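/- Let $\mathbb{K}$ be an algebraically closed field of characteristic $p>0$, $G$ a connected reductive algebraic group over $\mathbb{K}$, $T\subseteq B$ a maximal torus and a Borel subgroup of $G$, $X=X(T)$ the character group, $\mathfrak{g},\mathfrak{h},\mathfrak{b}$ the Lie algebras of $G,T,B$, $R\subset X$ the set of roots, $R^+$ and $\Pi$ the positive and simple roots given by $B$. Fix a basis $\{e_\alpha, h_i \mid \alpha\in R,\ 1\le i\le d\}$ of $\mathfrak{g}$ with $e_\alpha\in\mathfrak{g}_\alpha$, $h_1,\dots,h_d$ a basis of $\mathfrak{h}$ and $h_i^{[p]}=h_i$. Let $\chi\in\mathfrak{g}^*$ be in standard Levi form with associated subset $I\subseteq\Pi$: $\chi(\mathfrak{b})=0$ and, for $\alpha\in R^+$, $\chi(e_{-\alpha})=1$ if $\alpha\in I$ and $\chi(e_{-\alpha})=0$ otherwise. Put $$U_\chi=U(\mathfrak{g})/\langle e_\alpha^p-\chi(e_\alpha)^p\mid\alpha\in R\rangle,\qquad U^0=U(\mathfrak{h}),$$ and let $U^0U^+\subseteq U_\chi$ be the subalgebra generated by $\mathfrak{h}$ and the $e_\alpha$ with $\alpha\in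 R^+$. Grade $U_\chi$ by $X/\mathbb{Z}I$ with $e_\alpha$ in degree $\alpha+\mathbb{Z}I$ and $\mathfrak{h}$ in degree $0$, and let $(U_\chi)_{\xi}^{w}$, for $w\in\mathfrak{h}^*$, be the subspace of $(U_\chi)_\xi$ on which $\mathfrak{h}$ acts by commutators with weight $w$. For $\mu\in X$ let $d\mu\in\mathfrak{h}^*$ be its differential and $\widetilde\mu$ the automorphism of $U^0$ with $\widetilde\mu(h)=h+d\mu(h)$ for $h\in\mathfrak{h}$. Let $A$ be a commutative Noetherian $U^0$-algebra with structure map $\pi:U^0\to A$. The category $\mathcal{C}_A$ has as objects the $U_\chi\otimes_{\mathbb{K}} A$-modules $M$ (written as left $U_\chi$- and right $A$-modules) with a decomposition $M=\bigoplus_{\xi\in X/\mathbb{Z}I}M_\xi$ such that: (A) $M_\xi A\subseteq M_\xi$; (B) only finitely many $M_\xi$ are nonzero, and each is finitely generated over $A$; (C) $(U_\chi)_\sigma M_\xi\subseteq M_{\sigma+\xi}$; (D) each $M_{\lambda+\mathbb{Z}I}$ has a decomposition $M_{\lambda+\mathbb{Z}I}=\bigoplus M_{\lambda+\mathbb{Z}I}^{d\mu}$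 over the $d\mu\in\mathfrak{h}^*$ with $\mu\in\lambda+\mathbb{Z}I+pX$, such that, for $m\in M_{\lambda+\mathbb{Z}I}^{d\mu}$, $sm=m\,\pi(\widetilde\mu(s))$ for $s\in U^0$, $e_\alpha m\in M_{\lambda+\alpha+\mathbb{Z}I}^{d(\mu+\alpha)}$ for $\alpha\in R$, and $ma\in M_{\lambda+\mathbb{Z}I}^{d\mu}$ for $a\in A$. Morphisms are the $U_\chi\otimes A$-homomorphisms that send $M_{\lambda+\mathbb{Z}I}^{d\mu}$ to $N_{\lambda+\mathbb{Z}I}^{d\mu}$. For $\lambda\in X$ let $A^\lambda$ be $A$ with $e_\alpha$ ($\alpha\in R^+$) acting as $0$ and $s\in U^0$ acting as multiplication by $\pi(\widetilde\lambda(s))$, and let $Z_{A,\chi}(\lambda)=U_\chi\otimes_{U^0U^+}A^\lambda$ be the baby Verma module, in which $Z_{A,\chi}(\lambda)_{\xi}^{w}$ is the image of $(U_\chi)_{\xi-\lambda}^{w-d\lambda}\otimes A$. Then for every object $M$ of $\mathcal{C}_A$ there are a projective object $Q$ of $\mathcal{C}_A$ and a surjective morphism $Q\to M$ in $\mathcal{C}_A$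 such that $Q$ has a $Z$-filtration, i.e. a finite chain $0=Q_0\subseteq Q_1\subseteq\cdots\subseteq Q_r=Q$ of submodules in $\mathcal{C}_A$ with $Q_i/Q_{i-1}\cong Z_{A,\chi}(\lambda_i)$ in $\mathcal{C}_A$ for some $\lambda_1,\dots,\lambda_r\in X$. -/

import Mathlib

open scoped TensorProduct MatrixGroups

universe u v

noncomputable section

namespace GradedLevi

attribute [local instance 100] LieRing.ofAssociativeRing

/-! ### Linear algebraic groups over an algebraically closed field

A linear algebraic group is a Zariski closed subgroup of `GL n K`.  Regular functions on `GL n K`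
are the polynomials in the entries of `g` (variables `Sum.inl (i, j)`) and of `g⁻¹`
(variables `Sum.inr (i, j)`). -/

section AlgebraicGroups

variable {K : Type u} [Field K] {n : ℕ}

/-- Index set of the coordinate functions: entries of `g` and entries of `g⁻¹`. -/
abbrev CoordIdx (n : ℕ) : Type := (Fin n × Fin n) ⊕ (Fin n × Fin n)

/-- Polynomials representing the regular functions on `GL n K`. -/
abbrev Coord (n : ℕ) (K : Type u) [Field K] : Type u := MvPolynomial (CoordIdx n) K

/-- The value at `g` of the regular function represented by `f`. -/
def evalAt (f : Coord n K) (g : GL (Fin n) K) : K :=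
  MvPolynomial.eval
    (Sum.elim (fun ij => (g : Matrix (Fin n) (Fin n) K) ij.1 ij.2)
      (fun ij => ((g⁻¹ : GL (Fin n) K) : Matrix (Fin n) (Fin n) K) ij.1 ij.2)) f

/-- Zariski closed subsets of `GL n K`. -/
def IsZClosed (Z : Set (GL (Fin n) K)) : Prop :=
  ∃ S : Set (Coord n K), ∀ g : GL (Fin n) K, g ∈ Z ↔ ∀ f ∈ S, evalAt f g = 0

/-- Connectedness in the Zariski topology (of a subset that contains some point). -/
def IsZConnected (Z : Set (GL (Fin n) K)) : Prop :=
  Z.Nonempty ∧ ∀ Z₁ Z₂ : Set (GL (Fin n) K), IsZClosed Z₁ → IsZClosed Z₂ →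
    Z ⊆ Z₁ ∪ Z₂ → Z ∩ Z₁ ∩ Z₂ = ∅ → Z ⊆ Z₁ ∨ Z ⊆ Z₂

/-- The ideal of the regular functions that vanish on `H`. -/
def vanishingIdeal (H : Subgroup (GL (Fin n) K)) : Ideal (Coord n K) where
  carrier := {f | ∀ g ∈ H, evalAt f g = 0}
  add_mem' := by
    intro a b ha hb g hg
    have h1 := ha g hg
    have h2 := hb g hg
    simp only [evalAt] at h1 h2 ⊢
    rw [map_add, h1, h2, add_zero]
  zero_mem' := by intro g _; simp [evalAt]
  smul_mem' := by
    intro c f hf g hg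
    have h1 := hf g hg
    simp only [evalAt] at h1 ⊢
    rw [smul_eq_mul, map_mul, h1, mul_zero]

/-- The left invariant derivation of the ring of regular functions on `GL n K` attached to a
matrix `x`: it sends `f` to `g ↦ (d/dε) f (g (1 + ε x))` at `ε = 0`. -/
def leftDer : Matrix (Fin n) (Fin n) K →ₗ[K] Derivation K (Coord n K) (Coord n K) where
  toFun x := MvPolynomial.mkDerivation K
    (Sum.elim
      (fun ij => ∑ k, MvPolynomial.C (x k ij.2) * MvPolynomial.X (Sum.inl (ij.1, k)))
      (fun ij => -∑ k, MvPolynomial.C (x ij.1 k) * MvPolynomial.X (Sum.inr (k, ij.2))))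
  map_add' x y := by
    apply MvPolynomial.derivation_ext
    intro v
    rw [Derivation.add_apply, MvPolynomial.mkDerivation_X, MvPolynomial.mkDerivation_X,
      MvPolynomial.mkDerivation_X]
    rcases v with ij | ij
    · simp only [Sum.elim_inl, Matrix.add_apply, map_add, add_mul, Finset.sum_add_distrib]
    · simp only [Sum.elim_inr, Matrix.add_apply, map_add, add_mul, Finset.sum_add_distrib, neg_add]
  map_smul' c x := by
    apply MvPolynomial.derivation_ext
    intro v
    rw [Derivation.smul_apply, MvPolynomial.mkDerivation_X, MvPolynomial.mkDerivation_X]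
    rcases v with ij | ij
    · simp only [Sum.elim_inl, Matrix.smul_apply, smul_eq_mul, map_mul, mul_assoc, RingHom.id_apply,
        MvPolynomial.smul_eq_C_mul, Finset.mul_sum]
    · simp only [Sum.elim_inr, Matrix.smul_apply, smul_eq_mul, map_mul, mul_assoc, RingHom.id_apply,
        MvPolynomial.smul_eq_C_mul, Finset.mul_sum, mul_neg]

theorem leftDer_inl (x : Matrix (Fin n) (Fin n) K) (i j : Fin n) :
    leftDer x (MvPolynomial.X (Sum.inl (i, j))) =
      ∑ k, MvPolynomial.C (x k j) * MvPolynomial.X (Sum.inl (i, k)) := by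
  simp [leftDer, MvPolynomial.mkDerivation_X]

theorem leftDer_inr (x : Matrix (Fin n) (Fin n) K) (i j : Fin n) :
    leftDer x (MvPolynomial.X (Sum.inr (i, j))) =
      -∑ k, MvPolynomial.C (x i k) * MvPolynomial.X (Sum.inr (k, j)) := by
  simp [leftDer, MvPolynomial.mkDerivation_X]

theorem leftDer_C_mul (x : Matrix (Fin n) (Fin n) K) (c : K) (f : Coord n K) :
    leftDer x (MvPolynomial.C c * f) = MvPolynomial.C c * leftDer x f := by
  rw [← MvPolynomial.smul_eq_C_mul, ← MvPolynomial.smul_eq_C_mul, Derivation.map_smul]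

theorem leftDer_lie (x y : Matrix (Fin n) (Fin n) K) : leftDer ⁅x, y⁆ = ⁅leftDer x, leftDer y⁆ := by
  apply MvPolynomial.derivation_ext
  rintro (⟨i, j⟩ | ⟨i, j⟩)
  · rw [Derivation.commutator_apply, Ring.lie_def, map_sub, Derivation.sub_apply]
    simp only [leftDer_inl, map_sum, leftDer_C_mul, Matrix.mul_apply, map_mul, Finset.sum_mul,
      Finset.mul_sum]
    refine congrArg₂ (· - ·) ?_ ?_
    · refine Finset.sum_comm.trans (Finset.sum_congr rfl fun _ _ => Finset.sum_congr rfl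
        fun _ _ => ?_)
      ring
    · refine Finset.sum_comm.trans (Finset.sum_congr rfl fun _ _ => Finset.sum_congr rfl
        fun _ _ => ?_)
      ring
  · rw [Derivation.commutator_apply, Ring.lie_def, map_sub, Derivation.sub_apply]
    simp only [leftDer_inr, map_neg, map_sum, leftDer_C_mul, Matrix.mul_apply, map_mul,
      Finset.sum_mul, Finset.mul_sum, mul_neg, Finset.sum_neg_distrib, neg_neg]
    rw [neg_sub_neg]
    refine congrArg₂ (· - ·) ?_ ?_
    · refine Finset.sum_comm.trans (Finset.sum_congr rfl fun _ _ => Finset.sum_congr rfl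
        fun _ _ => ?_)
      ring
    · refine Finset.sum_comm.trans (Finset.sum_congr rfl fun _ _ => Finset.sum_congr rfl
        fun _ _ => ?_)
      ring

/-- The Lie algebra of a closed subgroup `H` of `GL n K`, as a subalgebra of `𝔤𝔩 n`: the matrices
whose left invariant derivation preserves the ideal of `H`.  Its `p`-th power map is the `p`-th
power of matrices. -/
def lieAlg (H : Subgroup (GL (Fin n) K)) : LieSubalgebra K (Matrix (Fin n) (Fin n) K) where
  carrier := {x | ∀ f ∈ vanishingIdeal H, leftDer x f ∈ vanishingIdeal H}
  add_mem' := by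
    intro x y hx hy f hf
    rw [map_add, Derivation.add_apply]
    exact add_mem (hx f hf) (hy f hf)
  zero_mem' := by intro f _; simp
  smul_mem' := by
    intro c x hx f hf
    rw [map_smul, Derivation.smul_apply, MvPolynomial.smul_eq_C_mul]
    exact Ideal.mul_mem_left _ _ (hx f hf)
  lie_mem' := by
    intro x y hx hy f hf
    rw [leftDer_lie, Derivation.commutator_apply]
    exact sub_mem (hx _ (hy f hf)) (hy _ (hx f hf))

/-- A torus: a closed connected subgroup that is conjugate to a group of diagonal matrices. -/
def IsTorus (T : Subgroup (GL (Fin n) K)) : Prop :=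
  IsZClosed (T : Set (GL (Fin n) K)) ∧ IsZConnected (T : Set (GL (Fin n) K)) ∧
    ∃ c : GL (Fin n) K, ∀ t ∈ T, ((c * t * c⁻¹ : GL (Fin n) K) : Matrix (Fin n) (Fin n) K).IsDiag

/-- A maximal torus of `G`. -/
def IsMaximalTorus (T G : Subgroup (GL (Fin n) K)) : Prop :=
  T ≤ G ∧ IsTorus T ∧ ∀ T' : Subgroup (GL (Fin n) K), IsTorus T' → T' ≤ G → T ≤ T' → T' = T

/-- A Borel subgroup of `G`: a maximal closed connected solvable subgroup. -/
def IsBorel (B G : Subgroup (GL (Fin n) K)) : Prop :=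
  (B ≤ G ∧ IsZClosed (B : Set (GL (Fin n) K)) ∧ IsZConnected (B : Set (GL (Fin n) K)) ∧
    Group.IsSolvable B) ∧
  ∀ B' : Subgroup (GL (Fin n) K), B' ≤ G → IsZClosed (B' : Set (GL (Fin n) K)) →
    IsZConnected (B' : Set (GL (Fin n) K)) → Group.IsSolvable B' → B ≤ B' → B' = B

/-- A connected reductive group: closed, connected, and without nontrivial closed connected normal
unipotent subgroups. -/
def IsConnectedReductive (G : Subgroup (GL (Fin n) K)) : Prop :=
  IsZClosed (G : Set (GL (Fin n) K)) ∧ IsZConnected (G : Set (GL (Fin n) K)) ∧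
  ∀ N : Subgroup (GL (Fin n) K), N ≤ G → (N.subgroupOf G).Normal →
    IsZClosed (N : Set (GL (Fin n) K)) → IsZConnected (N : Set (GL (Fin n) K)) →
    (∀ g ∈ N, IsNilpotent ((g : Matrix (Fin n) (Fin n) K) - 1)) → N = ⊥

/-- The group `Hom(T, 𝔾ₘ)` of characters: the homomorphisms `T → Kˣ` that are regular functions
on `T` (written multiplicatively). -/
def charSubgroup (T : Subgroup (GL (Fin n) K)) : Subgroup (T →* Kˣ) where
  carrier := {μ | ∃ f : Coord n K, ∀ t : T, (μ t : K) = evalAt f (t : GL (Fin n) K)}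
  mul_mem' := by
    rintro μ ν ⟨f, hf⟩ ⟨g, hg⟩
    refine ⟨f * g, fun t => ?_⟩
    rw [MonoidHom.mul_apply, Units.val_mul, hf, hg]
    simp [evalAt]
  one_mem' := ⟨1, fun t => by simp [evalAt]⟩
  inv_mem' := by
    rintro μ ⟨f, hf⟩
    refine ⟨MvPolynomial.rename Sum.swap f, fun t => ?_⟩
    rw [MonoidHom.inv_apply, ← map_inv, hf]
    simp only [evalAt, MvPolynomial.eval_rename]
    congr 1
    congr 1
    funext ij
    rcases ij with ij | ij <;> simp

/-- The character group `X(T)`, written additively. -/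
abbrev CharLattice (T : Subgroup (GL (Fin n) K)) : Type u := Additive (charSubgroup T)

/-- The value `μ(t)` of a character. -/
def CharLattice.val {T : Subgroup (GL (Fin n) K)} (μ : CharLattice T) (t : T) : Kˣ :=
  (Additive.toMul (α := charSubgroup T) μ).1 t

/-- A polynomial that represents the character `μ` on `T`. -/
def CharLattice.rep {T : Subgroup (GL (Fin n) K)} (μ : CharLattice T) : Coord n K :=
  (Additive.toMul (α := charSubgroup T) μ).2.choose

/-- The differential at `1` of a character `μ`, evaluated at a matrix `x`; for `x` in the Lie
algebra of `T` it does not depend on the polynomial that represents `μ` on `T`. -/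
def CharLattice.differential {T : Subgroup (GL (Fin n) K)} (μ : CharLattice T) :
    Matrix (Fin n) (Fin n) K →ₗ[K] K where
  toFun x := evalAt (leftDer x μ.rep) 1
  map_add' x y := by simp [evalAt]
  map_smul' c x := by simp [evalAt]

/-- A cocharacter of `T`: a homomorphism `Kˣ → T` whose matrix entries are Laurent polynomials. -/
def IsCocharacter {T : Subgroup (GL (Fin n) K)} (φ : Kˣ →* T) : Prop :=
  ∀ i j : Fin n, ∃ (q : Polynomial K) (m : ℕ), ∀ c : Kˣ,
    ((φ c : GL (Fin n) K) : Matrix (Fin n) (Fin n) K) i j * (c : K) ^ m = q.eval (c : K)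

/-- The weight space of weight `μ` for the adjoint action of `T` on the Lie algebra of `G`. -/
def weightSpace (G T : Subgroup (GL (Fin n) K)) (μ : CharLattice T) :
    Submodule K (Matrix (Fin n) (Fin n) K) where
  carrier := {x | x ∈ lieAlg G ∧ ∀ t : T,
    ((t : GL (Fin n) K) : Matrix (Fin n) (Fin n) K) * x *
      (((t : GL (Fin n) K)⁻¹ : GL (Fin n) K) : Matrix (Fin n) (Fin n) K) = (μ.val t : K) • x}
  add_mem' := by
    rintro x y ⟨hx, hx'⟩ ⟨hy, hy'⟩
    exact ⟨add_mem hx hy, fun t => by rw [mul_add, add_mul, hx', hy', smul_add]⟩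
  zero_mem' := ⟨zero_mem _, fun t => by simp⟩
  smul_mem' := by
    rintro c x ⟨hx, hx'⟩
    refine ⟨(lieAlg G).smul_mem c hx, fun t => ?_⟩
    rw [Matrix.mul_smul, Matrix.smul_mul, hx', smul_comm]

/-- The roots of `G` with respect to `T`: the nonzero weights of `T` on the Lie algebra of `G`. -/
def Roots (G T : Subgroup (GL (Fin n) K)) : Type u :=
  {α : CharLattice T // α ≠ 0 ∧ weightSpace G T α ≠ ⊥}

end AlgebraicGroups

/-! ### The standard notation attached to a connected reductive group -/

/-- A connected reductive group `G` over `K` with a maximal torus `T`, a Borel subgroup `B`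
containing `T`, the root datum of `(G, T)`, the set of simple roots given by `B`, and a basis of
the Lie algebra that consists of root vectors and of toral elements `h` with `h ^ [p] = h`. -/
structure ReductiveGroup (K : Type u) [Field K] (p : ℕ) where
  n : ℕ
  G : Subgroup (GL (Fin n) K)
  T : Subgroup (GL (Fin n) K)
  B : Subgroup (GL (Fin n) K)
  isConnectedReductive : IsConnectedReductive G
  isMaximalTorus : IsMaximalTorus T G
  isBorel : IsBorel B G
  T_le_B : T ≤ B
  /-- The coroot of a root, a cocharacter of `T` with values in the derived subgroup of `G`. -/
  coroot : Roots G T → (Kˣ →* T)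
  isCocharacter_coroot : ∀ α, IsCocharacter (coroot α)
  coroot_mem : ∀ α c, (coroot α c : GL (Fin n) K) ∈ ⁅G, G⁆
  /-- The (reduced) root datum of `(G, T)`; the cocharacter lattice is written as `Hom(X(T), ℤ)`. -/
  rootDatum : RootDatum (Roots G T) (CharLattice T) (Module.Dual ℤ (CharLattice T))
  pairing_apply : ∀ μ y, rootDatum.toLinearMap μ y = y μ
  root_apply : ∀ α, rootDatum.root α = α.1
  coroot_apply : ∀ α μ c, μ.val (coroot α c) = c ^ (rootDatum.coroot α μ)
  isReduced : rootDatum.IsReduced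
  /-- The simple roots. -/
  base : rootDatum.Base
  /-- The positive roots are the roots of `B`. -/
  pos_iff : ∀ α : Roots G T,
    rootDatum.root α ∈ AddSubmonoid.closure (rootDatum.root '' base.support) ↔
      weightSpace G T α.1 ≤ (lieAlg B).toSubmodule
  d : ℕ
  /-- The basis of the Lie algebra of `G`: root vectors and a basis of the Lie algebra of `T`. -/
  basis : Module.Basis (Roots G T ⊕ Fin d) K (lieAlg G)
  basis_root : ∀ α, (basis (Sum.inl α) : Matrix (Fin n) (Fin n) K) ∈ weightSpace G T α.1
  span_basis_torus : Submodule.span K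
    (Set.range fun i => (basis (Sum.inr i) : Matrix (Fin n) (Fin n) K)) = (lieAlg T).toSubmodule
  basis_torus_pow : ∀ i, (basis (Sum.inr i) : Matrix (Fin n) (Fin n) K) ^ p = basis (Sum.inr i)

namespace ReductiveGroup

variable {K : Type u} [Field K] {p : ℕ} (S : ReductiveGroup K p)

/-- The character lattice `X = X(T)`. -/
abbrev X : Type u := CharLattice S.T

/-- The set `R` of roots. -/
abbrev R : Type u := Roots S.G S.T

/-- The Lie algebra `𝔤` of `G`. -/
abbrev g : Type u := lieAlg S.G

/-- The Lie algebra `𝔥` of `T`, as a subalgebra of `𝔤`. -/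
def h : LieSubalgebra K S.g := (lieAlg S.T).comap (lieAlg S.G).incl

/-- The root vector `e_α`. -/
def e (α : S.R) : S.g := S.basis (Sum.inl α)

/-- The positive roots. -/
def IsPos (α : S.R) : Prop :=
  S.rootDatum.root α ∈ AddSubmonoid.closure (S.rootDatum.root '' S.base.support)

/-- The differential `dμ ∈ 𝔥*` of a character `μ`. -/
def diff (μ : S.X) : Module.Dual K S.h :=
  μ.differential.comp ((lieAlg S.G).toSubmodule.subtype.comp S.h.toSubmodule.subtype)

/-- `χ` is in standard Levi form with associated set `I` of simple roots. -/
def IsStandardLeviForm (χ : Module.Dual K S.g) (I : Set S.R) : Prop :=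
  I ⊆ S.base.support ∧
  (∀ x : S.g, (x : Matrix (Fin S.n) (Fin S.n) K) ∈ lieAlg S.B → χ x = 0) ∧
  ∀ α β : S.R, S.IsPos α → β.1 = -α.1 → (α ∈ I → χ (S.e β) = 1) ∧ (α ∉ I → χ (S.e β) = 0)

/-- The subgroup `ℤI` of `X`. -/
def ZI (I : Set S.R) : AddSubgroup S.X := AddSubgroup.closure (Subtype.val '' I)

/-- The quotient group `X/ℤI`. -/
abbrev XI (I : Set S.R) : Type u := S.X ⧸ S.ZI I

/-! ### The algebra `U_χ` and its grading -/

/-- The defining relations `e_α ^ p = χ(e_α) ^ p` of `U_χ`. -/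
inductive URel (χ : Module.Dual K S.g) :
    UniversalEnvelopingAlgebra K S.g → UniversalEnvelopingAlgebra K S.g → Prop
  | pow (α : S.R) : URel χ (UniversalEnvelopingAlgebra.ι K (S.e α) ^ p)
      (algebraMap K _ (χ (S.e α) ^ p))

/-- The algebra `U_χ = U(𝔤)/⟨e_α ^ p - χ(e_α) ^ p⟩`. -/
def U (χ : Module.Dual K S.g) : Type u := RingQuot (S.URel χ)

instance (χ : Module.Dual K S.g) : Ring (S.U χ) := inferInstanceAs (Ring (RingQuot (S.URel χ)))

instance (χ : Module.Dual K S.g) : Algebra K (S.U χ) :=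
  inferInstanceAs (Algebra K (RingQuot (S.URel χ)))

/-- The quotient map `U(𝔤) → U_χ`. -/
def toU (χ : Module.Dual K S.g) : UniversalEnvelopingAlgebra K S.g →ₐ[K] S.U χ :=
  RingQuot.mkAlgHom K (S.URel χ)

/-- The image in `U_χ` of an element of `𝔤`. -/
def ofLie (χ : Module.Dual K S.g) (x : S.g) : S.U χ := S.toU χ (UniversalEnvelopingAlgebra.ι K x)

/-- `u` is a product of root vectors `e_α` (of degree `α + ℤI`) and elements of `𝔥`
(of degree `0`), of total degree `ξ`. -/
inductive IsMonomial (χ : Module.Dual K S.g) (I : Set S.R) : S.XI I → S.U χ → Prop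
  | one : IsMonomial χ I 0 1
  | root (α : S.R) {ξ : S.XI I} {u : S.U χ} (hu : IsMonomial χ I ξ u) :
      IsMonomial χ I (QuotientAddGroup.mk α.1 + ξ) (S.ofLie χ (S.e α) * u)
  | torus (x : S.h) {ξ : S.XI I} {u : S.U χ} (hu : IsMonomial χ I ξ u) :
      IsMonomial χ I ξ (S.ofLie χ x * u)

/-- The graded piece `(U_χ)_ξ` for `ξ ∈ X/ℤI`. -/
def Ugr (χ : Module.Dual K S.g) (I : Set S.R) (ξ : S.XI I) : Submodule K (S.U χ) :=
  Submodule.span K {u | S.IsMonomial χ I ξ u}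

/-- The subspace `(U_χ)_ξ ^ w` of `(U_χ)_ξ` on which `𝔥` acts (by commutators) with weight `w`. -/
def Uwt (χ : Module.Dual K S.g) (I : Set S.R) (ξ : S.XI I) (w : Module.Dual K S.h) :
    Submodule K (S.U χ) where
  carrier := {u | u ∈ S.Ugr χ I ξ ∧
    ∀ x : S.h, S.ofLie χ x * u - u * S.ofLie χ x = w x • u}
  add_mem' := by
    rintro a b ⟨ha, ha'⟩ ⟨hb, hb'⟩
    refine ⟨add_mem ha hb, fun x => ?_⟩
    rw [smul_add, ← ha', ← hb', mul_add, add_mul]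
    abel
  zero_mem' := ⟨zero_mem _, fun x => by simp⟩
  smul_mem' := by
    rintro c a ⟨ha, ha'⟩
    refine ⟨Submodule.smul_mem _ c ha, fun x => ?_⟩
    rw [mul_smul_comm, smul_mul_assoc, ← smul_sub, ha', smul_comm]

/-- The algebra `U⁰ = U(𝔥)`. -/
abbrev U0 : Type u := UniversalEnvelopingAlgebra K S.h

/-- The weights that occur in degree `ξ = λ + ℤI`: the `dμ` with `μ ∈ λ + ℤI + pX`. -/
def weightsOf (I : Set S.R) (ξ : S.XI I) : Set (Module.Dual K S.h) :=
  {w | ∃ μ τ : S.X, (QuotientAddGroup.mk (μ - p • τ) : S.XI I) = ξ ∧ w = S.diff μ}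

end ReductiveGroup

/-! ### The category `𝒞_A` -/

section Category

variable {K : Type u} [Field K] {p : ℕ} (S : ReductiveGroup K p) (χ : Module.Dual K S.g)
  (I : Set S.R) {A : Type v} [CommRing A] [Algebra K A] (π : S.U0 →ₐ[K] A)

/-- The objects of `𝒞_A`: modules over `U_χ ⊗ A` with an `X/ℤI`-grading `gr` and decompositions
`wt` of the graded pieces.  The action of `a ∈ A` is that of `1 ⊗ a`, the action of `u ∈ U_χ` is
that of `u ⊗ 1`. -/
structure CA where
  carrier : Type (max u v)
  [addCommGroup : AddCommGroup carrier]
  [module : Module (S.U χ ⊗[K] A) carrier]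
  /-- `M_{λ+ℤI}` -/
  gr : S.XI I → AddSubgroup carrier
  /-- `M_{λ+ℤI}^{dμ}` -/
  wt : S.XI I → Module.Dual K S.h → AddSubgroup carrier
  gr_indep : iSupIndep gr
  gr_top : ⨆ ξ, gr ξ = ⊤
  /-- the action of `A` preserves the grading -/
  gr_smul : ∀ ξ (a : A), ∀ m ∈ gr ξ, ((1 : S.U χ) ⊗ₜ[K] a) • m ∈ gr ξ
  /-- finitely many nonzero pieces, each finitely generated over `A` -/
  gr_finite : {ξ | gr ξ ≠ ⊥}.Finite
  gr_fg : ∀ ξ, ∃ s : Finset carrier, gr ξ =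
    AddSubgroup.closure {y | ∃ m ∈ s, ∃ a : A, y = ((1 : S.U χ) ⊗ₜ[K] a) • m}
  /-- compatibility with the grading of `U_χ` -/
  gr_mul : ∀ σ ξ, ∀ u ∈ S.Ugr χ I σ, ∀ m ∈ gr ξ, (u ⊗ₜ[K] (1 : A)) • m ∈ gr (σ + ξ)
  /-- the decomposition of `M_ξ`, whose index set is `weightsOf` -/
  wt_eq_bot : ∀ ξ w, w ∉ S.weightsOf I ξ → wt ξ w = ⊥
  wt_indep : ∀ ξ, iSupIndep (wt ξ)
  wt_iSup : ∀ ξ, ⨆ w, wt ξ w = gr ξ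
  /-- `h m = m π(h + dμ(h))` for `h ∈ 𝔥`; since `𝔥` generates `U⁰`, this is `s m = m π(μ~(s))` for
  all `s ∈ U⁰`, where `μ~` is the automorphism of `U⁰` with `μ~(h) = h + dμ(h)` -/
  wt_torus : ∀ ξ (μ : S.X) (x : S.h), ∀ m ∈ wt ξ (S.diff μ),
    (S.ofLie χ x ⊗ₜ[K] (1 : A)) • m =
      ((1 : S.U χ) ⊗ₜ[K]
        π (UniversalEnvelopingAlgebra.ι K x + algebraMap K _ (S.diff μ x))) • m
  wt_root : ∀ ξ (μ : S.X) (α : S.R), ∀ m ∈ wt ξ (S.diff μ),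
    (S.ofLie χ (S.e α) ⊗ₜ[K] (1 : A)) • m ∈
      wt (ξ + QuotientAddGroup.mk α.1) (S.diff (μ + α.1))
  wt_smul : ∀ ξ w (a : A), ∀ m ∈ wt ξ w, ((1 : S.U χ) ⊗ₜ[K] a) • m ∈ wt ξ w

namespace CA

attribute [instance] CA.addCommGroup CA.module

variable {S χ I π}

/-- The morphisms of `𝒞_A`: homomorphisms of `U_χ ⊗ A`-modules that send `M_{λ+ℤI}^{dμ}` to
`N_{λ+ℤI}^{dμ}`. -/
@[ext]
structure Hom (M N : CA S χ I π) where
  toLinearMap : M.carrier →ₗ[S.U χ ⊗[K] A] N.carrier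
  map_wt : ∀ ξ w, ∀ m ∈ M.wt ξ w, toLinearMap m ∈ N.wt ξ w

instance : CategoryTheory.Category (CA S χ I π) where
  Hom M N := Hom M N
  id M := ⟨LinearMap.id, fun _ _ _ hm => hm⟩
  comp f g := ⟨g.toLinearMap.comp f.toLinearMap,
    fun ξ w m hm => g.map_wt ξ w _ (f.map_wt ξ w m hm)⟩

/-- The homomorphism of modules that underlies a morphism of `𝒞_A`. -/
def linearMap {M N : CA S χ I π} (f : M ⟶ N) : M.carrier →ₗ[S.U χ ⊗[K] A] N.carrier :=
  Hom.toLinearMap f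

end CA

/-! ### Baby Verma modules and `Z`-filtrations -/

/-- The defining relations of `Z_{A,χ}(μ) = U_χ ⊗_{U⁰U⁺} A^μ` as a quotient of `U_χ ⊗ A`: the left
ideal generated by `e_α ⊗ 1`, for `α` positive, and `h ⊗ 1 - 1 ⊗ π(h + dμ(h))`, for `h ∈ 𝔥`. -/
def babyVermaRel (μ : S.X) : Submodule (S.U χ ⊗[K] A) (S.U χ ⊗[K] A) :=
  Submodule.span _
    ({y | ∃ α : S.R, S.IsPos α ∧ y = S.ofLie χ (S.e α) ⊗ₜ[K] (1 : A)} ∪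
     {y | ∃ x : S.h, y = S.ofLie χ x ⊗ₜ[K] (1 : A) -
        (1 : S.U χ) ⊗ₜ[K]
          π (UniversalEnvelopingAlgebra.ι K x + algebraMap K _ (S.diff μ x))})

/-- The baby Verma module `Z_{A,χ}(μ) = U_χ ⊗_{U⁰U⁺} A^μ`, where `U⁰U⁺` is generated by `𝔥` and
the positive root vectors, and `A^μ = A` with `e_α` acting as `0` and `h` as `π(h + dμ(h))`. -/
abbrev BabyVerma (μ : S.X) : Type (max u v) := (S.U χ ⊗[K] A) ⧸ babyVermaRel S χ π μ

/-- The piece `Z_{A,χ}(μ)_ξ ^ w` of a baby Verma module: the image of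
`(U_χ)_{ξ - μ} ^ {w - dμ} ⊗ A`. -/
def babyVermaWt (μ : S.X) (ξ : S.XI I) (w : Module.Dual K S.h) :
    AddSubgroup (BabyVerma S χ π μ) :=
  AddSubgroup.closure {z | ∃ u ∈ S.Uwt χ I (ξ - QuotientAddGroup.mk μ) (w - S.diff μ), ∃ a : A,
    z = (babyVermaRel S χ π μ).mkQ (u ⊗ₜ[K] a)}

variable {S χ I π}

/-- `M ∈ 𝒞_A` has a `Z`-filtration: a chain `0 = F₀ ⊆ F₁ ⊆ ⋯ ⊆ Fᵣ = M` of submodules of `M` in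
`𝒞_A` (submodules that are the sum of their intersections with the pieces of `M`), such that each
`Fᵢ₊₁/Fᵢ`, with the induced pieces, is isomorphic to some `Z_{A,χ}(μ)`. -/
def CA.HasZFiltration (M : CA S χ I π) : Prop :=
  ∃ (r : ℕ) (F : Fin (r + 1) → Submodule (S.U χ ⊗[K] A) M.carrier),
    Monotone F ∧ F 0 = ⊥ ∧ F (Fin.last r) = ⊤ ∧
    (∀ i, (F i).toAddSubgroup = ⨆ ξ, ⨆ w, (F i).toAddSubgroup ⊓ M.wt ξ w) ∧
    ∀ i : Fin r, ∃ (μ : S.X)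
      (φ : (F i.succ ⧸ (F i.castSucc).submoduleOf (F i.succ)) ≃ₗ[S.U χ ⊗[K] A]
        BabyVerma S χ π μ),
      ∀ ξ w (z : BabyVerma S χ π μ), z ∈ babyVermaWt S χ I π μ ξ w ↔
        ∃ y : F i.succ, (y : M.carrier) ∈ M.wt ξ w ∧ φ (Submodule.Quotient.mk y) = z

end Category

end GradedLevi

end

noncomputable section

namespace GradedLevi

attribute [local instance 100] LieRing.ofAssociativeRing
attribute [local instance] Algebra.TensorProduct.rightAlgebra

section

/-! ### The Poincaré–Birkhoff–Witt theorem -/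

section PBW

variable {K : Type*} [CommRing K] {L : Type*} [LieRing L] [LieAlgebra K L]
  {ι : Type*} [LinearOrder ι] (b : Module.Basis ι K L)

set_option linter.unusedSectionVars false

namespace PBW

/-! Consider the modules Q(μ) = U_χ ⊗_{U⁰} A^μ, induced from the torus part alone rather than from
U⁰U⁺. A morphism from Q(μ) to M is the same as a vector of M of degree μ + ℤI and weight dμ
(`CA.exists_freeHom`). Epimorphisms of 𝒞_A are surjective, because cokernels exist, and hence
surjective on every piece, because the pieces are independent; so finite sums of the Q(μ) are
projective (`CA.projective_free`). Every nonzero piece of M is of the form (μ + ℤI, dμ), because d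
kills pX, and M is generated over A by finitely many vectors from its pieces
(`CA.exists_generators`). So a finite sum of modules Q(μ) maps onto M.

For the filtration, Q(μ) is free over A on the products of restricted monomials, first in the
negative and then in the positive root vectors, applied to the generator (`ReductiveGroup.qbasis`).
Let v_b be the generator multiplied by the positive monomial with exponents b. A positive root
vector sends v_b into the span of the v_{b'} of strictly larger height: straightening adds heights,
and monomials with an exponent ≥ p vanish because χ is zero on positive root vectors
(`ReductiveGroup.e_mul_ordU_posM_mem`). List the v_b by decreasing height and let F_i be generated
by the first i of them. Modulo F_i the next vector is a highest weight vector, and its products with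
the negative monomials form an A-basis of F_{i+1}/F_i. The universal map from the baby Verma module
is therefore an isomorphism (`ZBasis.exists_equiv`).

Freeness rests on the Poincaré–Birkhoff–Witt theorem (`PBW.basis`), proved by letting 𝔤 act on
commutative polynomials. Since pα is neither a root nor 0, e_α^[p] = 0 and e_α^p is central in U(𝔤)
(`ReductiveGroup.commute_e_pow`). Splitting p-th powers and torus factors off the ordered monomials
thus defines a map to a free A-module that kills all relations. The grading survives e_α^p =
χ(e_α)^p because χ(e_α) ≠ 0 forces α ∈ ℤI, and the weights survive because d(pα) = 0. -/

/-- Multiplication of a commutative monomial by a variable. -/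
def cons (K : Type*) [CommRing K] {ι : Type*} (i : ι) : (Multiset ι →₀ K) →ₗ[K] (Multiset ι →₀ K) :=
  Finsupp.lmapDomain K K (i ::ₘ ·)

@[simp] theorem cons_single (i : ι) (M : Multiset ι) (c : K) :
    cons K i (Finsupp.single M c) = Finsupp.single (i ::ₘ M) c := by
  simp [cons]

/-- Approximations, correct in degrees at most `n`, to the action of the basis vectors of `L` on
commutative monomials. -/
def approx : ℕ → ι → (Multiset ι →₀ K) →ₗ[K] (Multiset ι →₀ K)
  | 0, i => cons K i
  | n + 1, i => cons K i + Finsupp.linearCombination K fun M : Multiset ι =>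
      match M.sort with
      | [] => 0
      | j :: l => if i ≤ j then 0 else
          approx n j (approx n i (Finsupp.single (l : Multiset ι) 1) -
            cons K i (Finsupp.single (l : Multiset ι) 1)) +
          (b.repr ⁅b i, b j⁆).sum fun k c => c • approx n k (Finsupp.single (l : Multiset ι) 1)

/-- The commutative polynomials of degree at most `n`. -/
def degLE (K : Type*) [CommRing K] (ι : Type*) (n : ℕ) : Submodule K (Multiset ι →₀ K) :=
  Finsupp.supported K K {M | M.card ≤ n}

theorem single_mem_degLE {M : Multiset ι} {n : ℕ} (h : M.card ≤ n) (c : K) :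
    Finsupp.single M c ∈ degLE K ι n :=
  Finsupp.single_mem_supported K c h

theorem degLE_mono {m n : ℕ} (h : m ≤ n) : degLE K ι m ≤ degLE K ι n :=
  Finsupp.supported_mono fun _ hM => le_trans hM h

/-- A linear statement about commutative polynomials may be checked on monomials. -/
theorem supported_induction {s : Set (Multiset ι)} {N : Submodule K (Multiset ι →₀ K)}
    (h : ∀ M ∈ s, Finsupp.single M 1 ∈ N) : Finsupp.supported K K s ≤ N := by
  rw [Finsupp.supported_eq_span_single, Submodule.span_le]
  rintro _ ⟨M, hM, rfl⟩
  exact h M hM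

theorem sort_cons_le {M : Multiset ι} {j : ι} {l : List ι} (h : M.sort = j :: l) :
    (∀ k ∈ l, j ≤ k) ∧ M = j ::ₘ (l : Multiset ι) := by
  have h1 := M.pairwise_sort (· ≤ ·)
  rw [h, List.pairwise_cons] at h1
  refine ⟨h1.1, ?_⟩
  rw [← M.sort_eq (· ≤ ·), h, Multiset.cons_coe]

theorem sort_cons {j : ι} {N : Multiset ι} (h : ∀ k ∈ N, j ≤ k) :
    (j ::ₘ N).sort = j :: N.sort := Multiset.sort_cons j N (· ≤ ·) h

theorem approx_succ_of_le (n : ℕ) {i : ι} {M : Multiset ι} (h : ∀ k ∈ M, i ≤ k) :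
    approx b n i (Finsupp.single M 1) = Finsupp.single (i ::ₘ M) 1 := by
  cases n with
  | zero => simp [approx]
  | succ n =>
    simp only [approx, LinearMap.add_apply, cons_single, Finsupp.linearCombination_single, one_smul]
    rcases hM : M.sort with _ | ⟨j, l⟩
    · simp only [hM, add_zero]
    · have hj := (sort_cons_le hM).2
      simp only [hM, h j (by simp [hj]), if_true, add_zero]

/-- The formula is forced by e_i e_j z_N = e_j e_i z_N + [e_i, e_j] z_N: write e_i z_N as z_{iN}
plus terms of lower degree and note that e_j z_{iN} = z_{jiN}, j being minimal. -/
theorem approx_succ_of_lt (n : ℕ) {i j : ι} (hij : j < i) {N : Multiset ι} (h : ∀ k ∈ N, j ≤ k) :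
    approx b (n + 1) i (Finsupp.single (j ::ₘ N) 1) = Finsupp.single (i ::ₘ j ::ₘ N) 1 +
      (approx b n j (approx b n i (Finsupp.single N 1) - Finsupp.single (i ::ₘ N) 1) +
        (b.repr ⁅b i, b j⁆).sum fun k c => c • approx b n k (Finsupp.single N 1)) := by
  simp only [approx, LinearMap.add_apply, cons_single, Finsupp.linearCombination_single, one_smul,
    sort_cons h, not_le.2 hij, if_false, Multiset.sort_eq]

/-- The two clauses of the recursion: either i may be put in front, or the smallest variable of M
lies below i. -/
theorem monomial_cases (i : ι) (M : Multiset ι) :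
    (∀ k ∈ M, i ≤ k) ∨ ∃ j N, j < i ∧ (∀ k ∈ N, j ≤ k) ∧ M = j ::ₘ N := by
  rcases hM : M.sort with _ | ⟨j, l⟩
  · left
    have := M.sort_eq (· ≤ ·)
    rw [hM] at this
    simp [← this]
  · obtain ⟨h1, rfl⟩ := sort_cons_le hM
    rcases le_or_gt i j with h | h
    · left
      simp only [Multiset.mem_cons, Multiset.mem_coe]
      rintro k (rfl | hk)
      exacts [h, h.trans (h1 k hk)]
    · exact Or.inr ⟨j, l, h, by simpa using h1, rfl⟩

/-- The leading term of the action is commutative multiplication. This degree bound is what makes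
all later inductions on the degree close. -/
theorem approx_sub_mem (n : ℕ) : ∀ (i : ι) (M : Multiset ι),
    approx b n i (Finsupp.single M 1) - Finsupp.single (i ::ₘ M) 1 ∈ degLE K ι M.card := by
  induction n with
  | zero => intro i M; simp [approx]
  | succ n ih =>
    have ih' : ∀ (i : ι) (d : ℕ) (x), x ∈ degLE K ι d → approx b n i x ∈ degLE K ι (d + 1) := by
      intro i d x hx
      refine supported_induction (N := (degLE K ι (d + 1)).comap (approx b n i))
        (fun M hM => ?_) hx
      rw [Submodule.mem_comap, ← sub_add_cancel (approx b n i _) (Finsupp.single (i ::ₘ M) 1)]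
      have hM : M.card ≤ d := hM
      exact add_mem (degLE_mono (by lia) (ih i M)) (single_mem_degLE (by simpa using hM) 1)
    intro i M
    rcases monomial_cases i M with h | ⟨j, N, hij, h, rfl⟩
    · rw [approx_succ_of_le b _ h, sub_self]
      exact zero_mem _
    · rw [approx_succ_of_lt b n hij h, add_sub_cancel_left, Multiset.card_cons]
      refine add_mem (ih' _ _ _ (ih i N)) ?_
      exact Submodule.sum_mem _ fun k _ => Submodule.smul_mem _ _
        (ih' _ _ _ (single_mem_degLE le_rfl 1))

/-- Each level of the recursion calls the previous one only on polynomials of smaller degree, so the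
approximations stabilise degree by degree and `act` is their common value. -/
theorem approx_eq (d : ℕ) : ∀ (n m : ℕ) (_ : d ≤ n) (_ : d ≤ m) (i : ι) (x : Multiset ι →₀ K)
    (_ : x ∈ degLE K ι d), approx b n i x = approx b m i x := by
  induction d with
  | zero =>
    intro n m _ _ i x hx
    refine supported_induction (N := LinearMap.eqLocus (approx b n i) (approx b m i))
      (fun M hM => ?_) hx
    have hM : M = 0 := by simpa using hM
    subst hM
    rw [LinearMap.mem_eqLocus, approx_succ_of_le b _ (by simp), approx_succ_of_le b _ (by simp)]
  | succ d ih =>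
    intro n m hn hm i x hx
    refine supported_induction (N := LinearMap.eqLocus (approx b n i) (approx b m i))
      (fun M hM => ?_) hx
    rw [LinearMap.mem_eqLocus]
    obtain ⟨n, rfl⟩ : ∃ n', n = n' + 1 := ⟨n - 1, by lia⟩
    obtain ⟨m, rfl⟩ : ∃ n', m = n' + 1 := ⟨m - 1, by lia⟩
    rcases monomial_cases i M with h | ⟨j, N, hij, h, rfl⟩
    · rw [approx_succ_of_le b _ h, approx_succ_of_le b _ h]
    · have hN : N.card ≤ d := by simpa using hM
      have key : ∀ k, approx b n k (Finsupp.single N 1) = approx b m k (Finsupp.single N 1) :=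
        fun k => ih n m (by lia) (by lia) k _ (single_mem_degLE hN 1)
      rw [approx_succ_of_lt b n hij h, approx_succ_of_lt b m hij h]
      simp only [key]
      rw [ih n m (by lia) (by lia) j _ (degLE_mono hN (approx_sub_mem b m i N))]

/-- The action of the basis vectors of `L` on commutative polynomials. -/
def act (i : ι) : (Multiset ι →₀ K) →ₗ[K] (Multiset ι →₀ K) :=
  Finsupp.linearCombination K fun M => approx b M.card i (Finsupp.single M 1)

theorem act_eq_approx (n : ℕ) (i : ι) {x : Multiset ι →₀ K} (hx : x ∈ degLE K ι n) :
    act b i x = approx b n i x := by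
  refine supported_induction (N := LinearMap.eqLocus (act b i) (approx b n i))
    (fun M hM => ?_) hx
  rw [LinearMap.mem_eqLocus, act, Finsupp.linearCombination_single, one_smul]
  exact approx_eq b M.card _ _ le_rfl hM i _ (single_mem_degLE le_rfl 1)

/-- The action of `L` on commutative polynomials. -/
def actL : L →ₗ[K] (Multiset ι →₀ K) →ₗ[K] (Multiset ι →₀ K) := b.constr K (act b)

@[simp] theorem actL_basis (i : ι) : actL b (b i) = act b i := b.constr_basis K _ i

theorem act_of_le {i : ι} {M : Multiset ι} (h : ∀ k ∈ M, i ≤ k) :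
    act b i (Finsupp.single M 1) = Finsupp.single (i ::ₘ M) 1 := by
  rw [act_eq_approx b M.card i (single_mem_degLE le_rfl 1), approx_succ_of_le b _ h]

theorem act_sub_mem (i : ι) (M : Multiset ι) :
    act b i (Finsupp.single M 1) - Finsupp.single (i ::ₘ M) 1 ∈ degLE K ι M.card := by
  rw [act_eq_approx b M.card i (single_mem_degLE le_rfl 1)]
  exact approx_sub_mem b _ i M

/-- This case of the commutation relation is built into the definition: j is minimal, so e_j z_N =
z_{jN}, and the recursion for e_i on that monomial is the relation. -/
theorem act_act_of_lt {i j : ι} (hij : j < i) {N : Multiset ι} (h : ∀ k ∈ N, j ≤ k) :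
    act b i (act b j (Finsupp.single N 1)) =
      act b j (act b i (Finsupp.single N 1)) + actL b ⁅b i, b j⁆ (Finsupp.single N 1) := by
  have hN : Finsupp.single N (1 : K) ∈ degLE K ι N.card := single_mem_degLE le_rfl 1
  rw [act_of_le b h, act_eq_approx b (N.card + 1) i (single_mem_degLE (by simp) 1),
    approx_succ_of_lt b _ hij h, ← act_eq_approx b _ _ (approx_sub_mem b _ i N),
    ← act_eq_approx b _ i hN, map_sub, act_of_le b (i := j) (M := i ::ₘ N), actL,
    Module.Basis.constr_apply, Multiset.cons_swap i j]
  · simp only [← act_eq_approx b _ _ hN, Finsupp.sum, LinearMap.sum_apply, LinearMap.smul_apply]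
    abel
  · simp only [Multiset.mem_cons]
    rintro k (rfl | hk)
    exacts [hij.le, h k hk]

/-- Bilinearity in X and Y. The vector x stays fixed so that the statement can be used one degree at
a time. -/
theorem actL_comm_of_act_comm {x : Multiset ι →₀ K}
    (h : ∀ i j, act b i (act b j x) = act b j (act b i x) + actL b ⁅b i, b j⁆ x) (X Y : L) :
    actL b X (actL b Y x) = actL b Y (actL b X x) + actL b ⁅X, Y⁆ x := by
  have hX : X ∈ Submodule.span K (Set.range b) := b.mem_span X
  have hY : Y ∈ Submodule.span K (Set.range b) := b.mem_span Y
  induction hX using Submodule.span_induction with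
  | zero => simp
  | add X X' _ _ hX hX' =>
    simp only [map_add, LinearMap.add_apply, add_lie, hX, hX']
    abel
  | smul c X _ hX => simp only [map_smul, LinearMap.smul_apply, smul_lie, hX, smul_add]
  | mem _ hi =>
    obtain ⟨i, rfl⟩ := hi
    induction hY using Submodule.span_induction with
    | zero => simp
    | add X X' _ _ hX hX' =>
      simp only [map_add, LinearMap.add_apply, lie_add, hX, hX']
      abel
    | smul c X _ hX => simp only [map_smul, LinearMap.smul_apply, lie_smul, hX, smul_add]
    | mem _ hj =>
      obtain ⟨j, rfl⟩ := hj
      simpa using h i j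

/-- If the smaller of i and j lies below all variables of M, this is `act_act_of_lt` up to sign.
Otherwise M = kN with k minimal, so z_M = e_k z_N. Pull e_k to the left in both e_i e_j e_k z_N and
e_j e_i e_k z_N; the remaining terms are of lower degree, and their double brackets cancel by the
Jacobi identity. -/
theorem act_comm (d : ℕ) : ∀ (i j : ι) (x : Multiset ι →₀ K) (_ : x ∈ degLE K ι d),
    act b i (act b j x) = act b j (act b i x) + actL b ⁅b i, b j⁆ x := by
  induction d using Nat.strong_induction_on with
  | _ d ih =>
  have symm : ∀ (i j : ι) (x : Multiset ι →₀ K),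
      act b i (act b j x) = act b j (act b i x) + actL b ⁅b i, b j⁆ x →
      act b j (act b i x) = act b i (act b j x) + actL b ⁅b j, b i⁆ x := by
    intro i j x h
    rw [h, ← lie_skew, map_neg, LinearMap.neg_apply]
    abel
  intro i j x hx
  refine supported_induction (N := LinearMap.eqLocus (act b i ∘ₗ act b j)
    (act b j ∘ₗ act b i + actL b ⁅b i, b j⁆)) (fun M hM => ?_) hx
  simp only [LinearMap.mem_eqLocus, LinearMap.comp_apply, LinearMap.add_apply]
  rcases lt_trichotomy i j with hij | rfl | hij
  · rcases monomial_cases i M with h | ⟨k, N, hk, h, rfl⟩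
    · exact symm _ _ _ (act_act_of_lt b hij h)
    · exact act_comm_aux d ih i j k N hk (hk.trans hij) h hM
  · simp
  · rcases monomial_cases j M with h | ⟨k, N, hk, h, rfl⟩
    · exact act_act_of_lt b hij h
    · exact act_comm_aux d ih i j k N (hk.trans hij) hk h hM
where
  act_comm_aux (d : ℕ) (ih : ∀ m < d, ∀ (i j : ι) (x : Multiset ι →₀ K) (_ : x ∈ degLE K ι m),
      act b i (act b j x) = act b j (act b i x) + actL b ⁅b i, b j⁆ x)
      (i j k : ι) (N : Multiset ι) (hi : k < i) (hj : k < j) (h : ∀ l ∈ N, k ≤ l)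
      (hN : (k ::ₘ N).card ≤ d) :
      act b i (act b j (Finsupp.single (k ::ₘ N) 1)) =
        act b j (act b i (Finsupp.single (k ::ₘ N) 1)) +
          actL b ⁅b i, b j⁆ (Finsupp.single (k ::ₘ N) 1) := by
    have hN' : N.card < d := by simpa using hN
    set z : Multiset ι →₀ K := Finsupp.single N 1 with hz
    have hzd : z ∈ degLE K ι N.card := single_mem_degLE le_rfl 1
    have ihL : ∀ (X Y : L) (y : Multiset ι →₀ K), y ∈ degLE K ι N.card →
        actL b X (actL b Y y) = actL b Y (actL b X y) + actL b ⁅X, Y⁆ y := fun X Y y hy =>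
      actL_comm_of_act_comm b (fun i j => ih _ hN' i j y hy) X Y
    have hk : Finsupp.single (k ::ₘ N) 1 = actL b (b k) z := by
      rw [actL_basis, hz, act_of_le b h]
    -- The induction hypothesis applies only to the lower part of e_j z_N. Its leading monomial
    -- z_{jN} has one degree too many, but there k is still minimal and `act_act_of_lt` applies.
    have swap : ∀ i j, k < i → k < j → actL b (b i) (actL b (b k) (actL b (b j) z)) =
        actL b (b k) (actL b (b i) (actL b (b j) z)) +
          actL b ⁅b i, b k⁆ (actL b (b j) z) := by
      intro i j hi hj
      have h1 := ihL (b i) (b k) _ (act_sub_mem b j N)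
      have h2 := act_act_of_lt b hi (N := j ::ₘ N) (by
        simp only [Multiset.mem_cons]
        rintro l (rfl | hl)
        exacts [hj.le, h l hl])
      simp only [← actL_basis] at h2
      rw [actL_basis b j, ← sub_add_cancel (act b j z) (Finsupp.single (j ::ₘ N) 1)]
      simp only [map_add] at h1 h2 ⊢
      rw [h1, h2]
      abel
    have expand : ∀ i j, k < i → k < j → actL b (b i) (actL b (b j) (actL b (b k) z)) =
        actL b (b k) (actL b (b i) (actL b (b j) z)) + actL b ⁅b i, b k⁆ (actL b (b j) z) +
          (actL b ⁅b j, b k⁆ (actL b (b i) z) + actL b ⁅b i, ⁅b j, b k⁆⁆ z) := by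
      intro i j hi hj
      rw [ihL (b j) (b k) z hzd, map_add, swap i j hi hj, ihL (b i) ⁅b j, b k⁆ z hzd]
    simp only [hk, ← actL_basis]
    rw [expand i j hi hj, expand j i hj hi, ihL _ (b k) z hzd, ihL (b i) (b j) z hzd, map_add,
      lie_lie (b i) (b j) (b k), map_sub, LinearMap.sub_apply]
    have h3 : actL b ⁅b k, ⁅b i, b j⁆⁆ z = - actL b ⁅⁅b i, b j⁆, b k⁆ z := by
      rw [← lie_skew, map_neg, LinearMap.neg_apply]
    abel

/-- The representation of `L` on commutative polynomials. -/
def actHom : L →ₗ⁅K⁆ Module.End K (Multiset ι →₀ K) where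
  toLinearMap := actL b
  map_lie' := by
    intro X Y
    refine LinearMap.ext fun x => ?_
    obtain ⟨d, hd⟩ : ∃ d, x ∈ degLE K ι d := by
      refine ⟨x.support.sup Multiset.card, ?_⟩
      rw [degLE, Finsupp.mem_supported]
      exact fun M hM => Finset.le_sup (f := Multiset.card) hM
    have := actL_comm_of_act_comm b (fun i j => act_comm b d i j x hd) X Y
    rw [Ring.lie_def]
    change actL b ⁅X, Y⁆ x = actL b X (actL b Y x) - actL b Y (actL b X x)
    rw [this, add_sub_cancel_left]

/-- The ordered monomials in the universal enveloping algebra. -/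
def ordMonomial (M : Multiset ι) : UniversalEnvelopingAlgebra K L :=
  ((M.sort).map fun i => UniversalEnvelopingAlgebra.ι K (b i)).prod

theorem ordMonomial_zero : ordMonomial b 0 = 1 := by simp [ordMonomial]

theorem ordMonomial_cons {i : ι} {M : Multiset ι} (h : ∀ k ∈ M, i ≤ k) :
    ordMonomial b (i ::ₘ M) = UniversalEnvelopingAlgebra.ι K (b i) * ordMonomial b M := by
  rw [ordMonomial, sort_cons h, List.map_cons, List.prod_cons, ordMonomial]

/-- The symmetrization map for ordered monomials. -/
def ordMap : (Multiset ι →₀ K) →ₗ[K] UniversalEnvelopingAlgebra K L :=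
  Finsupp.linearCombination K (ordMonomial b)

theorem ordMap_single (M : Multiset ι) : ordMap b (Finsupp.single M 1) = ordMonomial b M := by
  simp [ordMap]

theorem ordMap_actL_of_act {x : Multiset ι →₀ K}
    (h : ∀ i, ordMap b (act b i x) = UniversalEnvelopingAlgebra.ι K (b i) * ordMap b x) (X : L) :
    ordMap b (actL b X x) = UniversalEnvelopingAlgebra.ι K X * ordMap b x := by
  have hX : X ∈ Submodule.span K (Set.range b) := b.mem_span X
  induction hX using Submodule.span_induction with
  | zero => simp
  | add X X' _ _ hX hX' => simp only [map_add, LinearMap.add_apply, hX, hX', add_mul]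
  | smul c X _ hX => simp only [map_smul, LinearMap.smul_apply, hX, smul_mul_assoc]
  | mem _ hi =>
    obtain ⟨i, rfl⟩ := hi
    simpa using h i

/-- When i may be put in front this is the definition of an ordered monomial. Otherwise both sides
obey the same straightening relation, whose correction terms have smaller degree. -/
theorem ordMap_act (d : ℕ) : ∀ (i : ι) (x : Multiset ι →₀ K) (_ : x ∈ degLE K ι d),
    ordMap b (act b i x) = UniversalEnvelopingAlgebra.ι K (b i) * ordMap b x := by
  induction d using Nat.strong_induction_on with
  | _ d ih =>
  intro i x hx
  refine supported_induction (N := LinearMap.eqLocus (ordMap b ∘ₗ act b i)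
    (LinearMap.mulLeft K (UniversalEnvelopingAlgebra.ι K (b i)) ∘ₗ ordMap b)) (fun M hM => ?_) hx
  simp only [LinearMap.mem_eqLocus, LinearMap.comp_apply, LinearMap.mulLeft_apply]
  rcases monomial_cases i M with h | ⟨j, N, hj, h, rfl⟩
  · rw [act_of_le b h, ordMap_single, ordMap_single, ordMonomial_cons b h]
  · have hN : N.card < d := by simpa using hM
    have hzd : Finsupp.single N 1 ∈ degLE K ι N.card := single_mem_degLE le_rfl (1 : K)
    have h2 : ∀ k ∈ i ::ₘ N, j ≤ k := by
      simp only [Multiset.mem_cons]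
      rintro l (rfl | hl)
      exacts [hj.le, h l hl]
    have h3 : ordMap b (act b j (act b i (Finsupp.single N 1))) =
        UniversalEnvelopingAlgebra.ι K (b j) * ordMap b (act b i (Finsupp.single N 1)) := by
      rw [← sub_add_cancel (act b i (Finsupp.single N 1)) (Finsupp.single (i ::ₘ N) 1)]
      simp only [map_add, mul_add]
      rw [ih _ hN j _ (act_sub_mem b i N), act_of_le b h2, ordMap_single, ordMap_single,
        ordMonomial_cons b h2]
    have hL := ordMap_actL_of_act b (fun i => ih _ hN i _ hzd)
    rw [← act_of_le b h, act_act_of_lt b hj h, map_add, h3, hL, ih _ hN i _ hzd, ih _ hN j _ hzd,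
      LieHom.map_lie, Ring.lie_def]
    noncomm_ring

theorem ordMap_actL (X : L) (x : Multiset ι →₀ K) :
    ordMap b (actL b X x) = UniversalEnvelopingAlgebra.ι K X * ordMap b x := by
  refine ordMap_actL_of_act b (fun i => ordMap_act b (x.support.sup Multiset.card) i x ?_) X
  rw [degLE, Finsupp.mem_supported]
  exact fun M hM => Finset.le_sup (f := Multiset.card) hM

/-- The universal enveloping algebra is generated by the Lie algebra. -/
theorem subalgebra_eq_top (B : Subalgebra K (UniversalEnvelopingAlgebra K L))
    (h : ∀ x : L, UniversalEnvelopingAlgebra.ι K x ∈ B) : B = ⊤ := by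
  let f : L →ₗ⁅K⁆ B :=
    { toFun := fun x => ⟨UniversalEnvelopingAlgebra.ι K x, h x⟩
      map_add' := fun x y => Subtype.ext (by simp)
      map_smul' := fun c x => Subtype.ext (by simp)
      map_lie' := fun {x y} => Subtype.ext (by simp [Ring.lie_def]) }
  have hf : B.val.comp (UniversalEnvelopingAlgebra.lift K f) = AlgHom.id K _ := by
    apply UniversalEnvelopingAlgebra.hom_ext
    ext x
    simp [f]
  rw [eq_top_iff]
  intro u _
  have := DFunLike.congr_fun hf u
  rw [AlgHom.id_apply] at this
  rw [← this]
  exact Subtype.property _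

/-- The action of the universal enveloping algebra on commutative polynomials. -/
def rep : UniversalEnvelopingAlgebra K L →ₐ[K] Module.End K (Multiset ι →₀ K) :=
  UniversalEnvelopingAlgebra.lift K (actHom b)

theorem rep_ι (x : L) : rep b (UniversalEnvelopingAlgebra.ι K x) = actL b x :=
  UniversalEnvelopingAlgebra.lift_ι_apply K (actHom b) x

/-- At x = 1 this displays u as a value of `ordMap`: the spanning half of the theorem. -/
theorem ordMap_rep (u : UniversalEnvelopingAlgebra K L) :
    ∀ x, ordMap b (rep b u x) = u * ordMap b x := by
  let B : Subalgebra K (UniversalEnvelopingAlgebra K L) :=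
    { carrier := {u | ∀ x, ordMap b (rep b u x) = u * ordMap b x}
      mul_mem' := fun {u v} hu hv x => by
        rw [map_mul, Module.End.mul_apply, hu, hv, mul_assoc]
      add_mem' := fun {u v} hu hv x => by
        rw [map_add, LinearMap.add_apply, map_add, hu, hv, add_mul]
      algebraMap_mem' := fun c x => by
        rw [AlgHom.commutes, Module.algebraMap_end_apply, map_smul, Algebra.smul_def] }
  have : B = ⊤ := subalgebra_eq_top B fun x y => by rw [rep_ι, ordMap_actL]
  exact (this ▸ Algebra.mem_top : u ∈ B)

/-- The factors act on 1 starting with the largest variable, so each is simply put in front. Hence u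
↦ u · 1 is a left inverse of `ordMap`: the independence half of the theorem. -/
theorem rep_ordMonomial (M : Multiset ι) :
    rep b (ordMonomial b M) (Finsupp.single 0 1) = Finsupp.single M 1 := by
  induction hn : M.card generalizing M with
  | zero =>
    rw [Multiset.card_eq_zero] at hn
    rw [hn, ordMonomial_zero, map_one, Module.End.one_apply]
  | succ n ih =>
    rcases hM : M.sort with _ | ⟨j, l⟩
    · have := M.sort_eq (· ≤ ·)
      rw [hM] at this
      simp [← this] at hn
    · obtain ⟨h, rfl⟩ := sort_cons_le hM
      rw [ordMonomial_cons b (by simpa using h), map_mul, Module.End.mul_apply,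
        ih _ (by simpa using hn), rep_ι, actL_basis, act_of_le b (by simpa using h)]

/-- The Poincaré–Birkhoff–Witt basis of the universal enveloping algebra. -/
def basis : Module.Basis (Multiset ι) K (UniversalEnvelopingAlgebra K L) :=
  Module.Basis.ofRepr <| LinearEquiv.symm <| LinearEquiv.ofBijective (ordMap b) <| by
    constructor
    · refine Function.LeftInverse.injective (g := fun u => rep b u (Finsupp.single 0 1)) fun x => ?_
      induction x using Finsupp.induction_linear with
      | zero => simp
      | add x y hx hy => simp only [map_add, LinearMap.add_apply, hx, hy]
      | single M c =>
        rw [← mul_one c, ← smul_eq_mul, ← Finsupp.smul_single, map_smul, ordMap_single]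
        simp only [map_smul, LinearMap.smul_apply, rep_ordMonomial]
    · intro u
      refine ⟨rep b u (Finsupp.single 0 1), ?_⟩
      rw [ordMap_rep, ordMap_single, ordMonomial_zero, mul_one]

@[simp] theorem basis_apply (M : Multiset ι) : basis b M = ordMonomial b M := by
  change ordMap b (Finsupp.single M 1) = _
  exact ordMap_single b M

/-! ### Straightening and weights -/

section Weights

variable {Γ : Type*} [AddCommMonoid Γ] {P : Set ι} {wt : ι → Γ}

/-- The multisets with elements in `P` and weight `γ`. -/
def wtSet (P : Set ι) (wt : ι → Γ) (γ : Γ) : Set (Multiset ι) :=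
  {M | (∀ i ∈ M, i ∈ P) ∧ (M.map wt).sum = γ}

theorem cons_mem_wtSet {i : ι} (hi : i ∈ P) {M : Multiset ι} {γ : Γ} (hM : M ∈ wtSet P wt γ) :
    i ::ₘ M ∈ wtSet P wt (wt i + γ) := by
  refine ⟨?_, by rw [Multiset.map_cons, Multiset.sum_cons, hM.2]⟩
  simp only [Multiset.mem_cons]
  rintro k (rfl | hk)
  exacts [hi, hM.1 k hk]

/-- Straightening only transposes factors or replaces two of them by terms of their bracket, and
both preserve the weight and the index set P when the structure constants do. It serves twice: for
characters on all indices, and for heights on the positive roots. -/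
theorem act_mem_supported
    (hP : ∀ i ∈ P, ∀ j ∈ P, ∀ k, b.repr ⁅b i, b j⁆ k ≠ 0 → k ∈ P ∧ wt k = wt i + wt j) (d : ℕ) :
    ∀ (i : ι) (_ : i ∈ P) (γ : Γ) (x : Multiset ι →₀ K) (_ : x ∈ degLE K ι d)
      (_ : x ∈ Finsupp.supported K K (wtSet P wt γ)),
      act b i x ∈ Finsupp.supported K K (wtSet P wt (wt i + γ)) := by
  induction d using Nat.strong_induction_on with
  | _ d ih =>
  intro i hi γ x hx hx'
  have hx'' : x ∈ Finsupp.supported K K ({M | M.card ≤ d} ∩ wtSet P wt γ) := by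
    rw [Finsupp.supported_inter]
    exact ⟨hx, hx'⟩
  refine supported_induction (N := (Finsupp.supported K K (wtSet P wt (wt i + γ))).comap (act b i))
    (fun M hM => ?_) hx''
  rw [Submodule.mem_comap]
  rcases monomial_cases i M with h | ⟨j, N, hj, h, rfl⟩
  · rw [act_of_le b h]
    exact Finsupp.single_mem_supported K _ (cons_mem_wtSet hi hM.2)
  · have hN : N.card < d := by simpa using hM.1
    have hjP : j ∈ P := hM.2.1 j (by simp)
    have hNw : N ∈ wtSet P wt (N.map wt).sum := ⟨fun k hk => hM.2.1 k (by simp [hk]), rfl⟩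
    have hγ : γ = wt j + (N.map wt).sum := by rw [← hM.2.2, Multiset.map_cons, Multiset.sum_cons]
    have hzd : Finsupp.single N 1 ∈ degLE K ι N.card := single_mem_degLE le_rfl (1 : K)
    have hz := Finsupp.single_mem_supported K (1 : K) hNw
    have hiN : i ::ₘ N ∈ wtSet P wt (wt i + (N.map wt).sum) := cons_mem_wtSet hi hNw
    have h2 : ∀ k ∈ i ::ₘ N, j ≤ k := by
      simp only [Multiset.mem_cons]
      rintro l (rfl | hl)
      exacts [hj.le, h l hl]
    rw [← act_of_le b h, act_act_of_lt b hj h]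
    refine add_mem ?_ ?_
    · rw [← sub_add_cancel (act b i (Finsupp.single N 1)) (Finsupp.single (i ::ₘ N) 1), map_add,
        hγ, add_left_comm]
      refine add_mem (ih _ hN j hjP _ _ (act_sub_mem b i N) (sub_mem (ih _ hN i hi _ _ hzd hz)
        (Finsupp.single_mem_supported K _ hiN))) ?_
      rw [act_of_le b h2]
      exact Finsupp.single_mem_supported K _ (cons_mem_wtSet hjP hiN)
    · rw [actL, Module.Basis.constr_apply, Finsupp.sum, LinearMap.sum_apply]
      refine Submodule.sum_mem _ fun k hk => Submodule.smul_mem _ _ ?_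
      obtain ⟨hkP, hkw⟩ := hP i hi j hjP k (Finsupp.mem_support_iff.1 hk)
      rw [hγ, ← add_assoc, ← hkw]
      exact ih _ hN k hkP _ _ hzd hz

/-- Straightening the product of a basis vector and an ordered monomial preserves weights. -/
theorem ι_mul_ordMonomial_mem
    (hP : ∀ i ∈ P, ∀ j ∈ P, ∀ k, b.repr ⁅b i, b j⁆ k ≠ 0 → k ∈ P ∧ wt k = wt i + wt j)
    {i : ι} (hi : i ∈ P) {γ : Γ} {M : Multiset ι} (hM : M ∈ wtSet P wt γ) :
    UniversalEnvelopingAlgebra.ι K (b i) * ordMonomial b M ∈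
      Submodule.span K (ordMonomial b '' wtSet P wt (wt i + γ)) := by
  have h := act_mem_supported b hP M.card i hi γ (Finsupp.single M 1) (single_mem_degLE le_rfl 1)
    (Finsupp.single_mem_supported K _ hM)
  rw [← ordMap_single, ← ordMap_actL, actL_basis]
  rw [Finsupp.supported_eq_span_single] at h
  have := Submodule.mem_map_of_mem (f := ordMap b) h
  rw [Submodule.map_span, ← Set.image_comp] at this
  convert this using 3
  exact (ordMap_single b _).symm

end Weights

end PBW
end PBW

end

section

/-! ### Lie algebras of algebraic groups in characteristic `p` -/

section CharP

/-- ad(x)^p = ad(x^p): left and right multiplication by x commute, so the p-th power of their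
difference is the difference of the p-th powers. -/
theorem mul_sub_mul_iterate_char (K : Type*) [Field K] (p : ℕ) [Fact p.Prime] [CharP K p]
    {A : Type*} [Ring A] [Algebra K A] (x y : A) :
    (fun z => x * z - z * x)^[p] y = x ^ p * y - y * x ^ p := by
  nontriviality A
  have : CharP (Module.End K A) p :=
    charP_of_injective_algebraMap (algebraMap K (Module.End K A)).injective p
  have h := sub_pow_char_of_commute (p := p) (x := LinearMap.mulLeft K x)
    (y := LinearMap.mulRight K x) (LinearMap.commute_mulLeft_right (R := K) x x)
  have h2 := LinearMap.congr_fun h y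
  rw [LinearMap.pow_mulLeft, LinearMap.pow_mulRight] at h2
  rw [Module.End.pow_apply] at h2
  exact h2

/-- In characteristic `p`, the `p`-th iterate of a derivation is a derivation. -/
theorem derivation_iterate_char {K : Type*} [Field K] (p : ℕ) [Fact p.Prime] [CharP K p]
    {A : Type*} [CommRing A] [Algebra K A] (D : Derivation K A A) (f g : A) :
    D^[p] (f * g) = f * D^[p] g + g * D^[p] f := by
  -- The commutator of D with multiplication by f is multiplication by D f, so ad(D)^p turns f into
  -- D^p f. This must equal the commutator of D^p with f.
  have h := mul_sub_mul_iterate_char K p (D : Module.End K A) (LinearMap.mulLeft K f)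
  have h1 : ∀ k : ℕ, (fun z : Module.End K A => (D : Module.End K A) * z - z * (D : Module.End K A))^[k]
      (LinearMap.mulLeft K f) = LinearMap.mulLeft K (D^[k] f) := by
    intro k
    induction k with
    | zero => rfl
    | succ k ih =>
      rw [Function.iterate_succ_apply', ih, Function.iterate_succ_apply']
      ext z
      simp [mul_comm]
  rw [h1] at h
  have h2 := LinearMap.congr_fun h g
  simp only [LinearMap.sub_apply, Module.End.mul_apply, LinearMap.mulLeft_apply,
    Module.End.pow_apply, Derivation.coeFn_coe] at h2
  rw [eq_sub_iff_add_eq] at h2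
  rw [← h2]
  ring

end CharP

/-! ### Matrix groups: tori, characters, weight spaces and p-th powers -/

section Groups

variable {K : Type u} [Field K] {n : ℕ}

@[simp] theorem evalAt_add (f g : Coord n K) (x : GL (Fin n) K) :
    evalAt (f + g) x = evalAt f x + evalAt g x := by simp [evalAt]

@[simp] theorem evalAt_sub (f g : Coord n K) (x : GL (Fin n) K) :
    evalAt (f - g) x = evalAt f x - evalAt g x := by simp [evalAt]

@[simp] theorem evalAt_neg (f : Coord n K) (x : GL (Fin n) K) :
    evalAt (-f) x = -evalAt f x := by simp [evalAt]

@[simp] theorem evalAt_mul (f g : Coord n K) (x : GL (Fin n) K) :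
    evalAt (f * g) x = evalAt f x * evalAt g x := by simp [evalAt]

@[simp] theorem evalAt_sum {ι : Type*} (s : Finset ι) (f : ι → Coord n K) (x : GL (Fin n) K) :
    evalAt (∑ i ∈ s, f i) x = ∑ i ∈ s, evalAt (f i) x := by simp [evalAt]

@[simp] theorem evalAt_C (c : K) (x : GL (Fin n) K) : evalAt (MvPolynomial.C c) x = c := by
  simp [evalAt]

@[simp] theorem evalAt_inl (i j : Fin n) (x : GL (Fin n) K) :
    evalAt (MvPolynomial.X (Sum.inl (i, j))) x = (x : Matrix (Fin n) (Fin n) K) i j := by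
  simp [evalAt]

@[simp] theorem evalAt_inr (i j : Fin n) (x : GL (Fin n) K) :
    evalAt (MvPolynomial.X (Sum.inr (i, j))) x =
      ((x⁻¹ : GL (Fin n) K) : Matrix (Fin n) (Fin n) K) i j := by
  simp [evalAt]

/-- Identities between regular functions on T may be differentiated at 1. Commutativity of 𝔥,
additivity of μ ↦ dμ and the action of 𝔥 on root vectors all come from such identities. -/
theorem evalAt_leftDer_one {T : Subgroup (GL (Fin n) K)} {y : Matrix (Fin n) (Fin n) K}
    (hy : y ∈ lieAlg T) {f : Coord n K} (hf : ∀ t ∈ T, evalAt f t = 0) :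
    evalAt (leftDer y f) 1 = 0 := hy f hf 1 T.one_mem

theorem leftDer_C (x : Matrix (Fin n) (Fin n) K) (c : K) :
    leftDer x (MvPolynomial.C c) = 0 := by
  rw [← MvPolynomial.algebraMap_eq, Derivation.map_algebraMap]

theorem IsTorus.commute {T : Subgroup (GL (Fin n) K)} (hT : IsTorus T) {s t : GL (Fin n) K}
    (hs : s ∈ T) (ht : t ∈ T) : s * t = t * s := by
  obtain ⟨-, -, c, hc⟩ := hT
  have h1 : c * s * c⁻¹ * (c * t * c⁻¹) = c * t * c⁻¹ * (c * s * c⁻¹) := by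
    apply Units.ext
    rw [Units.val_mul (c * s * c⁻¹), Units.val_mul (c * t * c⁻¹), ← (hc s hs).diagonal_diag, ← (hc t ht).diagonal_diag,
      Matrix.diagonal_mul_diagonal, Matrix.diagonal_mul_diagonal]
    simp only [mul_comm]
  rw [← mul_left_inj c⁻¹]
  simpa [mul_assoc] using h1

/-- The Lie algebra of a torus commutes with the torus. -/
theorem IsTorus.lieAlg_commute {T : Subgroup (GL (Fin n) K)} (hT : IsTorus T)
    {y : Matrix (Fin n) (Fin n) K} (hy : y ∈ lieAlg T) {t : GL (Fin n) K} (ht : t ∈ T) :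
    (t : Matrix (Fin n) (Fin n) K) * y = y * t := by
  ext i j
  have h := evalAt_leftDer_one hy
    (f := ∑ k, MvPolynomial.C (t.1 k j) * MvPolynomial.X (Sum.inl (i, k)) -
      ∑ k, MvPolynomial.C (t.1 i k) * MvPolynomial.X (Sum.inl (k, j))) (fun s hs => by
    have := congrArg (fun g : GL (Fin n) K => g.1 i j) (hT.commute hs ht)
    simp only [Units.val_mul, Matrix.mul_apply] at this
    simp only [evalAt_sub, evalAt_sum, evalAt_mul, evalAt_C, evalAt_inl]
    rw [← this, sub_eq_zero]
    exact Finset.sum_congr rfl fun _ _ => mul_comm _ _)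
  simp only [map_sub, map_sum, leftDer_C_mul, leftDer_inl, evalAt_sub, evalAt_sum, evalAt_mul,
    evalAt_C, evalAt_inl, Units.val_one, Matrix.one_apply, mul_ite, mul_one, mul_zero,
    Finset.sum_ite_eq, Finset.mem_univ, if_true, sub_eq_zero] at h
  rw [Matrix.mul_apply, Matrix.mul_apply, ← h]
  exact Finset.sum_congr rfl fun _ _ => mul_comm _ _

theorem IsTorus.lieAlg_abelian {T : Subgroup (GL (Fin n) K)} (hT : IsTorus T)
    {y z : Matrix (Fin n) (Fin n) K} (hy : y ∈ lieAlg T) (hz : z ∈ lieAlg T) :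
    y * z = z * y := by
  ext i j
  have h := evalAt_leftDer_one hy
    (f := ∑ k, MvPolynomial.C (z k j) * MvPolynomial.X (Sum.inl (i, k)) -
      ∑ k, MvPolynomial.C (z i k) * MvPolynomial.X (Sum.inl (k, j))) (fun s hs => by
    have := congrArg (fun g : Matrix (Fin n) (Fin n) K => g i j) (hT.lieAlg_commute hz hs)
    simp only [Matrix.mul_apply] at this
    simp only [evalAt_sub, evalAt_sum, evalAt_mul, evalAt_C, evalAt_inl]
    rw [← this, sub_eq_zero]
    exact Finset.sum_congr rfl fun _ _ => mul_comm _ _)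
  simp only [map_sub, map_sum, leftDer_C_mul, leftDer_inl, evalAt_sub, evalAt_sum, evalAt_mul,
    evalAt_C, evalAt_inl, Units.val_one, Matrix.one_apply, mul_ite, mul_one, mul_zero,
    Finset.sum_ite_eq, Finset.mem_univ, if_true, sub_eq_zero] at h
  rw [Matrix.mul_apply, Matrix.mul_apply, ← h]
  exact Finset.sum_congr rfl fun _ _ => mul_comm _ _

namespace CharLattice

variable {T : Subgroup (GL (Fin n) K)}

theorem val_eq_evalAt_rep (μ : CharLattice T) (t : T) :
    (μ.val t : K) = evalAt μ.rep (t : GL (Fin n) K) :=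
  (Additive.toMul (α := charSubgroup T) μ).2.choose_spec t

theorem val_add (μ ν : CharLattice T) (t : T) : (μ + ν).val t = μ.val t * ν.val t := rfl

theorem val_zero (t : T) : (0 : CharLattice T).val t = 1 := rfl

theorem val_nsmul (k : ℕ) (μ : CharLattice T) (t : T) : (k • μ).val t = μ.val t ^ k := by
  induction k with
  | zero => rw [zero_smul, val_zero, pow_zero]
  | succ k ih => rw [succ_nsmul, val_add, ih, pow_succ]

theorem val_injective {μ ν : CharLattice T} (h : ∀ t, (μ.val t : K) = ν.val t) : μ = ν := by
  apply Additive.toMul.injective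
  apply Subtype.ext
  apply MonoidHom.ext
  intro t
  exact Units.ext (h t)

theorem evalAt_rep_one (μ : CharLattice T) : evalAt μ.rep 1 = 1 := by
  have := μ.val_eq_evalAt_rep 1
  rw [OneMemClass.coe_one] at this
  rw [← this]
  simp [val]

/-- The product rule at 1, where representatives of characters take the value 1. -/
theorem differential_add (μ ν : CharLattice T) {y : Matrix (Fin n) (Fin n) K}
    (hy : y ∈ lieAlg T) : (μ + ν).differential y = μ.differential y + ν.differential y := by
  have h := evalAt_leftDer_one hy (f := (μ + ν).rep - μ.rep * ν.rep) (fun t ht => by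
    rw [evalAt_sub, evalAt_mul, ← val_eq_evalAt_rep _ ⟨t, ht⟩, ← val_eq_evalAt_rep _ ⟨t, ht⟩,
      ← val_eq_evalAt_rep _ ⟨t, ht⟩, val_add, Units.val_mul, sub_self])
  rw [map_sub, Derivation.leibniz, evalAt_sub, evalAt_add, smul_eq_mul, smul_eq_mul, evalAt_mul,
    evalAt_mul, evalAt_rep_one, evalAt_rep_one, sub_eq_zero, one_mul, one_mul, add_comm (evalAt _ _)] at h
  exact h

end CharLattice

/-- The derivative at t = 1 of each entry of t x t⁻¹ = α(t) x. The coordinates of t⁻¹ contribute the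
term -xy. -/
theorem lie_weightSpace {G T : Subgroup (GL (Fin n) K)} {α : CharLattice T}
    {x y : Matrix (Fin n) (Fin n) K} (hx : x ∈ weightSpace G T α) (hy : y ∈ lieAlg T) :
    y * x - x * y = α.differential y • x := by
  ext i j
  have h := evalAt_leftDer_one hy
    (f := ∑ k, ∑ l, MvPolynomial.C (x k l) *
        (MvPolynomial.X (Sum.inl (i, k)) * MvPolynomial.X (Sum.inr (l, j))) -
      MvPolynomial.C (x i j) * α.rep) (fun t ht => by
    have := congrArg (fun g : Matrix (Fin n) (Fin n) K => g i j) (hx.2 ⟨t, ht⟩)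
    simp only [Matrix.mul_apply, Matrix.smul_apply, smul_eq_mul, Finset.sum_mul] at this
    simp only [evalAt_sub, evalAt_sum, evalAt_mul, evalAt_C, evalAt_inl, evalAt_inr,
      ← CharLattice.val_eq_evalAt_rep α ⟨t, ht⟩]
    rw [mul_comm (x i j), ← this, sub_eq_zero, Finset.sum_comm]
    exact Finset.sum_congr rfl fun _ _ => Finset.sum_congr rfl fun _ _ => by ring)
  simp only [map_sub, map_sum, leftDer_C, Derivation.leibniz, leftDer_inl, leftDer_inr, add_zero,
    evalAt_sub, evalAt_sum, evalAt_mul, evalAt_add, evalAt_neg, smul_eq_mul,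
    evalAt_C, evalAt_inl, evalAt_inr, inv_one, Units.val_one, Matrix.one_apply, mul_ite, mul_one,
    mul_zero, ite_mul, one_mul, zero_mul, mul_add,
    Finset.sum_ite_eq, Finset.sum_ite_eq', Finset.sum_add_distrib, Finset.mem_univ, if_true,
    sub_eq_zero] at h
  rw [Matrix.sub_apply, Matrix.mul_apply, Matrix.mul_apply, Matrix.smul_apply, smul_eq_mul,
    mul_comm _ (x i j)]
  refine Eq.trans ?_ h
  rw [Finset.sum_comm]
  simp only [Finset.sum_ite_eq, Finset.mem_univ, if_true, mul_neg, Finset.sum_neg_distrib,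
    mul_comm (y i _)]
  abel

theorem lie_mem_weightSpace {G T : Subgroup (GL (Fin n) K)} {α β : CharLattice T}
    {x y : Matrix (Fin n) (Fin n) K} (hx : x ∈ weightSpace G T α) (hy : y ∈ weightSpace G T β) :
    ⁅x, y⁆ ∈ weightSpace G T (α + β) := by
  refine ⟨(lieAlg G).lie_mem hx.1 hy.1, fun t => ?_⟩
  have h : ∀ a b : Matrix (Fin n) (Fin n) K, (t.1.1 * (a * b) * (t.1⁻¹).1) =
      (t.1.1 * a * (t.1⁻¹).1) * (t.1.1 * b * (t.1⁻¹).1) := by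
    intro a b
    have : (t.1⁻¹).1 * t.1.1 = 1 := by rw [← Units.val_mul, inv_mul_cancel, Units.val_one]
    calc _ = t.1.1 * a * 1 * b * (t.1⁻¹).1 := by noncomm_ring
      _ = _ := by rw [← this]; noncomm_ring
  rw [Ring.lie_def, mul_sub, sub_mul, h, h, hx.2, hy.2, CharLattice.val_add, Units.val_mul,
    smul_mul_smul_comm, smul_mul_smul_comm, smul_sub, mul_comm (β.val t : K)]

theorem pow_conj (t : GL (Fin n) K) (x : Matrix (Fin n) (Fin n) K) (k : ℕ) :
    t.1 * x ^ k * (t⁻¹).1 = (t.1 * x * (t⁻¹).1) ^ k := by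
  exact (Units.conj_pow t x k).symm

theorem leftDer_iterate_inl (x : Matrix (Fin n) (Fin n) K) (k : ℕ) (i j : Fin n) :
    (leftDer x)^[k] (MvPolynomial.X (Sum.inl (i, j))) =
      ∑ l, MvPolynomial.C ((x ^ k) l j) * MvPolynomial.X (Sum.inl (i, l)) := by
  induction k with
  | zero => simp [Matrix.one_apply]
  | succ k ih =>
    rw [Function.iterate_succ_apply', ih]
    simp only [map_sum, leftDer_C_mul, leftDer_inl, pow_succ', Matrix.mul_apply, map_mul,
      Finset.sum_mul, Finset.mul_sum]
    rw [Finset.sum_comm]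
    exact Finset.sum_congr rfl fun _ _ => Finset.sum_congr rfl fun _ _ => by ring

theorem leftDer_iterate_inr (x : Matrix (Fin n) (Fin n) K) (k : ℕ) (i j : Fin n) :
    (leftDer x)^[k] (MvPolynomial.X (Sum.inr (i, j))) =
      (-1) ^ k * ∑ l, MvPolynomial.C ((x ^ k) i l) * MvPolynomial.X (Sum.inr (l, j)) := by
  induction k with
  | zero => simp [Matrix.one_apply]
  | succ k ih =>
    have h1 : ((-1 : Coord n K)) ^ k = MvPolynomial.C ((-1) ^ k) := by simp
    rw [Function.iterate_succ_apply', ih, h1, leftDer_C_mul, ← h1]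
    simp only [map_sum, leftDer_C_mul, leftDer_inr, pow_succ, Matrix.mul_apply, map_mul,
      Finset.sum_mul, Finset.mul_sum, mul_neg, Finset.sum_neg_distrib, mul_one, neg_mul]
    rw [Finset.sum_comm]
    exact congrArg _ (Finset.sum_congr rfl fun _ _ => Finset.sum_congr rfl fun _ _ => by ring)

/-- The Lie algebra of an algebraic group is closed under `p`-th powers. -/
theorem pow_char_mem_lieAlg (p : ℕ) [Fact p.Prime] [CharP K p] {G : Subgroup (GL (Fin n) K)}
    {x : Matrix (Fin n) (Fin n) K} (hx : x ∈ lieAlg G) : x ^ p ∈ lieAlg G := by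
  let D : Derivation K (Coord n K) (Coord n K) :=
    Derivation.mk' ((leftDer x : Module.End K (Coord n K)) ^ p) (fun a b => by
      rw [Module.End.pow_apply, Module.End.pow_apply, Module.End.pow_apply]
      exact derivation_iterate_char p (leftDer x) a b)
  have hD : ∀ f, D f = (leftDer x)^[p] f := fun f => by
    change ((leftDer x : Module.End K (Coord n K)) ^ p) f = _
    rw [Module.End.pow_apply]
    rfl
  have h : leftDer (x ^ p) = D := by
    apply MvPolynomial.derivation_ext
    rintro (⟨i, j⟩ | ⟨i, j⟩)
    · rw [hD, leftDer_iterate_inl, leftDer_inl]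
    -- The entries of the inverse pick up the sign (-1)^p, which is -1 in characteristic p, also for
    -- p = 2.
    · rw [hD, leftDer_iterate_inr, leftDer_inr, neg_one_pow_char, neg_one_mul]
  intro f hf
  rw [h, hD]
  have : ∀ k, (leftDer x)^[k] f ∈ vanishingIdeal G := by
    intro k
    induction k with
    | zero => exact hf
    | succ k ih => rw [Function.iterate_succ_apply']; exact hx _ ih
  exact this p

theorem pow_char_mem_weightSpace (p : ℕ) [Fact p.Prime] [CharP K p] {G T : Subgroup (GL (Fin n) K)}
    {α : CharLattice T} {x : Matrix (Fin n) (Fin n) K} (hx : x ∈ weightSpace G T α) :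
    x ^ p ∈ weightSpace G T (p • α) := by
  refine ⟨pow_char_mem_lieAlg p hx.1, fun t => ?_⟩
  rw [pow_conj, hx.2, smul_pow, CharLattice.val_nsmul, Units.val_pow_eq_pow_val]

end Groups

end

section

namespace ReductiveGroup

variable {K : Type u} [Field K] {p : ℕ} (S : ReductiveGroup K p)

/-! ### The structure of the Lie algebra -/

/-- The index set of the basis of `𝔤`; its order puts negative roots first, then positive roots,
then the torus. -/
def Idx : Type u := S.R ⊕ Fin S.d

/-- The index of a root vector. -/
def rt (α : S.R) : S.Idx := Sum.inl α

/-- The index of a basis vector of `𝔥`. -/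
def tor (i : Fin S.d) : S.Idx := Sum.inr i

/-- The given basis of `𝔤`. -/
def bas : Module.Basis S.Idx K S.g := S.basis

instance : Finite S.Idx := Module.Finite.finite_basis S.bas

instance : Finite S.R := Finite.of_injective S.rt fun _ _ h => Sum.inl_injective h

instance : Fintype S.R := Fintype.ofFinite _

open Classical in
/-- The three classes of basis vectors: negative root vectors, positive root vectors, `𝔥`. -/
def cls : S.Idx → ℕ := Sum.elim (fun α => if S.IsPos α then 1 else 0) fun _ => 2

/-- Lexicographic: first the class, then an arbitrary injection into ℕ. Only the order of the
classes matters later; it gives ordered monomials the shape negative · positive · torus. -/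
instance : LinearOrder S.Idx :=
  LinearOrder.lift' (fun i => toLex (S.cls i, (exists_injective_nat S.Idx).choose i)) fun _ _ h =>
    (exists_injective_nat S.Idx).choose_spec (congrArg (fun x => (ofLex x).2) h)

theorem lt_of_cls_lt {i j : S.Idx} (h : S.cls i < S.cls j) : i < j :=
  Prod.Lex.toLex_lt_toLex.2 (Or.inl h)

theorem cls_rt_pos {α : S.R} (h : S.IsPos α) : S.cls (S.rt α) = 1 := if_pos h

theorem cls_rt_neg {α : S.R} (h : ¬ S.IsPos α) : S.cls (S.rt α) = 0 := if_neg h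

theorem cls_tor (i : Fin S.d) : S.cls (S.tor i) = 2 := rfl

/-- The weight of a basis vector. -/
def wt : S.Idx → S.X := Sum.elim (fun α => α.1) fun _ => 0

@[simp] theorem wt_rt (α : S.R) : S.wt (S.rt α) = α.1 := rfl

@[simp] theorem wt_tor (i : Fin S.d) : S.wt (S.tor i) = 0 := rfl

theorem idx_cases {q : S.Idx → Prop} (h1 : ∀ α, q (S.rt α)) (h2 : ∀ i, q (S.tor i)) (i : S.Idx) :
    q i := Sum.rec h1 h2 i

theorem isTorus : IsTorus S.T := S.isMaximalTorus.2.1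

theorem tor_mem (i : Fin S.d) : S.bas (S.tor i) ∈ S.h := by
  have h : (S.bas (S.tor i) : Matrix (Fin S.n) (Fin S.n) K) ∈ (lieAlg S.T).toSubmodule := by
    rw [← S.span_basis_torus]
    exact Submodule.subset_span ⟨i, rfl⟩
  exact h

/-- The given basis of `𝔥`. -/
def hb (i : Fin S.d) : S.h := ⟨S.bas (S.tor i), S.tor_mem i⟩

theorem span_hb : Submodule.span K (Set.range S.hb) = ⊤ := by
  rw [eq_top_iff]
  rintro x -
  have hx : (x.1 : Matrix (Fin S.n) (Fin S.n) K) ∈ (lieAlg S.T).toSubmodule := x.2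
  let f : S.h →ₗ[K] Matrix (Fin S.n) (Fin S.n) K :=
    (lieAlg S.G).toSubmodule.subtype.comp S.h.toSubmodule.subtype
  have hf : Function.Injective f := fun a b hab => Subtype.ext (Subtype.ext hab)
  rw [← S.span_basis_torus] at hx
  have h2 : Submodule.map f (Submodule.span K (Set.range S.hb)) =
      Submodule.span K (Set.range fun i => (S.basis (Sum.inr i) : Matrix (Fin S.n) (Fin S.n) K)) := by
    rw [Submodule.map_span, ← Set.range_comp]
    rfl
  rw [← h2] at hx
  obtain ⟨y, hy, hxy⟩ := hx
  have : y = x := hf hxy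
  exact this ▸ hy

theorem bas_mem_weightSpace (i : S.Idx) :
    (S.bas i : Matrix (Fin S.n) (Fin S.n) K) ∈ weightSpace S.G S.T (S.wt i) := by
  refine S.idx_cases (q := fun i => (S.bas i : Matrix (Fin S.n) (Fin S.n) K) ∈
    weightSpace S.G S.T (S.wt i)) (fun α => S.basis_root α) (fun i => ?_) i
  refine ⟨(S.bas (S.tor i)).2, fun t => ?_⟩
  have h : (S.bas (S.tor i) : Matrix (Fin S.n) (Fin S.n) K) ∈ lieAlg S.T := S.tor_mem i
  rw [S.isTorus.lieAlg_commute h t.2, mul_assoc, ← Units.val_mul, mul_inv_cancel,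
    wt_tor, CharLattice.val_zero, Units.val_one, Units.val_one, mul_one, one_smul]

/-- Compare the coefficients in t x t⁻¹ = γ(t) x for all t in T. The group distinguishes all weights
in X, while 𝔥 sees only their differentials, which vanish on pX. -/
theorem wt_eq_of_repr_ne_zero {x : S.g} {γ : S.X}
    (hx : (x : Matrix (Fin S.n) (Fin S.n) K) ∈ weightSpace S.G S.T γ) {i : S.Idx}
    (hi : S.bas.repr x i ≠ 0) : S.wt i = γ := by
  have := Fintype.ofFinite S.Idx
  refine CharLattice.val_injective fun t => ?_
  have h1 := hx.2 t
  have h2 : (x : Matrix (Fin S.n) (Fin S.n) K) =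
      ∑ i, S.bas.repr x i • (S.bas i : Matrix (Fin S.n) (Fin S.n) K) := by
    have := congrArg Subtype.val (S.bas.sum_repr x)
    rw [AddSubmonoidClass.coe_finsetSum] at this
    exact this.symm
  have h3 : ∑ i, (S.bas.repr x i * ((S.wt i).val t - γ.val t : K)) • S.bas i = 0 := by
    apply Subtype.ext
    rw [h2, Finset.mul_sum, Finset.sum_mul, Finset.smul_sum, ← sub_eq_zero,
      ← Finset.sum_sub_distrib] at h1
    rw [AddSubmonoidClass.coe_finsetSum, ZeroMemClass.coe_zero, ← h1]
    refine Finset.sum_congr rfl fun j _ => ?_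
    rw [Matrix.mul_smul, Matrix.smul_mul, (S.bas_mem_weightSpace j).2 t, smul_smul, smul_smul,
      ← sub_smul, mul_sub, mul_comm (γ.val t : K)]
    rfl
  have h4 := Fintype.linearIndependent_iff.1 S.bas.linearIndependent _ h3 i
  exact sub_eq_zero.1 ((mul_eq_zero.1 h4).resolve_left hi)

/-- The structure constants of `𝔤` respect weights. -/
theorem wt_of_repr_lie_ne_zero {i j k : S.Idx} (h : S.bas.repr ⁅S.bas i, S.bas j⁆ k ≠ 0) :
    S.wt k = S.wt i + S.wt j :=
  S.wt_eq_of_repr_ne_zero (by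
    rw [LieSubalgebra.coe_bracket]
    exact lie_mem_weightSpace (S.bas_mem_weightSpace i) (S.bas_mem_weightSpace j)) h

theorem lie_torus (x y : S.h) : ⁅(x : S.g), (y : S.g)⁆ = 0 := by
  apply Subtype.ext
  have hx : (x.1 : Matrix (Fin S.n) (Fin S.n) K) ∈ lieAlg S.T := x.2
  have hy : (y.1 : Matrix (Fin S.n) (Fin S.n) K) ∈ lieAlg S.T := y.2
  rw [LieSubalgebra.coe_bracket, Ring.lie_def, S.isTorus.lieAlg_abelian hx hy, sub_self]
  rfl

theorem lie_e (x : S.h) (α : S.R) : ⁅(x : S.g), S.e α⁆ = S.diff α.1 x • S.e α := by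
  apply Subtype.ext
  rw [LieSubalgebra.coe_bracket, Ring.lie_def]
  exact lie_weightSpace (S.basis_root α) x.2

theorem diff_add (μ ν : S.X) : S.diff (μ + ν) = S.diff μ + S.diff ν :=
  LinearMap.ext fun x => CharLattice.differential_add μ ν x.2

@[simp] theorem diff_zero : S.diff 0 = 0 := by
  have := S.diff_add 0 0
  simpa using this

theorem diff_nsmul (k : ℕ) (μ : S.X) : S.diff (k • μ) = k • S.diff μ := by
  induction k with
  | zero => simp
  | succ k ih => rw [succ_nsmul, diff_add, ih, succ_nsmul]

theorem diff_p_smul [CharP K p] (μ : S.X) : S.diff (p • μ) = 0 := by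
  rw [diff_nsmul]
  ext x
  simp

theorem diff_neg (μ : S.X) : S.diff (-μ) = -S.diff μ := by
  rw [eq_neg_iff_add_eq_zero, ← diff_add, neg_add_cancel, diff_zero]

theorem diff_sub (μ ν : S.X) : S.diff (μ - ν) = S.diff μ - S.diff ν := by
  rw [sub_eq_add_neg, diff_add, diff_neg, sub_eq_add_neg]

/-- Pairing with the coroot of α gives 2k, which is nonzero in ℤ. -/
theorem root_zsmul_ne_zero (α : S.R) {k : ℤ} (hk : k ≠ 0) : k • α.1 ≠ 0 := by
  intro h
  have h1 := S.rootDatum.root_coroot_two α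
  rw [S.root_apply] at h1
  have h2 : S.rootDatum.toLinearMap (k • α.1) (S.rootDatum.coroot α) = 0 := by rw [h]; simp
  rw [map_zsmul, LinearMap.smul_apply, h1] at h2
  simp [hk] at h2

theorem p_smul_root_ne_zero [Fact p.Prime] (α : S.R) : p • α.1 ≠ 0 := by
  have := S.root_zsmul_ne_zero α (k := p) (by simpa using (Fact.out : p.Prime).ne_zero)
  rwa [natCast_zsmul] at this

/-- Two dependent roots of a reduced root datum agree up to sign, so β = pα would give (p - 1)α = 0
or (p + 1)α = 0. -/
theorem p_smul_root_ne_root [Fact p.Prime] (α β : S.R) : β.1 ≠ p • α.1 := by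
  intro h
  have hp := (Fact.out : p.Prime).two_le
  have := S.isReduced
  have hdep : ¬ LinearIndependent ℤ ![S.rootDatum.root α, S.rootDatum.root β] := by
    intro hli
    have := LinearIndependent.pair_iff.1 hli (p : ℤ) (-1) (by
      rw [S.root_apply, S.root_apply, h, natCast_zsmul]
      simp)
    simp at this
  rcases RootPairing.IsReduced.eq_or_eq_neg α β hdep with h1 | h1
  · rw [S.root_apply, S.root_apply] at h1
    refine S.root_zsmul_ne_zero α (k := (p : ℤ) - 1) (by lia) ?_
    rw [sub_smul, natCast_zsmul, ← h, one_smul, h1, sub_self]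
  · rw [S.root_apply, S.root_apply] at h1
    refine S.root_zsmul_ne_zero α (k := (p : ℤ) + 1) (by lia) ?_
    rw [add_smul, natCast_zsmul, ← h, one_smul, h1]
    simp

/-- Root vectors satisfy `e_α ^ [p] = 0`. -/
theorem e_pow_char [Fact p.Prime] [CharP K p] (α : S.R) :
    (S.e α : Matrix (Fin S.n) (Fin S.n) K) ^ p = 0 := by
  have h := pow_char_mem_weightSpace p (S.basis_root α)
  let x : S.g := ⟨(S.e α : Matrix (Fin S.n) (Fin S.n) K) ^ p, h.1⟩
  suffices hx : x = 0 from congrArg Subtype.val hx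
  rw [← S.bas.repr.map_eq_zero_iff]
  ext i
  by_contra hi
  -- A basis vector that occurs in e_α^p has weight pα, which is neither a root nor 0.
  have hw : S.wt i = p • α.1 := S.wt_eq_of_repr_ne_zero (x := x) h hi
  revert hw
  refine S.idx_cases (q := fun i => S.wt i = p • α.1 → False) (fun β => ?_) (fun i => ?_) i
  · exact S.p_smul_root_ne_root α β
  · exact fun h => S.p_smul_root_ne_zero α h.symm

/-- The `p`-th powers of the root vectors are central in `U(𝔤)`. -/
theorem commute_e_pow [Fact p.Prime] [CharP K p] (α : S.R)
    (u : UniversalEnvelopingAlgebra K S.g) :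
    Commute (UniversalEnvelopingAlgebra.ι K (S.e α) ^ p) u := by
  have key : ∀ y : S.g, UniversalEnvelopingAlgebra.ι K (S.e α) ^ p *
      UniversalEnvelopingAlgebra.ι K y =
      UniversalEnvelopingAlgebra.ι K y * UniversalEnvelopingAlgebra.ι K (S.e α) ^ p := by
    intro y
    have h1 : ∀ k : ℕ, (fun z => UniversalEnvelopingAlgebra.ι K (S.e α) * z -
        z * UniversalEnvelopingAlgebra.ι K (S.e α))^[k] (UniversalEnvelopingAlgebra.ι K y) =
        UniversalEnvelopingAlgebra.ι K ((fun z : S.g => ⁅S.e α, z⁆)^[k] y) := by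
      intro k
      induction k with
      | zero => rfl
      | succ k ih =>
        rw [Function.iterate_succ_apply', ih, Function.iterate_succ_apply', LieHom.map_lie,
          Ring.lie_def]
    have h2 : ∀ k : ℕ, (((fun z : S.g => ⁅S.e α, z⁆)^[k] y : S.g) :
        Matrix (Fin S.n) (Fin S.n) K) =
        (fun z : Matrix (Fin S.n) (Fin S.n) K =>
          (S.e α : Matrix (Fin S.n) (Fin S.n) K) * z - z * (S.e α).1)^[k] y.1 := by
      intro k
      induction k with
      | zero => rfl
      | succ k ih =>
        rw [Function.iterate_succ_apply', Function.iterate_succ_apply', ← ih,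
          LieSubalgebra.coe_bracket, Ring.lie_def]
    -- In matrices ad(e_α)^p = ad(e_α^p) = 0. The iterated brackets in U(𝔤) stay inside 𝔤, so there
    -- too ad(e_α)^p, which is ad of the p-th power taken in U(𝔤), vanishes on 𝔤.
    have h3 : ((fun z : S.g => ⁅S.e α, z⁆)^[p] y : S.g) = 0 := by
      apply Subtype.ext
      rw [h2, mul_sub_mul_iterate_char K p, S.e_pow_char, zero_mul, mul_zero, sub_zero]
      rfl
    have h4 := mul_sub_mul_iterate_char K p (UniversalEnvelopingAlgebra.ι K (S.e α))
      (UniversalEnvelopingAlgebra.ι K y)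
    rw [h1, h3, map_zero] at h4
    exact sub_eq_zero.1 h4.symm
  have := PBW.subalgebra_eq_top (Subalgebra.centralizer K
    {UniversalEnvelopingAlgebra.ι K (S.e α) ^ p}) (fun x => by
      rw [Subalgebra.mem_centralizer_iff]
      rintro _ rfl
      exact key x)
  have hu : u ∈ Subalgebra.centralizer K {UniversalEnvelopingAlgebra.ι K (S.e α) ^ p} :=
    this ▸ Algebra.mem_top
  exact (Subalgebra.mem_centralizer_iff K).1 hu _ rfl

/-! ### Positive roots -/

/-- A sum of simple roots with natural coefficients has height at least 0, and no root has height 0.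
-/
theorem height_pos {α : S.R} (h : S.IsPos α) : 0 < S.base.height α := by
  have key : ∀ m ∈ AddSubmonoid.closure (S.rootDatum.root '' S.base.support),
      ∃ f : S.R → ℕ, m = ∑ j ∈ S.base.support, (f j : ℤ) • S.rootDatum.root j := by
    classical
    intro m hm
    induction hm using AddSubmonoid.closure_induction with
    | zero => exact ⟨0, by simp⟩
    | mem x hx =>
      obtain ⟨j, hj, rfl⟩ := hx
      refine ⟨Pi.single j 1, ?_⟩
      rw [Finset.sum_eq_single_of_mem j hj]
      · simp
      · intro k _ hk
        simp [Pi.single_eq_of_ne hk]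
    | add x y _ _ hx hy =>
      obtain ⟨f, rfl⟩ := hx
      obtain ⟨g, rfl⟩ := hy
      exact ⟨f + g, by simp [add_smul, Finset.sum_add_distrib]⟩
  obtain ⟨f, hf⟩ := key _ h
  have h1 := RootPairing.Base.height_eq_sum (b := S.base) (f := fun j => (f j : ℤ)) hf
  have h2 := S.base.height_ne_zero α
  have h3 : 0 ≤ S.base.height α := by
    rw [h1]
    exact Finset.sum_nonneg fun _ _ => Int.natCast_nonneg _
  lia

theorem isPos_or_neg (α : S.R) : S.IsPos α ∨ ∃ β : S.R, S.IsPos β ∧ α.1 = -β.1 := by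
  rcases S.base.root_mem_or_neg_mem α with h | h
  · exact Or.inl h
  · have h1 : S.rootDatum.root (S.rootDatum.reflectionPerm α α) = -S.rootDatum.root α := by
      simp
    refine Or.inr ⟨S.rootDatum.reflectionPerm α α, ?_, ?_⟩
    · rw [IsPos, h1]
      exact h
    · rw [S.root_apply, S.root_apply] at h1
      rw [h1, neg_neg]

/-- The positive root vectors, with their heights, are closed under the bracket. -/
theorem pos_of_repr_lie_ne_zero {α β : S.R} (hα : S.IsPos α) (hβ : S.IsPos β) {k : S.Idx}
    (h : S.bas.repr ⁅S.e α, S.e β⁆ k ≠ 0) :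
    ∃ γ, k = S.rt γ ∧ S.IsPos γ ∧ S.base.height γ = S.base.height α + S.base.height β := by
  have hw := S.wt_of_repr_lie_ne_zero (i := S.rt α) (j := S.rt β) h
  have hadd : S.rootDatum.root α + S.rootDatum.root β ∈
      AddSubmonoid.closure (S.rootDatum.root '' S.base.support) := add_mem hα hβ
  revert hw
  refine S.idx_cases (q := fun k => S.wt k = S.wt (S.rt α) + S.wt (S.rt β) → ∃ γ, k = S.rt γ ∧
    S.IsPos γ ∧ S.base.height γ = S.base.height α + S.base.height β) (fun γ hw => ?_)
    (fun i hw => ?_) k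
  · have hr : S.rootDatum.root γ = S.rootDatum.root α + S.rootDatum.root β := by
      rw [S.root_apply, S.root_apply, S.root_apply]
      exact hw
    refine ⟨γ, rfl, ?_, S.base.height_add hr⟩
    rw [IsPos, hr]
    exact hadd
  · exfalso
    have h1 : S.rootDatum.root β = -S.rootDatum.root α := by
      rw [S.root_apply, S.root_apply, eq_neg_iff_add_eq_zero, add_comm]
      exact hw.symm
    -- If the weight were 0 then α = β - 2β, so the heights of α and β would be opposite, although
    -- both are positive.
    have h2 := S.base.height_add_zsmul (i := β) (j := β) (k := α) (z := -2) (by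
      rw [h1]; module)
    have := S.height_pos hα
    have := S.height_pos hβ
    rw [smul_eq_mul] at h2
    lia

/-! ### Forms in standard Levi form -/

section Levi

variable {S} {χ : Module.Dual K S.g} {I : Set S.R}

theorem chi_of_isPos (hχ : S.IsStandardLeviForm χ I) {α : S.R} (h : S.IsPos α) : χ (S.e α) = 0 :=
  hχ.2.1 _ ((S.pos_iff α).1 h (S.basis_root α))

/-- A nonzero value occurs only at the negatives of roots in I. This makes the relation e_α^p =
χ(e_α)^p homogeneous for X/ℤI. -/
theorem mem_ZI_of_chi_ne_zero (hχ : S.IsStandardLeviForm χ I) {α : S.R} (h : χ (S.e α) ≠ 0) :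
    α.1 ∈ S.ZI I := by
  rcases S.isPos_or_neg α with h1 | ⟨β, hβ, h1⟩
  · exact absurd (chi_of_isPos hχ h1) h
  · have h2 : β ∈ I := by
      by_contra hI
      exact h ((hχ.2.2 β α hβ h1).2 hI)
    rw [h1]
    exact neg_mem (AddSubgroup.subset_closure ⟨β, h2, rfl⟩)

end Levi

end ReductiveGroup

end

section

/-! ### Products of ordered monomials -/

namespace PBW

variable {K : Type*} [CommRing K] {L : Type*} [LieRing L] [LieAlgebra K L]
  {ι : Type*} [LinearOrder ι] (b : Module.Basis ι K L)

/-- Induction on multisets, adding elements in decreasing order. -/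
theorem sorted_induction {q : Multiset ι → Prop} (h0 : q 0)
    (h1 : ∀ (j : ι) (N : Multiset ι), (∀ k ∈ N, j ≤ k) → q N → q (j ::ₘ N)) (M : Multiset ι) :
    q M := by
  induction hn : M.card generalizing M with
  | zero =>
    rw [Multiset.card_eq_zero] at hn
    rwa [hn]
  | succ n ih =>
    rcases hM : M.sort with _ | ⟨j, l⟩
    · have := M.sort_eq (· ≤ ·)
      rw [hM] at this
      simp [← this] at hn
    · obtain ⟨h, rfl⟩ := sort_cons_le hM
      exact h1 j l (by simpa using h) (ih _ (by simpa using hn))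

theorem ordMonomial_add {M N : Multiset ι} (h : ∀ i ∈ M, ∀ j ∈ N, i ≤ j) :
    ordMonomial b (M + N) = ordMonomial b M * ordMonomial b N := by
  induction M using sorted_induction with
  | h0 => rw [zero_add, ordMonomial_zero, one_mul]
  | h1 j M hj ih =>
    rw [Multiset.cons_add, ordMonomial_cons, ih fun i hi => h i (Multiset.mem_cons_of_mem hi),
      ordMonomial_cons b hj, mul_assoc]
    intro k hk
    rcases Multiset.mem_add.1 hk with hk | hk
    exacts [hj k hk, h j (Multiset.mem_cons_self _ _) k hk]

theorem ordMonomial_replicate (k : ℕ) (i : ι) :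
    ordMonomial b (Multiset.replicate k i) = UniversalEnvelopingAlgebra.ι K (b i) ^ k := by
  induction k with
  | zero => rw [Multiset.replicate_zero, ordMonomial_zero, pow_zero]
  | succ k ih =>
    rw [Multiset.replicate_succ, ordMonomial_cons, ih, pow_succ']
    intro j hj
    rw [Multiset.eq_of_mem_replicate hj]

theorem commute_ordMonomial {x : UniversalEnvelopingAlgebra K L} {M : Multiset ι}
    (h : ∀ j ∈ M, Commute x (UniversalEnvelopingAlgebra.ι K (b j))) :
    Commute x (ordMonomial b M) := by
  induction M using sorted_induction with
  | h0 => rw [ordMonomial_zero]; exact Commute.one_right x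
  | h1 j M hj ih =>
    rw [ordMonomial_cons b hj]
    exact (h j (Multiset.mem_cons_self _ _)).mul_right
      (ih fun i hi => h i (Multiset.mem_cons_of_mem hi))

/-- The power has to pass only the factors larger than i. It is used for central powers, k = p, and
for single torus elements, k = 1. -/
theorem ordMonomial_add_replicate (k : ℕ) (i : ι) {M : Multiset ι}
    (h : ∀ j ∈ M, i < j →
      Commute (UniversalEnvelopingAlgebra.ι K (b i) ^ k) (UniversalEnvelopingAlgebra.ι K (b j))) :
    ordMonomial b (M + Multiset.replicate k i) =
      ordMonomial b M * UniversalEnvelopingAlgebra.ι K (b i) ^ k := by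
  induction M using sorted_induction with
  | h0 => rw [zero_add, ordMonomial_zero, one_mul, ordMonomial_replicate]
  | h1 j M hj ih =>
    rcases le_or_gt j i with hji | hij
    · rw [Multiset.cons_add, ordMonomial_cons, ih fun i hi => h i (Multiset.mem_cons_of_mem hi),
        ordMonomial_cons b hj, mul_assoc]
      intro l hl
      rcases Multiset.mem_add.1 hl with hl | hl
      · exact hj l hl
      · rwa [Multiset.eq_of_mem_replicate hl]
    · have h1 : ∀ l ∈ j ::ₘ M, i < l := by
        intro l hl
        rcases Multiset.mem_cons.1 hl with rfl | hl
        exacts [hij, hij.trans_le (hj l hl)]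
      rw [add_comm, ordMonomial_add, ordMonomial_replicate]
      · exact commute_ordMonomial b fun l hl => h l hl (h1 l hl)
      · intro l hl m hm
        rw [Multiset.eq_of_mem_replicate hl]
        exact (h1 m hm).le

end PBW

theorem exists_linearMap_factor {K V W X : Type*} [Ring K] [AddCommGroup V] [AddCommGroup W]
    [AddCommGroup X] [Module K V] [Module K W] [Module K X] (f : V →ₗ[K] W) (g : V →ₗ[K] X)
    (hf : Function.Surjective f) (h : ∀ v, f v = 0 → g v = 0) :
    ∃ k : W →ₗ[K] X, ∀ v, k (f v) = g v := by
  refine ⟨(LinearMap.ker f).liftQ g (fun v hv =>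
    LinearMap.mem_ker.2 (h v (LinearMap.mem_ker.1 hv))) ∘ₗ
    (f.quotKerEquivOfSurjective hf).symm.toLinearMap, fun v => ?_⟩
  have : (f.quotKerEquivOfSurjective hf).symm (f v) = (LinearMap.ker f).mkQ v := by
    rw [LinearEquiv.symm_apply_eq]
    rfl
  rw [LinearMap.comp_apply, LinearEquiv.coe_toLinearMap, this, Submodule.mkQ_apply,
    Submodule.liftQ_apply]

namespace ReductiveGroup

variable {K : Type u} [Field K] {p : ℕ} (S : ReductiveGroup K p)

/-- The weight of a monomial. -/
def wtM (M : Multiset S.Idx) : S.X := (M.map S.wt).sum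

@[simp] theorem wtM_cons (i : S.Idx) (M : Multiset S.Idx) :
    S.wtM (i ::ₘ M) = S.wt i + S.wtM M := by simp [wtM]

@[simp] theorem wtM_zero : S.wtM 0 = 0 := by simp [wtM]

@[simp] theorem wtM_add (M N : Multiset S.Idx) : S.wtM (M + N) = S.wtM M + S.wtM N := by
  simp [wtM]

@[simp] theorem wtM_replicate (k : ℕ) (i : S.Idx) :
    S.wtM (Multiset.replicate k i) = k • S.wt i := by simp [wtM]

theorem lie_bas (x : S.h) (i : S.Idx) : ⁅(x : S.g), S.bas i⁆ = S.diff (S.wt i) x • S.bas i := by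
  refine S.idx_cases (q := fun i => ⁅(x : S.g), S.bas i⁆ = S.diff (S.wt i) x • S.bas i)
    (fun α => S.lie_e x α) (fun i => ?_) i
  rw [wt_tor, diff_zero, LinearMap.zero_apply, zero_smul]
  exact S.lie_torus x (S.hb i)

/-- Moving an element of `𝔥` past an ordered monomial. -/
theorem torus_mul_ordMonomial (x : S.h) (M : Multiset S.Idx) :
    UniversalEnvelopingAlgebra.ι K (x : S.g) * PBW.ordMonomial S.bas M =
      PBW.ordMonomial S.bas M * UniversalEnvelopingAlgebra.ι K (x : S.g) +
        S.diff (S.wtM M) x • PBW.ordMonomial S.bas M := by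
  induction M using PBW.sorted_induction with
  | h0 => simp [PBW.ordMonomial_zero]
  | h1 j M hj ih =>
    have h : UniversalEnvelopingAlgebra.ι K (x : S.g) * UniversalEnvelopingAlgebra.ι K (S.bas j) =
        UniversalEnvelopingAlgebra.ι K (S.bas j) * UniversalEnvelopingAlgebra.ι K (x : S.g) +
          S.diff (S.wt j) x • UniversalEnvelopingAlgebra.ι K (S.bas j) := by
      rw [← sub_eq_iff_eq_add', ← Ring.lie_def, ← LieHom.map_lie, lie_bas, map_smul]
    rw [PBW.ordMonomial_cons S.bas hj, ← mul_assoc, h, add_mul, mul_assoc, ih, wtM_cons, diff_add,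
      LinearMap.add_apply, add_smul, mul_add, mul_smul_comm, smul_mul_assoc, mul_assoc]
    abel

/-- Only other torus elements can follow h_i in the order, and 𝔥 is abelian. -/
theorem ordMonomial_add_tor (M : Multiset S.Idx) (i : Fin S.d) :
    PBW.ordMonomial S.bas (S.tor i ::ₘ M) =
      PBW.ordMonomial S.bas M * UniversalEnvelopingAlgebra.ι K (S.bas (S.tor i)) := by
  have := PBW.ordMonomial_add_replicate S.bas 1 (S.tor i) (M := M) (fun j _ hj => by
    revert hj
    refine S.idx_cases (q := fun j => S.tor i < j → Commute _
      (UniversalEnvelopingAlgebra.ι K (S.bas j))) (fun α h => ?_) (fun k _ => ?_) j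
    · refine absurd h (lt_asymm (S.lt_of_cls_lt ?_))
      rw [cls_tor]
      by_cases hα : S.IsPos α
      · rw [S.cls_rt_pos hα]; decide
      · rw [S.cls_rt_neg hα]; decide
    · rw [pow_one, commute_iff_eq, ← sub_eq_zero, ← Ring.lie_def, ← LieHom.map_lie]
      have := S.lie_torus (S.hb i) (S.hb k)
      change ⁅S.bas (S.tor i), S.bas (S.tor k)⁆ = 0 at this
      rw [this, map_zero])
  rwa [pow_one, Multiset.replicate_one, add_comm, Multiset.singleton_add] at this

theorem ordMonomial_add_p [Fact p.Prime] [CharP K p] (M : Multiset S.Idx) (α : S.R) :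
    PBW.ordMonomial S.bas (M + Multiset.replicate p (S.rt α)) =
      PBW.ordMonomial S.bas M * UniversalEnvelopingAlgebra.ι K (S.e α) ^ p :=
  PBW.ordMonomial_add_replicate S.bas p (S.rt α) fun _ _ _ => S.commute_e_pow α _

theorem rt_injective : Function.Injective S.rt := fun _ _ h => Sum.inl_injective h

theorem tor_injective : Function.Injective S.tor := fun _ _ h => Sum.inr_injective h

theorem rt_ne_tor (α : S.R) (i : Fin S.d) : S.rt α ≠ S.tor i := Sum.inl_ne_inr

variable (χ : Module.Dual K S.g)

theorem toU_surjective : Function.Surjective (S.toU χ) := RingQuot.mkAlgHom_surjective K _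

theorem toU_e_pow (α : S.R) :
    S.toU χ (UniversalEnvelopingAlgebra.ι K (S.e α) ^ p) = algebraMap K _ (χ (S.e α) ^ p) := by
  have := RingQuot.mkAlgHom_rel K (URel.pow (χ := χ) α)
  rw [AlgHom.commutes] at this
  exact this

/-- The image in `U_χ` of an ordered monomial. -/
def ordU (M : Multiset S.Idx) : S.U χ := S.toU χ (PBW.ordMonomial S.bas M)

/-- Because the relators are central, the left ideal N they generate is the whole kernel: they act
as zero on U(𝔤)/N, so U_χ acts there, and an element of the kernel sends the class of 1 to 0. -/
theorem mem_span_of_toU_eq_zero [Fact p.Prime] [CharP K p] {u : UniversalEnvelopingAlgebra K S.g}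
    (hu : S.toU χ u = 0) :
    u ∈ Submodule.span (UniversalEnvelopingAlgebra K S.g)
      (Set.range fun α : S.R => UniversalEnvelopingAlgebra.ι K (S.e α) ^ p -
        algebraMap K _ (χ (S.e α) ^ p)) := by
  set N := Submodule.span (UniversalEnvelopingAlgebra K S.g)
      (Set.range fun α : S.R => UniversalEnvelopingAlgebra.ι K (S.e α) ^ p -
        algebraMap K _ (χ (S.e α) ^ p)) with hN
  let f : S.U χ →ₐ[K] Module.End K (UniversalEnvelopingAlgebra K S.g ⧸ N) :=
    RingQuot.liftAlgHom K ⟨Algebra.lsmul K K _, by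
      rintro _ _ ⟨α⟩
      refine LinearMap.ext fun w => ?_
      obtain ⟨u, rfl⟩ := N.mkQ_surjective w
      rw [Algebra.lsmul_coe, Algebra.lsmul_coe, ← sub_eq_zero, ← sub_smul, ← map_smul,
        Submodule.mkQ_apply, Submodule.Quotient.mk_eq_zero, smul_eq_mul, sub_mul,
        (S.commute_e_pow α u).eq, Algebra.commutes, ← mul_sub]
      exact N.smul_mem _ (Submodule.subset_span ⟨α, rfl⟩)⟩
  have hf : ∀ v, f (S.toU χ v) = Algebra.lsmul K K _ v := fun v =>
    RingQuot.liftAlgHom_mkAlgHom_apply K _ _ v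
  have h1 := LinearMap.congr_fun (hf u) (N.mkQ 1)
  rw [hu, map_zero, LinearMap.zero_apply, Algebra.lsmul_coe] at h1
  beta_reduce at h1
  rw [← map_smul, smul_eq_mul, mul_one,
    eq_comm, Submodule.mkQ_apply, Submodule.Quotient.mk_eq_zero] at h1
  exact h1

/-! ### The module `U_χ ⊗_{U⁰} A^μ` -/

variable {A : Type v} [CommRing A] [Algebra K A] (π : S.U0 →ₐ[K] A)

/-- The scalar `π(μ~(x))` by which `x ∈ 𝔥` acts on vectors of weight `μ`. -/
def tw (μ : S.X) (x : S.h) : A :=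
  π (UniversalEnvelopingAlgebra.ι K x + algebraMap K _ (S.diff μ x))

theorem tw_eq (μ : S.X) (x : S.h) :
    S.tw π μ x = π (UniversalEnvelopingAlgebra.ι K x) + algebraMap K A (S.diff μ x) := by
  rw [tw, map_add, AlgHom.commutes]

theorem tw_add_diff (μ ν : S.X) (x : S.h) :
    S.tw π (μ + ν) x = S.tw π μ x + algebraMap K A (S.diff ν x) := by
  rw [tw_eq, tw_eq, diff_add, LinearMap.add_apply, map_add, add_assoc]

/-- The relations `h ⊗ 1 = 1 ⊗ π(h + dμ(h))`. -/
def torRel (μ : S.X) : Submodule (S.U χ ⊗[K] A) (S.U χ ⊗[K] A) :=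
  Submodule.span _ (Set.range fun x : S.h =>
    S.ofLie χ x ⊗ₜ[K] (1 : A) - (1 : S.U χ) ⊗ₜ[K] S.tw π μ x)

/-- The module `U_χ ⊗_{U⁰} A^μ`. -/
abbrev QMod (μ : S.X) : Type (max u v) := (S.U χ ⊗[K] A) ⧸ S.torRel χ π μ

variable [Fact p.Prime]

/-- The exponents mod `p` of the root vectors in a monomial. -/
def res (M : Multiset S.Idx) (α : S.R) : Fin p :=
  ⟨M.count (S.rt α) % p, Nat.mod_lt _ (Fact.out : p.Prime).pos⟩

/-- The scalar that splits off when a monomial is reduced to a restricted one. -/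
def coef (μ : S.X) (M : Multiset S.Idx) : A :=
  (∏ α, algebraMap K A ((χ (S.e α) ^ p) ^ (M.count (S.rt α) / p))) *
    ∏ i, S.tw π μ (S.hb i) ^ M.count (S.tor i)

/-- Reduction of ordered monomials to restricted ones. -/
def reduce (μ : S.X) : UniversalEnvelopingAlgebra K S.g →ₗ[K] ((S.R → Fin p) →₀ A) :=
  (PBW.basis S.bas).constr K fun M => Finsupp.single (S.res M) (S.coef χ π μ M)

theorem reduce_ordMonomial (μ : S.X) (M : Multiset S.Idx) :
    S.reduce χ π μ (PBW.ordMonomial S.bas M) = Finsupp.single (S.res M) (S.coef χ π μ M) := by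
  rw [← PBW.basis_apply, reduce, Module.Basis.constr_basis]

-- Right multiplication by the central e_α^p adds p copies of α to a monomial. Residues are
-- unchanged, the quotient at α grows by one, and the coefficient gains the factor χ(e_α)^p.
open Classical in
theorem reduce_mul_e_pow [CharP K p] (μ : S.X) (u : UniversalEnvelopingAlgebra K S.g) (α : S.R) :
    S.reduce χ π μ (u * (UniversalEnvelopingAlgebra.ι K (S.e α) ^ p -
      algebraMap K _ (χ (S.e α) ^ p))) = 0 := by
  suffices h : S.reduce χ π μ ∘ₗ LinearMap.mulRight K (UniversalEnvelopingAlgebra.ι K (S.e α) ^ p -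
      algebraMap K _ (χ (S.e α) ^ p)) = 0 from LinearMap.congr_fun h u
  refine (PBW.basis S.bas).ext fun M => ?_
  rw [PBW.basis_apply, LinearMap.comp_apply, LinearMap.mulRight_apply, mul_sub, map_sub,
    ← S.ordMonomial_add_p, ← Algebra.commutes, ← Algebra.smul_def, map_smul, reduce_ordMonomial,
    reduce_ordMonomial, LinearMap.zero_apply, sub_eq_zero, Finsupp.smul_single]
  have hp : 0 < p := (Fact.out : p.Prime).pos
  have hc : ∀ β, (M + Multiset.replicate p (S.rt α)).count (S.rt β) =
      M.count (S.rt β) + p * if β = α then 1 else 0 := by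
    intro β
    rw [Multiset.count_add, Multiset.count_replicate]
    by_cases h : β = α
    · simp [h]
    · rw [if_neg h, if_neg fun h' => h (S.rt_injective h'.symm), mul_zero]
  have hr : S.res (M + Multiset.replicate p (S.rt α)) = S.res M := by
    funext β
    apply Fin.ext
    simp only [res, hc, Nat.add_mul_mod_self_left]
  have ht : ∀ i, (M + Multiset.replicate p (S.rt α)).count (S.tor i) = M.count (S.tor i) := by
    intro i
    rw [Multiset.count_add, Multiset.count_replicate, if_neg (S.rt_ne_tor α i), add_zero]
  rw [hr]
  congr 1
  simp only [coef, hc, ht, Nat.add_mul_div_left _ _ hp, pow_add, map_mul, Finset.prod_mul_distrib]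
  rw [Finset.prod_eq_single_of_mem α (Finset.mem_univ α) (f := fun β => algebraMap K A
    ((χ (S.e β) ^ p) ^ if β = α then 1 else 0)) (fun β _ h => by rw [if_neg h, pow_zero, map_one])]
  rw [if_pos rfl, pow_one, Algebra.smul_def]
  ring

/-- Torus elements come last, so right multiplication by h_i adds h_i to the monomial and the
coefficient gains its scalar. General x follows by linearity. -/
theorem reduce_mul_torus (μ : S.X) (u : UniversalEnvelopingAlgebra K S.g) (x : S.h) :
    S.reduce χ π μ (u * UniversalEnvelopingAlgebra.ι K (x : S.g)) =
      S.tw π μ x • S.reduce χ π μ u := by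
  have hx : x ∈ Submodule.span K (Set.range S.hb) := S.span_hb ▸ Submodule.mem_top
  induction hx using Submodule.span_induction with
  | zero => simp [tw_eq]
  | add x y _ _ hx hy =>
    have hc : ((x + y : S.h) : S.g) = x + y := rfl
    rw [hc, map_add, mul_add, map_add, hx, hy, ← add_smul]
    congr 1
    simp only [tw_eq, map_add]
    abel
  | smul c x _ hx =>
    have hc : ((c • x : S.h) : S.g) = c • (x : S.g) := rfl
    rw [hc, map_smul, mul_smul_comm, map_smul, hx, ← smul_assoc]
    congr 1
    simp only [tw_eq, map_smul, smul_eq_mul, map_mul, Algebra.smul_def, AlgHom.commutes, mul_add]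
  | mem x hx =>
    obtain ⟨i, rfl⟩ := hx
    suffices h : S.reduce χ π μ ∘ₗ LinearMap.mulRight K
        (UniversalEnvelopingAlgebra.ι K (S.bas (S.tor i))) =
        (LinearMap.lsmul A ((S.R → Fin p) →₀ A) (S.tw π μ (S.hb i))).restrictScalars K ∘ₗ
          S.reduce χ π μ from LinearMap.congr_fun h u
    refine (PBW.basis S.bas).ext fun M => ?_
    rw [PBW.basis_apply, LinearMap.comp_apply, LinearMap.comp_apply, LinearMap.mulRight_apply,
      ← S.ordMonomial_add_tor, reduce_ordMonomial, reduce_ordMonomial,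
      LinearMap.restrictScalars_apply, LinearMap.lsmul_apply, Finsupp.smul_single]
    have hc : ∀ β, (S.tor i ::ₘ M).count (S.rt β) = M.count (S.rt β) := fun β =>
      Multiset.count_cons_of_ne (S.rt_ne_tor β i) M
    have hr : S.res (S.tor i ::ₘ M) = S.res M := by
      funext β
      simp only [res, hc]
    rw [hr]
    congr 1
    simp only [coef, hc]
    rw [smul_eq_mul, mul_left_comm]
    congr 1
    simp only [Multiset.count_cons, pow_add, Finset.prod_mul_distrib]
    rw [Finset.prod_eq_single_of_mem i (Finset.mem_univ i) (f := fun j => S.tw π μ (S.hb j) ^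
      if S.tor j = S.tor i then 1 else 0) (fun j _ h => by
        rw [if_neg fun h' => h (S.tor_injective h'), pow_zero])]
    rw [if_pos rfl, pow_one, mul_comm]

/-- `reduce` kills the kernel of U(𝔤) → U_χ and turns right multiplication by x ∈ 𝔥 into the scalar
of weight μ, so it descends. Restricted monomials go to the standard basis, which is the source of
their independence. -/
theorem exists_reduce_tensor [CharP K p] (μ : S.X) :
    ∃ f : S.U χ ⊗[K] A →ₗ[A] ((S.R → Fin p) →₀ A),
      (∀ M a, f (S.ordU χ M ⊗ₜ a) = a • Finsupp.single (S.res M) (S.coef χ π μ M)) ∧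
      ∀ x ∈ S.torRel χ π μ, f x = 0 := by
  obtain ⟨k, hk⟩ := exists_linearMap_factor (S.toU χ).toLinearMap (S.reduce χ π μ)
    (S.toU_surjective χ) (fun u hu => by
      have := S.mem_span_of_toU_eq_zero χ hu
      -- Allowing all left multiples makes the statement stable under the scalars of the left ideal.
      suffices h : ∀ v, S.reduce χ π μ (v * u) = 0 by simpa using h 1
      clear hu
      induction this using Submodule.span_induction with
      | zero => simp
      | add x y _ _ hx hy => intro v; rw [mul_add, map_add, hx, hy, add_zero]
      | smul c x _ hx => intro v; rw [smul_eq_mul, ← mul_assoc, hx]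
      | mem x hx =>
        obtain ⟨α, rfl⟩ := hx
        exact fun v => S.reduce_mul_e_pow χ π μ v α)
  let f₀ : S.U χ ⊗[K] A →ₗ[K] ((S.R → Fin p) →₀ A) :=
    TensorProduct.lift (LinearMap.mk₂ K (fun u a => a • k u)
      (fun u v a => by rw [map_add, smul_add]) (fun c u a => by rw [map_smul, smul_comm])
      (fun u a b => by rw [add_smul]) (fun c u a => by rw [smul_assoc]))
  have hf₀ : ∀ u a, f₀ (u ⊗ₜ a) = a • k u := fun u a => rfl
  let f : S.U χ ⊗[K] A →ₗ[A] ((S.R → Fin p) →₀ A) :=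
    { f₀ with
      map_smul' := fun a x => by
        change f₀ (a • x) = a • f₀ x
        induction x using TensorProduct.induction_on with
        | zero => simp
        | add x y hx hy => rw [smul_add, map_add, hx, hy, map_add, smul_add]
        | tmul u b =>
          rw [Algebra.smul_def, Algebra.TensorProduct.right_algebraMap_apply,
            Algebra.TensorProduct.tmul_mul_tmul, one_mul, hf₀, hf₀, mul_smul] }
  have hf : ∀ u a, f (u ⊗ₜ a) = a • k u := fun u a => rfl
  refine ⟨f, fun M a => ?_, fun x hx => ?_⟩
  · rw [hf, ← reduce_ordMonomial]
    exact congrArg _ (hk _)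
  · suffices h : ∀ y, f (y * x) = 0 by simpa using h 1
    induction hx using Submodule.span_induction with
    | zero => simp
    | add x y _ _ hx hy => intro v; rw [mul_add, map_add, hx, hy, add_zero]
    | smul c x _ hx => intro v; rw [smul_eq_mul, ← mul_assoc, hx]
    | mem x hx =>
      obtain ⟨x, rfl⟩ := hx
      intro y
      induction y using TensorProduct.induction_on with
      | zero => simp
      | add y z hy hz => rw [add_mul, map_add, hy, hz, add_zero]
      | tmul u a =>
        obtain ⟨u, rfl⟩ := S.toU_surjective χ u
        rw [mul_sub, Algebra.TensorProduct.tmul_mul_tmul, Algebra.TensorProduct.tmul_mul_tmul,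
          mul_one, mul_one, map_sub, hf, hf, ofLie, ← map_mul]
        have h1 := hk (u * UniversalEnvelopingAlgebra.ι K (x : S.g))
        have h2 := hk u
        rw [AlgHom.toLinearMap_apply] at h1 h2
        rw [h1, h2, reduce_mul_torus, smul_smul, sub_self]

end ReductiveGroup

end

section

namespace ReductiveGroup

variable {K : Type u} [Field K] {p : ℕ} (S : ReductiveGroup K p)

/-! ### Restricted monomials -/

/-- The monomial in the root vectors with exponents `n`. -/
def mset (n : S.R → Fin p) : Multiset S.Idx := ∑ α, Multiset.replicate (n α) (S.rt α)

theorem count_rt_mset (n : S.R → Fin p) (α : S.R) : (S.mset n).count (S.rt α) = n α := by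
  rw [mset, Multiset.count_sum', Finset.sum_eq_single_of_mem α (Finset.mem_univ α)]
  · rw [Multiset.count_replicate, if_pos rfl]
  · intro β _ h
    rw [Multiset.count_replicate, if_neg fun h' => h (S.rt_injective h')]

theorem count_tor_mset (n : S.R → Fin p) (i : Fin S.d) : (S.mset n).count (S.tor i) = 0 := by
  rw [mset, Multiset.count_sum']
  refine Finset.sum_eq_zero fun α _ => ?_
  rw [Multiset.count_replicate, if_neg (S.rt_ne_tor α i)]

theorem eq_mset [Fact p.Prime] {M : Multiset S.Idx} (h1 : ∀ i, S.tor i ∉ M) (h2 : ∀ α, M.count (S.rt α) < p) :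
    M = S.mset (S.res M) := by
  ext i
  refine S.idx_cases (q := fun i => M.count i = (S.mset (S.res M)).count i)
    (fun α => ?_) (fun i => ?_) i
  · rw [count_rt_mset]
    exact (Nat.mod_eq_of_lt (h2 α)).symm
  · rw [count_tor_mset, Multiset.count_eq_zero_of_notMem (h1 i)]

theorem res_mset [Fact p.Prime] (n : S.R → Fin p) : S.res (S.mset n) = n := by
  funext α
  apply Fin.ext
  simp only [res, count_rt_mset, Nat.mod_eq_of_lt (n α).2]

variable (χ : Module.Dual K S.g) (I : Set S.R)

/-! ### Torus vectors and reduction to restricted monomials -/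

section Modules

variable {A : Type v} [CommRing A] [Algebra K A] (π : S.U0 →ₐ[K] A)

theorem coef_mset (μ : S.X) (n : S.R → Fin p) : S.coef χ π μ (S.mset n) = 1 := by
  simp [coef, count_rt_mset, count_tor_mset, Nat.div_eq_of_lt (Fin.is_lt _)]

variable {V : Type*} [AddCommGroup V] [Module (S.U χ ⊗[K] A) V]

/-- Vectors on which `x ∈ 𝔥` acts as the scalar `π(μ~(x))`. -/
def IsTorusVector (μ : S.X) (v : V) : Prop :=
  ∀ x : S.h, (S.ofLie χ x ⊗ₜ[K] (1 : A)) • v = ((1 : S.U χ) ⊗ₜ[K] S.tw π μ x) • v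

variable {S χ π}

theorem mul_tmul_one_smul (x y : S.U χ) (v : V) :
    ((x * y) ⊗ₜ[K] (1 : A)) • v = (x ⊗ₜ[K] (1 : A)) • (y ⊗ₜ[K] (1 : A)) • v := by
  rw [smul_smul, Algebra.TensorProduct.tmul_mul_tmul, one_mul]

theorem add_tmul_one_smul (x y : S.U χ) (v : V) :
    ((x + y) ⊗ₜ[K] (1 : A)) • v = (x ⊗ₜ[K] (1 : A)) • v + (y ⊗ₜ[K] (1 : A)) • v := by
  rw [TensorProduct.add_tmul, add_smul]

variable [Module A V] [IsScalarTower A (S.U χ ⊗[K] A) V]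

theorem one_tmul_smul (a : A) (v : V) : ((1 : S.U χ) ⊗ₜ[K] a) • v = a • v := by
  rw [← Algebra.TensorProduct.right_algebraMap_apply, algebraMap_smul]

theorem smul_smul_right (x : S.U χ ⊗[K] A) (a : A) (v : V) : x • a • v = a • x • v := by
  rw [← one_tmul_smul (S := S) (χ := χ), ← one_tmul_smul (S := S) (χ := χ) a (x • v), smul_smul,
    smul_smul, ← Algebra.TensorProduct.right_algebraMap_apply, Algebra.commutes]

theorem algebraMap_tmul_smul (c : K) (v : V) :
    ((algebraMap K (S.U χ) c) ⊗ₜ[K] (1 : A)) • v = algebraMap K A c • v := by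
  rw [← one_tmul_smul (S := S) (χ := χ), Algebra.algebraMap_eq_smul_one,
    Algebra.algebraMap_eq_smul_one, TensorProduct.smul_tmul]

theorem smul_tmul_one_smul (c : K) (u : S.U χ) (v : V) :
    ((c • u) ⊗ₜ[K] (1 : A)) • v = algebraMap K A c • (u ⊗ₜ[K] (1 : A)) • v := by
  rw [← algebraMap_tmul_smul (S := S) (χ := χ), smul_smul, Algebra.TensorProduct.tmul_mul_tmul,
    one_mul, Algebra.smul_def]

/-- The image in `V` of a `K`-subspace of `U_χ` that is spanned by a given set. -/
theorem tmul_smul_mem_span {s : Set (S.U χ)} {u : S.U χ} (hu : u ∈ Submodule.span K s) (v : V) :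
    (u ⊗ₜ[K] (1 : A)) • v ∈ Submodule.span A ((fun u => (u ⊗ₜ[K] (1 : A)) • v) '' s) := by
  induction hu using Submodule.span_induction with
  | zero => rw [TensorProduct.zero_tmul, zero_smul]; exact zero_mem _
  | add x y _ _ hx hy => rw [add_tmul_one_smul]; exact add_mem hx hy
  | smul c x _ hx => rw [smul_tmul_one_smul]; exact Submodule.smul_mem _ _ hx
  | mem x hx => exact Submodule.subset_span ⟨x, hx, rfl⟩

theorem IsTorusVector.smul_eq {μ : S.X} {v : V} (hv : S.IsTorusVector χ π μ v) (x : S.h) :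
    (S.ofLie χ x ⊗ₜ[K] (1 : A)) • v = S.tw π μ x • v := by
  rw [hv x, one_tmul_smul]

theorem torus_mul_ordU (x : S.h) (M : Multiset S.Idx) :
    S.ofLie χ x * S.ordU χ M = S.ordU χ M * S.ofLie χ x + S.diff (S.wtM M) x • S.ordU χ M := by
  rw [ofLie, ordU, ← map_mul, torus_mul_ordMonomial, map_add, map_mul, map_smul]

theorem IsTorusVector.ordU_smul {μ : S.X} {v : V} (hv : S.IsTorusVector χ π μ v)
    (M : Multiset S.Idx) :
    S.IsTorusVector χ π (μ + S.wtM M) ((S.ordU χ M ⊗ₜ[K] (1 : A)) • v) := by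
  intro x
  rw [← mul_tmul_one_smul, torus_mul_ordU, add_tmul_one_smul, mul_tmul_one_smul, hv.smul_eq,
    smul_tmul_one_smul, smul_smul_right, one_tmul_smul, tw_add_diff, add_smul]

/-- The restricted monomials whose degree and weight agree with those of `ν`. -/
def good (I : Set S.R) (ν : S.X) : Set (S.R → Fin p) :=
  {n | (QuotientAddGroup.mk (S.wtM (S.mset n)) : S.XI I) = QuotientAddGroup.mk ν ∧
    S.diff (S.wtM (S.mset n)) = S.diff ν}

variable [Fact p.Prime] [CharP K p]

/-- In `V`, an ordered monomial reduces to a restricted one of the same degree and weight. -/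
theorem ordU_smul_mem (hχ : S.IsStandardLeviForm χ I) {μ : S.X} {v : V}
    (hv : S.IsTorusVector χ π μ v) (M : Multiset S.Idx) :
    (S.ordU χ M ⊗ₜ[K] (1 : A)) • v ∈ Submodule.span A
      ((fun n => (S.ordU χ (S.mset n) ⊗ₜ[K] (1 : A)) • v) '' good I (S.wtM M)) := by
  induction hn : M.card using Nat.strong_induction_on generalizing M with
  | _ k ih =>
  by_cases h1 : ∃ i, S.tor i ∈ M
  · obtain ⟨i, hi⟩ := h1
    obtain ⟨N, rfl⟩ := Multiset.exists_cons_of_mem hi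
    rw [ordU, ordMonomial_add_tor, map_mul, mul_tmul_one_smul]
    have h2 := hv.smul_eq (S.hb i)
    rw [ofLie] at h2
    change (S.toU χ (UniversalEnvelopingAlgebra.ι K (S.bas (S.tor i))) ⊗ₜ[K] (1 : A)) • v = _ at h2
    rw [h2, smul_smul_right, wtM_cons, wt_tor, zero_add]
    exact Submodule.smul_mem _ _ (ih N.card (by simp [← hn]) N rfl)
  · by_cases h2 : ∃ α, p ≤ M.count (S.rt α)
    · obtain ⟨α, hα⟩ := h2
      obtain ⟨N, rfl⟩ : ∃ N, M = N + Multiset.replicate p (S.rt α) := by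
        rw [Multiset.le_count_iff_replicate_le] at hα
        exact ⟨M - _, (Multiset.sub_add_cancel hα).symm⟩
      rw [ordU, ordMonomial_add_p, map_mul, mul_tmul_one_smul, toU_e_pow, algebraMap_tmul_smul,
        smul_smul_right]
      -- If χ(e_α) = 0 the term vanishes. If not, α ∈ ℤI, so dropping p copies of α changes neither
      -- the class in X/ℤI nor, by d(pα) = 0, the weight.
      by_cases h0 : χ (S.e α) = 0
      · rw [h0, zero_pow (Fact.out : p.Prime).ne_zero, map_zero, zero_smul]
        exact zero_mem _
      · have hg : good (p := p) I (S.wtM (N + Multiset.replicate p (S.rt α))) =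
            good I (S.wtM N) := by
          have h3 : (QuotientAddGroup.mk (S.wtM (N + Multiset.replicate p (S.rt α))) : S.XI I) =
              QuotientAddGroup.mk (S.wtM N) := by
            rw [wtM_add, QuotientAddGroup.eq, wtM_replicate, wt_rt, neg_add_rev, add_assoc,
              neg_add_cancel, add_zero]
            exact neg_mem (nsmul_mem (mem_ZI_of_chi_ne_zero hχ h0) p)
          have h4 : S.diff (S.wtM (N + Multiset.replicate p (S.rt α))) = S.diff (S.wtM N) := by
            rw [wtM_add, diff_add, wtM_replicate, diff_p_smul, add_zero]
          ext n
          simp only [good, Set.mem_ofPred_eq, h3, h4]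
        rw [hg]
        refine Submodule.smul_mem _ _ (ih N.card ?_ N rfl)
        simp [← hn, (Fact.out : p.Prime).pos]
    · push Not at h1 h2
      have h3 := S.eq_mset h1 h2
      refine Submodule.subset_span ⟨S.res M, ?_, ?_⟩
      · rw [good, Set.mem_ofPred_eq, ← h3]
        exact ⟨rfl, rfl⟩
      · exact congrArg (fun N => (S.ordU χ N ⊗ₜ[K] (1 : A)) • v) h3.symm

/-- A root vector acts on the restricted monomials with the expected degree and weight. -/
theorem e_smul_ordU_smul_mem (hχ : S.IsStandardLeviForm χ I) {μ : S.X} {v : V}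
    (hv : S.IsTorusVector χ π μ v) (α : S.R) (M : Multiset S.Idx) :
    (S.ofLie χ (S.e α) ⊗ₜ[K] (1 : A)) • (S.ordU χ M ⊗ₜ[K] (1 : A)) • v ∈ Submodule.span A
      ((fun n => (S.ordU χ (S.mset n) ⊗ₜ[K] (1 : A)) • v) '' good I (α.1 + S.wtM M)) := by
  have h := PBW.ι_mul_ordMonomial_mem S.bas (P := Set.univ) (wt := S.wt)
    (fun i _ j _ k hk => ⟨Set.mem_univ k, S.wt_of_repr_lie_ne_zero hk⟩) (i := S.rt α)
    (Set.mem_univ _) (γ := S.wtM M) (M := M) ⟨fun _ _ => Set.mem_univ _, rfl⟩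
  have h2 := Submodule.mem_map_of_mem (f := (S.toU χ).toLinearMap) h
  rw [Submodule.map_span, AlgHom.toLinearMap_apply, map_mul] at h2
  rw [← mul_tmul_one_smul]
  have h3 := tmul_smul_mem_span (A := A) h2 v
  refine Submodule.span_le.2 ?_ h3
  rintro _ ⟨_, ⟨_, ⟨N, hN, rfl⟩, rfl⟩, rfl⟩
  have h4 := ordU_smul_mem I hχ hv N
  rwa [show S.wtM N = _ from hN.2, wt_rt] at h4

/-- The module generated by a torus vector is spanned over `A` by restricted monomials. -/
theorem smul_mem_span_ordU_smul (hχ : S.IsStandardLeviForm χ I) {μ : S.X} {v : V}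
    (hv : S.IsTorusVector χ π μ v) (x : S.U χ ⊗[K] A) :
    x • v ∈ Submodule.span A (Set.range fun n : S.R → Fin p =>
      (S.ordU χ (S.mset n) ⊗ₜ[K] (1 : A)) • v) := by
  induction x using TensorProduct.induction_on with
  | zero => rw [zero_smul]; exact zero_mem _
  | add x y hx hy => rw [add_smul]; exact add_mem hx hy
  | tmul u a =>
    have h1 : (u ⊗ₜ[K] a) • v = a • (u ⊗ₜ[K] (1 : A)) • v := by
      rw [← one_tmul_smul (S := S) (χ := χ), smul_smul, Algebra.TensorProduct.tmul_mul_tmul,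
        one_mul, mul_one]
    rw [h1]
    refine Submodule.smul_mem _ _ ?_
    obtain ⟨u, rfl⟩ := S.toU_surjective χ u
    have h2 := Submodule.mem_map_of_mem (f := (S.toU χ).toLinearMap)
      ((PBW.basis S.bas).mem_span u)
    rw [Submodule.map_span, AlgHom.toLinearMap_apply] at h2
    refine Submodule.span_le.2 ?_ (tmul_smul_mem_span (A := A) h2 v)
    rintro _ ⟨_, ⟨_, ⟨N, rfl⟩, rfl⟩, rfl⟩
    rw [PBW.basis_apply]
    exact Submodule.span_mono (Set.image_subset_range _ _) (ordU_smul_mem I hχ hv N)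

end Modules

/-! ### The monomial basis of U_χ ⊗_{U⁰} A^μ -/

section QMod

variable {S χ I}
variable {A : Type v} [CommRing A] [Algebra K A] (π : S.U0 →ₐ[K] A)

variable (χ) in
/-- The generator of `U_χ ⊗_{U⁰} A^μ`. -/
def qgen (μ : S.X) : S.QMod χ π μ := (S.torRel χ π μ).mkQ 1

theorem smul_qgen (μ : S.X) (x : S.U χ ⊗[K] A) : x • S.qgen χ π μ = (S.torRel χ π μ).mkQ x := by
  rw [qgen, ← map_smul, smul_eq_mul, mul_one]

theorem isTorusVector_qgen (μ : S.X) : S.IsTorusVector χ π μ (S.qgen χ π μ) := by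
  intro x
  rw [← sub_eq_zero, ← sub_smul, smul_qgen, Submodule.mkQ_apply, Submodule.Quotient.mk_eq_zero]
  exact Submodule.subset_span ⟨x, rfl⟩

variable [Fact p.Prime] [CharP K p]

/-- The basis of `U_χ ⊗_{U⁰} A^μ` that consists of the restricted monomials in the root vectors. -/
def qbasis (hχ : S.IsStandardLeviForm χ I) (μ : S.X) :
    Module.Basis (S.R → Fin p) A (S.QMod χ π μ) :=
  Module.Basis.mk (v := fun n => (S.ordU χ (S.mset n) ⊗ₜ[K] (1 : A)) • S.qgen χ π μ) (by
    obtain ⟨f, hf, hf0⟩ := S.exists_reduce_tensor χ π μ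
    let f' : S.QMod χ π μ →ₗ[A] ((S.R → Fin p) →₀ A) :=
      ((S.torRel χ π μ).restrictScalars A).liftQ f (fun x hx => LinearMap.mem_ker.2 (hf0 x hx)) ∘ₗ
        (Submodule.Quotient.restrictScalarsEquiv A (S.torRel χ π μ)).symm.toLinearMap
    -- Independence is tested after the reduction map, which sends the n-th vector to the n-th
    -- standard basis vector.
    refine LinearIndependent.of_comp f' ?_
    have : f' ∘ (fun n => (S.ordU χ (S.mset n) ⊗ₜ[K] (1 : A)) • S.qgen χ π μ) =
        fun n => Finsupp.single n (1 : A) := by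
      funext n
      rw [Function.comp_apply, smul_qgen]
      change f (S.ordU χ (S.mset n) ⊗ₜ[K] (1 : A)) = _
      rw [hf, res_mset, coef_mset, one_smul]
    rw [this]
    exact Finsupp.basisSingleOne.linearIndependent) (by
    intro w _
    obtain ⟨x, rfl⟩ := (S.torRel χ π μ).mkQ_surjective w
    rw [← smul_qgen]
    exact smul_mem_span_ordU_smul I hχ (isTorusVector_qgen π μ) x)

theorem qbasis_apply (hχ : S.IsStandardLeviForm χ I) (μ : S.X) (n : S.R → Fin p) :
    qbasis π hχ μ n = (S.ordU χ (S.mset n) ⊗ₜ[K] (1 : A)) • S.qgen χ π μ :=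
  Module.Basis.mk_apply _ _ n

end QMod

end ReductiveGroup

end

section

/-! ### Independent families of subgroups -/

section Independence

variable {C : Type*} {M N : Type*} [AddCommGroup M] [AddCommGroup N]

theorem iSup_toAddSubgroup {A : Type*} [Ring A] [Module A M] (P : C → Submodule A M) :
    ⨆ c, (P c).toAddSubgroup = (⨆ c, P c).toAddSubgroup := by
  refine le_antisymm (iSup_le fun c => Submodule.toAddSubgroup_mono (le_iSup P c)) fun x hx => ?_
  refine Submodule.iSup_induction P (motive := fun x => x ∈ ⨆ c, (P c).toAddSubgroup)
    ((Submodule.mem_toAddSubgroup _).1 hx) (fun c x hx => ?_) (zero_mem _) fun x y hx hy => add_mem hx hy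
  exact (le_iSup (fun c => (P c).toAddSubgroup) c) hx

theorem exists_finset_sum_of_mem_iSup {G : C → AddSubgroup M} {y : M} (hy : y ∈ ⨆ c, G c) :
    ∃ (s : Finset C) (g : C → M), (∀ c, g c ∈ G c) ∧ y = ∑ c ∈ s, g c := by
  classical
  refine AddSubgroup.iSup_induction G (C := fun y => ∃ (s : Finset C) (g : C → M),
    (∀ c, g c ∈ G c) ∧ y = ∑ c ∈ s, g c) hy (fun c x hx => ?_)
    ⟨∅, 0, fun c => zero_mem _, by simp⟩ fun x y hx hy => ?_
  · refine ⟨{c}, Pi.single c x, fun d => ?_, by simp⟩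
    rcases eq_or_ne d c with rfl | h
    · rwa [Pi.single_eq_same]
    · rw [Pi.single_eq_of_ne h]; exact zero_mem _
  · obtain ⟨s, g, hg, rfl⟩ := hx
    obtain ⟨t, h, hh, rfl⟩ := hy
    refine ⟨s ∪ t, fun c => (if c ∈ s then g c else 0) + (if c ∈ t then h c else 0), fun c => ?_, ?_⟩
    · refine add_mem ?_ ?_
      · split_ifs; exacts [hg c, zero_mem _]
      · split_ifs; exacts [hh c, zero_mem _]
    · rw [Finset.sum_add_distrib]
      congr 1
      · rw [← Finset.sum_filter, Finset.filter_mem_eq_inter, Finset.union_inter_cancel_left]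
      · rw [← Finset.sum_filter, Finset.filter_mem_eq_inter, Finset.union_inter_cancel_right]

theorem eq_zero_of_sum_eq_zero {G : C → AddSubgroup M} (hG : iSupIndep G) {s : Finset C} {g : C → M}
    (hg : ∀ c, g c ∈ G c) (h : ∑ c ∈ s, g c = 0) {c : C} (hc : c ∈ s) : g c = 0 := by
  classical
  have h1 : -g c = ∑ d ∈ s.erase c, g d := by
    rw [← Finset.add_sum_erase s g hc] at h
    exact neg_eq_of_add_eq_zero_right h
  have h2 : -g c ∈ ⨆ (d) (_ : d ≠ c), G d := by
    rw [h1]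
    refine sum_mem fun d hd => ?_
    exact AddSubgroup.mem_iSup_of_mem d (AddSubgroup.mem_iSup_of_mem (Finset.ne_of_mem_erase hd)
      (hg d))
  exact neg_eq_zero.1 ((AddSubgroup.disjoint_def.1 (hG c)) (neg_mem (hg c)) h2)

theorem exists_add_of_mem_iSup {G : C → AddSubgroup M} {y : M} (hy : y ∈ ⨆ c, G c) (c : C) :
    ∃ y₁ ∈ G c, ∃ y₂ ∈ ⨆ (d) (_ : d ≠ c), G d, y = y₁ + y₂ := by
  have h : ⨆ c, G c ≤ G c ⊔ ⨆ (d) (_ : d ≠ c), G d := by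
    refine iSup_le fun d => ?_
    rcases eq_or_ne d c with rfl | hd
    · exact le_sup_left
    · exact (le_iSup₂ (f := fun d (_ : d ≠ c) => G d) d hd).trans le_sup_right
  obtain ⟨y₁, h₁, y₂, h₂, rfl⟩ := AddSubgroup.mem_sup.1 (h hy)
  exact ⟨y₁, h₁, y₂, h₂, rfl⟩

/-- A homogeneous element in the image of a graded map is the image of a homogeneous element. -/
theorem exists_homogeneous_preimage {G : C → AddSubgroup N} (hG : iSupIndep G)
    {H : C → AddSubgroup M} (f : M →+ N) (hf : ∀ c, ∀ x ∈ H c, f x ∈ G c) {y : M}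
    (hy : y ∈ ⨆ c, H c) {c : C} (hc : f y ∈ G c) : ∃ y' ∈ H c, f y' = f y := by
  obtain ⟨y₁, h₁, y₂, h₂, rfl⟩ := exists_add_of_mem_iSup hy c
  refine ⟨y₁, h₁, ?_⟩
  have h3 : f y₂ ∈ ⨆ (d) (_ : d ≠ c), G d := by
    have h4 : (⨆ (d) (_ : d ≠ c), H d) ≤ (⨆ (d) (_ : d ≠ c), G d).comap f :=
      iSup₂_le fun d hd x hx => AddSubgroup.mem_iSup_of_mem d
        (AddSubgroup.mem_iSup_of_mem hd (hf d x hx))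
    exact h4 h₂
  have h5 : f y₂ ∈ G c := by
    rw [map_add] at hc
    exact (AddSubgroup.add_mem_cancel_left _ (hf c _ h₁)).1 hc
  rw [map_add, AddSubgroup.disjoint_def.1 (hG c) h5 h3, add_zero]

/-- Independence of a family is inherited by the quotient by a homogeneous subgroup. -/
theorem iSupIndep_map {G : C → AddSubgroup M} (hG : iSupIndep G) (q : M →+ N)
    {H : C → AddSubgroup M} (hH : ∀ c, H c ≤ G c) (hHq : ∀ c, ∀ x ∈ H c, q x = 0)
    (hN : ∀ x ∈ ⨆ c, G c, q x = 0 → x ∈ ⨆ c, H c) : iSupIndep fun c => (G c).map q := by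
  intro c
  rw [AddSubgroup.disjoint_def]
  rintro z ⟨x, hx, rfl⟩ hz
  have h1 : (⨆ (d) (_ : d ≠ c), (G d).map q) = (⨆ (d) (_ : d ≠ c), G d).map q := by
    simp only [AddSubgroup.map_iSup]
  rw [h1] at hz
  obtain ⟨y, hy, hxy⟩ := hz
  have hle : (⨆ (d) (_ : d ≠ c), G d) ≤ ⨆ d, G d := iSup₂_le fun d _ => le_iSup G d
  have h2 : x - y ∈ ⨆ c, H c := by
    refine hN _ (sub_mem (AddSubgroup.mem_iSup_of_mem c hx) (hle hy)) ?_
    rw [map_sub, hxy, sub_self]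
  obtain ⟨a, ha, a', ha', hxa⟩ := exists_add_of_mem_iSup h2 c
  have h3 : a' ∈ ⨆ (d) (_ : d ≠ c), G d := iSup₂_mono (fun d _ => hH d) ha'
  have h4 : x - a = 0 := by
    refine AddSubgroup.disjoint_def.1 (hG c) (sub_mem hx (hH c ha)) ?_
    have : x - a = a' + y := by rw [← sub_eq_iff_eq_add, sub_right_comm, hxa, add_sub_cancel_left]
    rw [this]
    exact add_mem h3 hy
  rw [sub_eq_zero.1 h4]
  exact hHq c a ha

theorem iSupIndep_span_image {J A : Type*} [CommRing A] [Module A M] {b : J → M}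
    (hb : LinearIndependent A b) {s : C → Set J} (hs : ∀ c d, c ≠ d → Disjoint (s c) (s d)) :
    iSupIndep fun c => (Submodule.span A (b '' s c)).toAddSubgroup := by
  intro c
  rw [AddSubgroup.disjoint_def]
  intro x hx hx'
  have h1 : (⨆ (d) (_ : d ≠ c), (Submodule.span A (b '' s d)).toAddSubgroup) ≤
      (Submodule.span A (b '' (s c)ᶜ)).toAddSubgroup :=
    iSup₂_le fun d hd => Submodule.toAddSubgroup_mono (Submodule.span_mono (Set.image_mono
      (hs d c hd).subset_compl_right))
  exact Submodule.disjoint_def.1 (hb.disjoint_span_image disjoint_compl_right) x hx (h1 hx')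

/-- Translates A-spans into the additive closures by which `CA` expresses finite generation. -/
theorem span_toAddSubgroup {A : Type*} [CommRing A] [Module A M] (s : Set M) :
    (Submodule.span A s).toAddSubgroup = AddSubgroup.closure {y | ∃ m ∈ s, ∃ a : A, y = a • m} := by
  apply le_antisymm
  · intro x hx
    rw [Submodule.mem_toAddSubgroup] at hx
    induction hx using Submodule.span_induction with
    | zero => exact zero_mem _
    | add x y _ _ hx hy => exact add_mem hx hy
    | mem x hx => exact AddSubgroup.subset_closure ⟨x, hx, 1, (one_smul A x).symm⟩
    | smul a x hx' hx =>
      clear hx'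
      induction hx using AddSubgroup.closure_induction with
      | zero => rw [smul_zero]; exact zero_mem _
      | add x y _ _ hx hy => rw [smul_add]; exact add_mem hx hy
      | neg x _ hx => rw [smul_neg]; exact neg_mem hx
      | mem x hx =>
        obtain ⟨m, hm, c, rfl⟩ := hx
        exact AddSubgroup.subset_closure ⟨m, hm, a * c, (mul_smul a c m).symm⟩
  · rw [AddSubgroup.closure_le]
    rintro _ ⟨m, hm, a, rfl⟩
    exact Submodule.smul_mem _ _ (Submodule.subset_span hm)

end Independence

open ReductiveGroup

variable {K : Type u} [Field K] {p : ℕ} {S : ReductiveGroup K p} {χ : Module.Dual K S.g}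
  {I : Set S.R} {A : Type v} [CommRing A] [Algebra K A] {π : S.U0 →ₐ[K] A}

/-! ### Objects of `𝒞_A` given by a basis of weight vectors -/

section OfBasis

variable {V : Type (max u v)} [AddCommGroup V] [Module (S.U χ ⊗[K] A) V] [Module A V]
  [IsScalarTower A (S.U χ ⊗[K] A) V] {J : Type*} [Finite J]

/-- The indices of the basis vectors of degree `ξ`. -/
def grIdx (I : Set S.R) (ω : J → S.X) (ξ : S.XI I) : Set J := {j | QuotientAddGroup.mk (ω j) = ξ}

/-- The indices of the basis vectors of degree `ξ` and weight `w`. -/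
def wtIdx (I : Set S.R) (ω : J → S.X) (ξ : S.XI I) (w : Module.Dual K S.h) : Set J :=
  {j | QuotientAddGroup.mk (ω j) = ξ ∧ S.diff (ω j) = w}

/-- `A`-linear maps carry spans to spans. -/
theorem smul_mem_of_mem_span {s : Set V} {P : Submodule A V} (x : S.U χ ⊗[K] A)
    (h : ∀ v ∈ s, x • v ∈ P) {v : V} (hv : v ∈ Submodule.span A s) : x • v ∈ P := by
  induction hv using Submodule.span_induction with
  | zero => rw [smul_zero]; exact zero_mem _
  | add v w _ _ hv hw => rw [smul_add]; exact add_mem hv hw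
  | smul a v _ hv => rw [smul_smul_right]; exact Submodule.smul_mem _ _ hv
  | mem v hv => exact h v hv

/-- The object of `𝒞_A` given by a module with an `A`-basis of weight vectors. -/
def CA.ofBasis (b : Module.Basis J A V) (ω : J → S.X)
    (htor : ∀ j, S.IsTorusVector χ π (ω j) (b j))
    (hroot : ∀ j α, (S.ofLie χ (S.e α) ⊗ₜ[K] (1 : A)) • b j ∈ Submodule.span A
      (b '' wtIdx I ω (QuotientAddGroup.mk (ω j + α.1)) (S.diff (ω j + α.1)))) :
    CA S χ I π where
  carrier := V
  gr ξ := (Submodule.span A (b '' grIdx I ω ξ)).toAddSubgroup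
  wt ξ w := (Submodule.span A (b '' wtIdx I ω ξ w)).toAddSubgroup
  gr_indep := iSupIndep_span_image b.linearIndependent fun c d h =>
    Set.disjoint_left.2 fun j hc hd => h (hc.symm.trans hd)
  gr_top := by
    rw [iSup_toAddSubgroup, Submodule.toAddSubgroup_eq_top, ← Submodule.span_iUnion,
      ← Set.image_iUnion, ← b.span_eq]
    congr 1
    rw [← Set.image_univ]
    congr 1
    exact Set.eq_univ_of_forall fun j => Set.mem_iUnion.2 ⟨_, rfl⟩
  gr_smul ξ a m hm := by
    rw [one_tmul_smul]
    exact Submodule.smul_mem _ _ hm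
  gr_finite := by
    refine (Set.finite_range fun j => (QuotientAddGroup.mk (ω j) : S.XI I)).subset fun ξ hξ => ?_
    by_contra hr
    refine hξ ?_
    have : grIdx I ω ξ = ∅ := Set.eq_empty_of_forall_notMem fun j hj => hr ⟨j, hj⟩
    rw [this, Set.image_empty, Submodule.span_empty, Submodule.bot_toAddSubgroup]
  gr_fg ξ := by
    refine ⟨(Set.toFinite (b '' grIdx I ω ξ)).toFinset, ?_⟩
    rw [span_toAddSubgroup]
    simp only [one_tmul_smul, Set.Finite.mem_toFinset]
  gr_mul σ ξ u hu m hm := by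
    rw [Submodule.mem_toAddSubgroup] at hm ⊢
    induction hu using Submodule.span_induction with
    | zero => rw [TensorProduct.zero_tmul, zero_smul]; exact zero_mem _
    | add x y _ _ hx hy => rw [add_tmul_one_smul]; exact add_mem hx hy
    | smul c x _ hx => rw [smul_tmul_one_smul]; exact Submodule.smul_mem _ _ hx
    | mem x hx =>
      induction hx with
      | one => rwa [← Algebra.TensorProduct.one_def, one_smul, zero_add]
      | @root α σ u _ ih =>
        rw [mul_tmul_one_smul, add_assoc]
        refine smul_mem_of_mem_span _ ?_ ih
        rintro _ ⟨j, hj, rfl⟩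
        refine Submodule.span_mono (Set.image_mono fun k hk => ?_) (hroot j α)
        refine hk.1.trans ?_
        rw [QuotientAddGroup.mk_add, show (QuotientAddGroup.mk (ω j) : S.XI I) = σ + ξ from hj,
          add_comm]
      | @torus x σ u _ ih =>
        rw [mul_tmul_one_smul]
        refine smul_mem_of_mem_span _ ?_ ih
        rintro _ ⟨j, hj, rfl⟩
        rw [(htor j).smul_eq]
        exact Submodule.smul_mem _ _ (Submodule.subset_span ⟨j, hj, rfl⟩)
  wt_eq_bot ξ w hw := by
    have : wtIdx I ω ξ w = ∅ := Set.eq_empty_of_forall_notMem fun j hj =>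
      hw ⟨ω j, 0, by rw [smul_zero, sub_zero]; exact hj.1, hj.2.symm⟩
    rw [this, Set.image_empty, Submodule.span_empty, Submodule.bot_toAddSubgroup]
  wt_indep ξ := iSupIndep_span_image b.linearIndependent fun c d h =>
    Set.disjoint_left.2 fun j hc hd => h (hc.2.symm.trans hd.2)
  wt_iSup ξ := by
    rw [iSup_toAddSubgroup, ← Submodule.span_iUnion, ← Set.image_iUnion]
    congr 3
    ext j
    simp [wtIdx, grIdx]
  wt_torus ξ μ x m hm := by
    rw [one_tmul_smul]
    rw [Submodule.mem_toAddSubgroup] at hm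
    induction hm using Submodule.span_induction with
    | zero => simp
    | add x y _ _ hx hy => rw [smul_add, smul_add, hx, hy]
    | smul c x _ hx => rw [smul_smul_right, hx, smul_comm]
    | mem m hm =>
      obtain ⟨j, hj, rfl⟩ := hm
      rw [(htor j).smul_eq, tw, hj.2]
  wt_root ξ μ α m hm := by
    rw [Submodule.mem_toAddSubgroup] at hm ⊢
    refine smul_mem_of_mem_span _ ?_ hm
    rintro _ ⟨j, hj, rfl⟩
    have h := hroot j α
    rwa [QuotientAddGroup.mk_add, hj.1, diff_add, hj.2, ← diff_add] at h
  wt_smul ξ w a m hm := by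
    rw [one_tmul_smul]
    exact Submodule.smul_mem _ _ hm

end OfBasis

/-! ### Weight vectors in objects of `𝒞_A` -/

namespace CA

variable (M : CA S χ I π)

theorem wt_torus' {ξ : S.XI I} {μ : S.X} {m : M.carrier} (hm : m ∈ M.wt ξ (S.diff μ)) :
    S.IsTorusVector χ π μ m := fun x => M.wt_torus ξ μ x m hm

theorem ordU_smul_mem_wt {ξ : S.XI I} {μ : S.X} {m : M.carrier} (hm : m ∈ M.wt ξ (S.diff μ))
    (L : Multiset S.Idx) : (S.ordU χ L ⊗ₜ[K] (1 : A)) • m ∈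
      M.wt (ξ + QuotientAddGroup.mk (S.wtM L)) (S.diff (μ + S.wtM L)) := by
  induction L using PBW.sorted_induction with
  | h0 => simpa [ordU, PBW.ordMonomial_zero, ← Algebra.TensorProduct.one_def] using hm
  | h1 j N hj ih =>
    rw [ordU, PBW.ordMonomial_cons S.bas hj, map_mul, mul_tmul_one_smul, wtM_cons]
    refine S.idx_cases (q := fun j => (S.toU χ (UniversalEnvelopingAlgebra.ι K (S.bas j)) ⊗ₜ[K]
      (1 : A)) • (S.ordU χ N ⊗ₜ[K] (1 : A)) • m ∈
      M.wt (ξ + QuotientAddGroup.mk (S.wt j + S.wtM N)) (S.diff (μ + (S.wt j + S.wtM N))))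
      (fun α => ?_) (fun i => ?_) j
    · have := M.wt_root _ _ α _ ih
      rw [add_assoc, add_assoc, ← QuotientAddGroup.mk_add, add_comm (S.wtM N)] at this
      exact this
    · rw [wt_tor, zero_add]
      have := M.wt_torus _ _ (S.hb i) _ ih
      change (S.toU χ (UniversalEnvelopingAlgebra.ι K (S.bas (S.tor i))) ⊗ₜ[K] (1 : A)) • _ = _
        at this
      rw [this]
      exact M.wt_smul _ _ _ _ ih

/-- The pieces of `U_χ` act compatibly with the pieces of an object of `𝒞_A`. -/
theorem Uwt_smul_mem_wt {ξ σ : S.XI I} {μ : S.X} {w : Module.Dual K S.h} {m : M.carrier}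
    (hm : m ∈ M.wt ξ (S.diff μ)) {u : S.U χ} (hu : u ∈ S.Uwt χ I σ w) :
    (u ⊗ₜ[K] (1 : A)) • m ∈ M.wt (σ + ξ) (w + S.diff μ) := by
  classical
  have hgr : m ∈ M.gr ξ := by
    rw [← M.wt_iSup]
    exact AddSubgroup.mem_iSup_of_mem _ hm
  have h1 := M.gr_mul σ ξ u hu.1 m hgr
  rw [← M.wt_iSup] at h1
  obtain ⟨s, g, hg, hsum⟩ := exists_finset_sum_of_mem_iSup h1
  -- Choose x ∈ 𝔥 on which w' and w + dμ differ. It acts on the component g w' by the scalar of w'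
  -- and on the whole vector by that of w + dμ. Subtracting gives a relation between the components,
  -- which are independent.
  have key : ∀ w', w' ∈ s → w' ≠ w + S.diff μ → g w' = 0 := by
    intro w' hw' hne
    obtain ⟨x, hx⟩ : ∃ x, w' x ≠ (w + S.diff μ) x := by
      by_contra h
      push Not at h
      exact hne (LinearMap.ext h)
    let c : Module.Dual K S.h → K := fun w' => w' x - (w + S.diff μ) x
    have hact : ∀ w', (S.ofLie χ x ⊗ₜ[K] (1 : A)) • g w' =
        ((1 : S.U χ) ⊗ₜ[K] (π (UniversalEnvelopingAlgebra.ι K x) + algebraMap K A (w' x))) •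
          g w' := by
      intro w'
      -- The torus rule is available only for differentials of characters; outside `weightsOf` the
      -- component is zero.
      by_cases hw : w' ∈ S.weightsOf I (σ + ξ)
      · obtain ⟨ν, τ, -, rfl⟩ := hw
        rw [M.wt_torus _ ν x _ (hg _), map_add, AlgHom.commutes]
      · have := hg w'
        rw [M.wt_eq_bot _ _ hw, AddSubgroup.mem_bot] at this
        rw [this, smul_zero, smul_zero]
    have hy : (S.ofLie χ x ⊗ₜ[K] (1 : A)) • (u ⊗ₜ[K] (1 : A)) • m =
        ((1 : S.U χ) ⊗ₜ[K] (π (UniversalEnvelopingAlgebra.ι K x) +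
          algebraMap K A ((w + S.diff μ) x))) • (u ⊗ₜ[K] (1 : A)) • m := by
      have h2 : S.ofLie χ x * u = u * S.ofLie χ x + w x • u := by rw [← hu.2 x]; abel
      have h3 := M.wt_torus _ μ x _ hm
      rw [map_add, AlgHom.commutes] at h3
      rw [← mul_tmul_one_smul, h2, add_tmul_one_smul, mul_tmul_one_smul, h3, smul_smul, smul_smul,
        ← add_smul]
      congr 1
      simp only [LinearMap.add_apply, map_add, TensorProduct.tmul_add, TensorProduct.smul_tmul,
        Algebra.algebraMap_eq_smul_one, mul_add, add_mul, Algebra.TensorProduct.tmul_mul_tmul,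
        mul_one, one_mul]
      abel
    have hz : ∑ w' ∈ s, ((1 : S.U χ) ⊗ₜ[K] algebraMap K A (c w')) • g w' = 0 := by
      rw [hsum, Finset.smul_sum, Finset.smul_sum, ← sub_eq_zero, ← Finset.sum_sub_distrib] at hy
      rw [← hy]
      refine Finset.sum_congr rfl fun w' _ => ?_
      rw [hact, ← sub_smul, ← TensorProduct.tmul_sub, add_sub_add_left_eq_sub, ← map_sub]
    have hz' := eq_zero_of_sum_eq_zero (M.wt_indep (σ + ξ))
      (fun w' => M.wt_smul _ _ _ _ (hg w')) hz hw'
    -- The difference of the two scalars comes from the field K, so it is invertible in A.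
    have hc : c w' ≠ 0 := sub_ne_zero.2 hx
    have := congrArg (fun z => ((1 : S.U χ) ⊗ₜ[K] algebraMap K A (c w')⁻¹) • z) hz'
    simpa only [smul_smul, Algebra.TensorProduct.tmul_mul_tmul, one_mul, ← map_mul,
      inv_mul_cancel₀ hc, map_one, ← Algebra.TensorProduct.one_def, one_smul, smul_zero] using this
  rw [hsum]
  refine sum_mem fun w' hw' => ?_
  rcases eq_or_ne w' (w + S.diff μ) with rfl | hne
  · exact hg _
  · rw [key w' hw' hne]
    exact zero_mem _

end CA

end

section

open ReductiveGroup

namespace CA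

variable {K : Type u} [Field K] {p : ℕ} {S : ReductiveGroup K p} {χ : Module.Dual K S.g}
  {I : Set S.R} {A : Type v} [CommRing A] [Algebra K A] {π : S.U0 →ₐ[K] A}

/-! ### Cokernels and epimorphisms -/

section Cokernel

variable {M N : CA S χ I π} (f : M ⟶ N)

theorem map_wt (ξ : S.XI I) (w : Module.Dual K S.h) (m : M.carrier) (hm : m ∈ M.wt ξ w) :
    linearMap f m ∈ N.wt ξ w := Hom.map_wt f ξ w m hm

theorem map_gr (ξ : S.XI I) (m : M.carrier) (hm : m ∈ M.gr ξ) : linearMap f m ∈ N.gr ξ := by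
  rw [← M.wt_iSup] at hm
  have h : (⨆ w, M.wt ξ w) ≤ (N.gr ξ).comap (linearMap f).toAddMonoidHom := by
    refine iSup_le fun w x hx => ?_
    change linearMap f x ∈ N.gr ξ
    rw [← N.wt_iSup]
    exact AddSubgroup.mem_iSup_of_mem w (map_wt f ξ w x hx)
  exact h hm

theorem exists_gr_preimage {ξ : S.XI I} {m : M.carrier} (h : linearMap f m ∈ N.gr ξ) :
    ∃ m' ∈ M.gr ξ, linearMap f m' = linearMap f m :=
  exists_homogeneous_preimage N.gr_indep (linearMap f).toAddMonoidHom (H := M.gr) (map_gr f)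
    (by rw [M.gr_top]; exact AddSubgroup.mem_top m) h

/-- The weight pieces are independent only within one degree, so the preimage is projected first to
degree ξ and then to weight w. -/
theorem exists_wt_preimage {ξ : S.XI I} {w : Module.Dual K S.h} {m : M.carrier}
    (h : linearMap f m ∈ N.wt ξ w) : ∃ m' ∈ M.wt ξ w, linearMap f m' = linearMap f m := by
  have h1 : linearMap f m ∈ N.gr ξ := by
    rw [← N.wt_iSup]
    exact AddSubgroup.mem_iSup_of_mem w h
  obtain ⟨m₁, hm₁, h2⟩ := exists_gr_preimage f h1
  rw [← h2] at h ⊢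
  exact exists_homogeneous_preimage (N.wt_indep ξ) (linearMap f).toAddMonoidHom (H := M.wt ξ)
    (map_wt f ξ) (by rwa [M.wt_iSup]) h

/-- The quotient map from the target of a morphism to its cokernel. -/
abbrev cokerMap : N.carrier →ₗ[S.U χ ⊗[K] A] N.carrier ⧸ LinearMap.range (linearMap f) :=
  (LinearMap.range (linearMap f)).mkQ

theorem cokerMap_apply (m : M.carrier) : cokerMap f (linearMap f m) = 0 := by
  rw [Submodule.mkQ_apply, Submodule.Quotient.mk_eq_zero]
  exact ⟨m, rfl⟩

theorem exists_of_cokerMap_eq_zero {x : N.carrier} (h : cokerMap f x = 0) :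
    ∃ m, linearMap f m = x := by
  rw [Submodule.mkQ_apply, Submodule.Quotient.mk_eq_zero] at h
  exact h

/-- The cokernel of a morphism of `𝒞_A`. -/
def coker : CA S χ I π where
  carrier := N.carrier ⧸ LinearMap.range (linearMap f)
  gr ξ := (N.gr ξ).map (cokerMap f).toAddMonoidHom
  wt ξ w := (N.wt ξ w).map (cokerMap f).toAddMonoidHom
  gr_indep := by
    refine iSupIndep_map N.gr_indep _ (H := fun ξ => (M.gr ξ).map (linearMap f).toAddMonoidHom)
      ?_ ?_ ?_
    · rintro ξ _ ⟨m, hm, rfl⟩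
      exact map_gr f ξ m hm
    · rintro ξ _ ⟨m, -, rfl⟩
      exact cokerMap_apply f m
    · intro x _ hx
      obtain ⟨m, rfl⟩ := exists_of_cokerMap_eq_zero f hx
      rw [← AddSubgroup.map_iSup, M.gr_top]
      exact ⟨m, AddSubgroup.mem_top m, rfl⟩
  gr_top := by
    rw [← AddSubgroup.map_iSup, N.gr_top, ← AddMonoidHom.range_eq_map]
    exact AddMonoidHom.range_eq_top.2 (Submodule.mkQ_surjective _)
  gr_smul := by
    rintro ξ a _ ⟨m, hm, rfl⟩
    exact ⟨_, N.gr_smul ξ a m hm, (cokerMap f).map_smul _ _⟩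
  gr_finite := by
    refine N.gr_finite.subset fun ξ hξ h => hξ ?_
    rw [h, AddSubgroup.map_bot]
  gr_fg ξ := by
    classical
    obtain ⟨s, hs⟩ := N.gr_fg ξ
    refine ⟨s.image (cokerMap f), ?_⟩
    rw [hs, AddMonoidHom.map_closure]
    congr 1
    ext y
    constructor
    · rintro ⟨_, ⟨m, hm, a, rfl⟩, rfl⟩
      exact ⟨_, Finset.mem_image_of_mem _ hm, a, (cokerMap f).map_smul _ _⟩
    · rintro ⟨_, hy, a, rfl⟩
      obtain ⟨m, hm, rfl⟩ := Finset.mem_image.1 hy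
      exact ⟨_, ⟨m, hm, a, rfl⟩, (cokerMap f).map_smul _ _⟩
  gr_mul := by
    rintro σ ξ u hu _ ⟨m, hm, rfl⟩
    exact ⟨_, N.gr_mul σ ξ u hu m hm, (cokerMap f).map_smul _ _⟩
  wt_eq_bot ξ w hw := by rw [N.wt_eq_bot ξ w hw, AddSubgroup.map_bot]
  wt_indep ξ := by
    refine iSupIndep_map (N.wt_indep ξ) _
      (H := fun w => (M.wt ξ w).map (linearMap f).toAddMonoidHom) ?_ ?_ ?_
    · rintro w _ ⟨m, hm, rfl⟩
      exact map_wt f ξ w m hm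
    · rintro w _ ⟨m, -, rfl⟩
      exact cokerMap_apply f m
    · intro x hxg hx
      rw [N.wt_iSup] at hxg
      obtain ⟨m, rfl⟩ := exists_of_cokerMap_eq_zero f hx
      obtain ⟨m', hm', h⟩ := exists_gr_preimage f hxg
      rw [← AddSubgroup.map_iSup, M.wt_iSup, ← h]
      exact ⟨m', hm', rfl⟩
  wt_iSup ξ := by rw [← AddSubgroup.map_iSup, N.wt_iSup]
  wt_torus := by
    rintro ξ μ x _ ⟨m, hm, rfl⟩
    change _ • cokerMap f m = _ • cokerMap f m
    rw [← map_smul, ← map_smul, N.wt_torus ξ μ x m hm]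
  wt_root := by
    rintro ξ μ α _ ⟨m, hm, rfl⟩
    exact ⟨_, N.wt_root ξ μ α m hm, (cokerMap f).map_smul _ _⟩
  wt_smul := by
    rintro ξ w a _ ⟨m, hm, rfl⟩
    exact ⟨_, N.wt_smul ξ w a m hm, (cokerMap f).map_smul _ _⟩

/-- The projection to the cokernel and the zero map agree after composition with f. -/
theorem surjective_of_epi [CategoryTheory.Epi f] : Function.Surjective (linearMap f) := by
  let q : N ⟶ coker f := (⟨cokerMap f, fun ξ w m hm => ⟨m, hm, rfl⟩⟩ : Hom N (coker f))
  let z : N ⟶ coker f := (⟨0, fun ξ w m hm => zero_mem _⟩ : Hom N (coker f))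
  have h : q = z := by
    rw [← CategoryTheory.cancel_epi f]
    exact Hom.ext (LinearMap.ext fun m => cokerMap_apply f m)
  intro x
  have h2 := LinearMap.congr_fun (congrArg linearMap h) x
  exact exists_of_cokerMap_eq_zero f h2

end Cokernel

/-! ### The projective objects `⨁ U_χ ⊗_{U⁰} A^μ` -/

section Free

variable (π) (hχ : S.IsStandardLeviForm χ I) {k : ℕ} (lam : Fin k → S.X)

variable (χ) in
/-- The module `⨁ⱼ U_χ ⊗_{U⁰} A^{λⱼ}`. -/
abbrev FreeMod : Type (max u v) := ∀ j, S.QMod χ π (lam j)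

/-- The generators of `⨁ⱼ U_χ ⊗_{U⁰} A^{λⱼ}`. -/
def gen (j : Fin k) : FreeMod χ π lam := Pi.single j (S.qgen χ π (lam j))

theorem isTorusVector_gen (j : Fin k) : S.IsTorusVector χ π (lam j) (gen (χ := χ) π lam j) := by
  intro x
  rw [gen, ← Pi.single_smul, isTorusVector_qgen, ← Pi.single_smul]

variable [Fact p.Prime] [CharP K p]

/-- The basis of `⨁ⱼ U_χ ⊗_{U⁰} A^{λⱼ}` formed by the restricted monomials. -/
def freeBasis : Module.Basis (Σ _ : Fin k, S.R → Fin p) A (FreeMod χ π lam) :=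
  Pi.basis fun j => qbasis π hχ (lam j)

theorem freeBasis_apply (j : Fin k) (n : S.R → Fin p) :
    freeBasis π hχ lam ⟨j, n⟩ = (S.ordU χ (S.mset n) ⊗ₜ[K] (1 : A)) • gen π lam j := by
  rw [freeBasis, Pi.basis_apply, qbasis_apply]
  exact Pi.single_smul j _ _

/-- The weights of the basis vectors. -/
def freeWt (x : Σ _ : Fin k, S.R → Fin p) : S.X := lam x.1 + S.wtM (S.mset x.2)

/-- The object `⨁ⱼ U_χ ⊗_{U⁰} A^{λⱼ}` of `𝒞_A`. -/
def free : CA S χ I π :=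
  ofBasis (freeBasis π hχ lam) (freeWt lam)
    (fun ⟨j, n⟩ => by
      rw [freeBasis_apply]
      exact (isTorusVector_gen π lam j).ordU_smul (S.mset n))
    (fun ⟨j, n⟩ α => by
      rw [freeBasis_apply]
      refine Submodule.span_mono ?_
        (e_smul_ordU_smul_mem I hχ (isTorusVector_gen π lam j) α (S.mset n))
      rintro _ ⟨n', hn', rfl⟩
      refine ⟨⟨j, n'⟩, ⟨?_, ?_⟩, freeBasis_apply π hχ lam j n'⟩
      · simp only [freeWt, QuotientAddGroup.mk_add]
        rw [hn'.1, QuotientAddGroup.mk_add, add_assoc, add_comm (QuotientAddGroup.mk α.1)]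
      · simp only [freeWt, diff_add]
        rw [hn'.2, diff_add, add_assoc, add_comm (S.diff α.1)])

theorem gen_mem_wt (j : Fin k) :
    gen π lam j ∈ (free π hχ lam).wt (QuotientAddGroup.mk (lam j)) (S.diff (lam j)) := by
  -- The generator is the basis vector with all exponents zero.
  have h0 : S.mset (fun _ => ⟨0, (Fact.out : p.Prime).pos⟩) = 0 := by simp [mset]
  have h1 : gen π lam j ∈ freeBasis π hχ lam ''
      wtIdx I (freeWt lam) (QuotientAddGroup.mk (lam j)) (S.diff (lam j)) := by
    refine ⟨⟨j, fun _ => ⟨0, (Fact.out : p.Prime).pos⟩⟩, ⟨?_, ?_⟩, ?_⟩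
    · simp only [freeWt, h0, wtM_zero, add_zero]
    · simp only [freeWt, h0, wtM_zero, add_zero]
    · rw [freeBasis_apply, h0, ordU, PBW.ordMonomial_zero, map_one,
        ← Algebra.TensorProduct.one_def, one_smul]
  have h2 : gen π lam j ∈ Submodule.span A (freeBasis π hχ lam ''
      wtIdx I (freeWt lam) (QuotientAddGroup.mk (lam j)) (S.diff (lam j))) :=
    Submodule.subset_span h1
  exact h2

variable {π}

/-- The universal property of `⨁ⱼ U_χ ⊗_{U⁰} A^{λⱼ}`. -/
theorem exists_freeHom (M : CA S χ I π) (m : Fin k → M.carrier)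
    (hm : ∀ j, m j ∈ M.wt (QuotientAddGroup.mk (lam j)) (S.diff (lam j))) :
    ∃ f : free π hχ lam ⟶ M, ∀ j, linearMap f (gen π lam j) = m j := by
  have hle : ∀ j, S.torRel χ π (lam j) ≤ LinearMap.ker (LinearMap.toSpanSingleton _ _ (m j)) := by
    intro j
    refine Submodule.span_le.2 ?_
    rintro _ ⟨x, rfl⟩
    rw [SetLike.mem_coe, LinearMap.mem_ker, LinearMap.toSpanSingleton_apply, sub_smul, sub_eq_zero]
    exact M.wt_torus' (hm j) x
  let F : FreeMod χ π lam →ₗ[S.U χ ⊗[K] A] M.carrier :=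
    ∑ j, (S.torRel χ π (lam j)).liftQ (LinearMap.toSpanSingleton _ _ (m j)) (hle j) ∘ₗ
      LinearMap.proj j
  have hF : ∀ j, F (gen π lam j) = m j := by
    intro j
    simp only [F, LinearMap.sum_apply, LinearMap.comp_apply, LinearMap.proj_apply, gen]
    rw [Finset.sum_eq_single_of_mem j (Finset.mem_univ j)]
    · rw [Pi.single_eq_same, qgen, Submodule.mkQ_apply, Submodule.liftQ_apply,
        LinearMap.toSpanSingleton_apply, one_smul]
    · intro i _ hi
      rw [Pi.single_eq_of_ne hi, map_zero]
  have hwt : ∀ ξ w (x : FreeMod χ π lam),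
      x ∈ Submodule.span A (freeBasis π hχ lam '' wtIdx I (freeWt lam) ξ w) → F x ∈ M.wt ξ w := by
    intro ξ w x hx
    induction hx using Submodule.span_induction with
    | zero => rw [map_zero]; exact zero_mem _
    | add x y _ _ hx hy => rw [map_add]; exact add_mem hx hy
    | smul a x _ hx =>
      have h := M.wt_smul ξ w a _ hx
      have e : ((1 : S.U χ) ⊗ₜ[K] a) • x = a • x :=
        one_tmul_smul (S := S) (χ := χ) a x
      rwa [← map_smul, e] at h
    | mem x hx =>
      obtain ⟨⟨j, n⟩, ⟨rfl, rfl⟩, rfl⟩ := hx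
      rw [freeBasis_apply, map_smul, hF]
      exact M.ordU_smul_mem_wt (hm j) (S.mset n)
  exact ⟨(⟨F, hwt⟩ : Hom (free π hχ lam) M), hF⟩

theorem freeHom_ext {M : CA S χ I π} {f g : free π hχ lam ⟶ M}
    (h : ∀ j, linearMap f (gen π lam j) = linearMap g (gen π lam j)) : f = g := by
  refine Hom.ext (LinearMap.pi_ext' fun j => ?_)
  apply Submodule.linearMap_qext
  refine LinearMap.ext_ring ?_
  exact h j

/-- To lift a morphism it suffices to lift the images of the generators inside their pieces, which
is possible because an epimorphism is surjective on every piece. -/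
theorem projective_free : CategoryTheory.Projective (free π hχ lam) where
  factors {E X} f e _ := by
    have hs := surjective_of_epi e
    have h1 : ∀ j, ∃ m ∈ E.wt (QuotientAddGroup.mk (lam j)) (S.diff (lam j)),
        linearMap e m = linearMap f (gen π lam j) := by
      intro j
      obtain ⟨m, hm⟩ := hs (linearMap f (gen π lam j))
      have h2 := map_wt f _ _ _ (gen_mem_wt π hχ lam j)
      rw [← hm] at h2 ⊢
      exact exists_wt_preimage e h2
    choose m hm hm' using h1
    obtain ⟨f', hf'⟩ := exists_freeHom hχ lam E m hm
    refine ⟨f', freeHom_ext hχ lam fun j => ?_⟩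
    rw [← hm' j, ← hf' j]
    rfl

end Free

/-! ### Generation by weight vectors -/

section Generators

variable [CharP K p] (M : CA S χ I π)

/-- Weights in degree λ + ℤI come from μ ∈ λ + ℤI + pX. Removing the summand in pX puts μ into the
coset itself without changing dμ, so one character records both degree and weight. -/
theorem mem_wt_diff {ξ : S.XI I} {w : Module.Dual K S.h} {m : M.carrier} (hm : m ∈ M.wt ξ w)
    (h0 : m ≠ 0) : ∃ μ : S.X, ξ = QuotientAddGroup.mk μ ∧ w = S.diff μ := by
  by_cases hw : w ∈ S.weightsOf I ξ
  · obtain ⟨μ, τ, h1, h2⟩ := hw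
    exact ⟨μ - p • τ, h1.symm, by rw [h2, diff_sub, diff_p_smul, sub_zero]⟩
  · rw [M.wt_eq_bot ξ w hw] at hm
    exact absurd hm h0

/-- M is finitely generated already over A and spanned over A by weight vectors, so finitely many
weight vectors span it. -/
theorem exists_generators : ∃ (k : ℕ) (lam : Fin k → S.X) (m : Fin k → M.carrier),
    (∀ j, m j ∈ M.wt (QuotientAddGroup.mk (lam j)) (S.diff (lam j))) ∧
      Submodule.span (S.U χ ⊗[K] A) (Set.range m) = ⊤ := by
  let _ : Module A M.carrier := Module.compHom M.carrier (algebraMap A (S.U χ ⊗[K] A))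
  have : IsScalarTower A (S.U χ ⊗[K] A) M.carrier := ⟨fun a x m => by
    rw [Algebra.smul_def, mul_smul]
    rfl⟩
  let T : Set M.carrier := {m | ∃ μ : S.X, m ∈ M.wt (QuotientAddGroup.mk μ) (S.diff μ)}
  have hT : Submodule.span A T = ⊤ := by
    rw [← Submodule.toAddSubgroup_eq_top, eq_top_iff, ← M.gr_top]
    refine iSup_le fun ξ => ?_
    rw [← M.wt_iSup]
    refine iSup_le fun w m hm => ?_
    by_cases h0 : m = 0
    · rw [h0]; exact zero_mem _
    · obtain ⟨μ, rfl, rfl⟩ := M.mem_wt_diff hm h0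
      exact Submodule.subset_span ⟨μ, hm⟩
  have hfg : (⊤ : Submodule A M.carrier).FG := by
    classical
    choose s hs using M.gr_fg
    refine ⟨M.gr_finite.toFinset.biUnion s, ?_⟩
    rw [← Submodule.toAddSubgroup_eq_top, eq_top_iff, ← M.gr_top]
    refine iSup_le fun ξ => ?_
    by_cases h0 : M.gr ξ = ⊥
    · rw [h0]; exact bot_le
    · rw [hs ξ, AddSubgroup.closure_le]
      rintro _ ⟨m, hm, a, rfl⟩
      rw [one_tmul_smul]
      refine Submodule.smul_mem _ _ (Submodule.subset_span ?_)
      rw [Finset.coe_biUnion]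
      exact Set.mem_iUnion₂.2 ⟨ξ, by simpa using h0, hm⟩
  rw [← hT, Submodule.fg_span_iff_fg_span_finset_subset] at hfg
  obtain ⟨s, hsT, hs⟩ := hfg
  choose μ hμ using fun m : s => hsT m.2
  refine ⟨s.card, fun j => μ (s.equivFin.symm j), fun j => (s.equivFin.symm j : M.carrier),
    fun j => hμ _, ?_⟩
  rw [eq_top_iff]
  intro x _
  have hx : x ∈ Submodule.span A (s : Set M.carrier) := by rw [← hs, hT]; trivial
  refine Submodule.span_le_restrictScalars A (S.U χ ⊗[K] A) _ (Submodule.span_mono ?_ hx)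
  intro m hm
  exact ⟨s.equivFin ⟨m, hm⟩, by simp⟩

end Generators

end CA

end

section

namespace ReductiveGroup

variable {K : Type u} [Field K] {p : ℕ} (S : ReductiveGroup K p)

/-! ### Monomials in positive and in negative root vectors -/

/-- Exponents on the positive roots. -/
abbrev PosExp : Type u := {α : S.R // S.IsPos α} → Fin p

/-- Exponents on the negative roots. -/
abbrev NegExp : Type u := {α : S.R // ¬ S.IsPos α} → Fin p

instance : Fintype {α : S.R // S.IsPos α} := Fintype.ofFinite _

instance : Fintype {α : S.R // ¬ S.IsPos α} := Fintype.ofFinite _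

instance : Finite S.PosExp := Pi.finite

instance : Fintype S.NegExp := Fintype.ofFinite _

/-- The monomial in the positive root vectors with exponents `b`. -/
def posM (b : S.PosExp) : Multiset S.Idx := ∑ α, Multiset.replicate (b α) (S.rt α.1)

/-- The monomial in the negative root vectors with exponents `a`. -/
def negM (a : S.NegExp) : Multiset S.Idx := ∑ α, Multiset.replicate (a α) (S.rt α.1)

variable {S}

theorem mem_posM {b : S.PosExp} {i : S.Idx} (h : i ∈ S.posM b) : ∃ α, S.IsPos α ∧ i = S.rt α := by
  rw [posM, Multiset.mem_sum] at h
  obtain ⟨α, -, h⟩ := h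
  exact ⟨α.1, α.2, Multiset.eq_of_mem_replicate h⟩

theorem mem_negM {a : S.NegExp} {i : S.Idx} (h : i ∈ S.negM a) :
    ∃ α, ¬ S.IsPos α ∧ i = S.rt α := by
  rw [negM, Multiset.mem_sum] at h
  obtain ⟨α, -, h⟩ := h
  exact ⟨α.1, α.2, Multiset.eq_of_mem_replicate h⟩

theorem mset_eq_negM_add_posM (n : S.R → Fin p) :
    S.mset n = S.negM (fun α => n α.1) + S.posM (fun α => n α.1) := by
  classical
  rw [mset, negM, posM, add_comm]
  convert (Fintype.sum_subtype_add_sum_subtype (fun α => S.IsPos α)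
    fun α => Multiset.replicate (n α) (S.rt α)).symm

variable {χ : Module.Dual K S.g} {I : Set S.R}

theorem ordU_negM_add_posM (a : S.NegExp) (b : S.PosExp) :
    S.ordU χ (S.negM a + S.posM b) = S.ordU χ (S.negM a) * S.ordU χ (S.posM b) := by
  rw [ordU, PBW.ordMonomial_add, map_mul, ordU, ordU]
  intro i hi j hj
  obtain ⟨α, hα, rfl⟩ := mem_negM hi
  obtain ⟨β, hβ, rfl⟩ := mem_posM hj
  refine (S.lt_of_cls_lt ?_).le
  rw [S.cls_rt_neg hα, S.cls_rt_pos hβ]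
  exact zero_lt_one

variable (S) in
/-- The height of a root, and `0` for the elements of the torus. -/
def hgt : S.Idx → ℤ := Sum.elim S.base.height fun _ => 0

/-- Ordered monomials are homogeneous. -/
theorem ordU_mem_Uwt (M : Multiset S.Idx) :
    S.ordU χ M ∈ S.Uwt χ I (QuotientAddGroup.mk (S.wtM M)) (S.diff (S.wtM M)) := by
  refine ⟨Submodule.subset_span ?_, fun x => by rw [torus_mul_ordU, add_sub_cancel_left]⟩
  induction M using PBW.sorted_induction with
  | h0 =>
    rw [ordU, PBW.ordMonomial_zero, map_one, wtM_zero]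
    exact IsMonomial.one
  | h1 j N hj ih =>
    rw [ordU, PBW.ordMonomial_cons S.bas hj, map_mul, wtM_cons]
    refine S.idx_cases (q := fun j => S.IsMonomial χ I (QuotientAddGroup.mk (S.wt j + S.wtM N))
      (S.toU χ (UniversalEnvelopingAlgebra.ι K (S.bas j)) * S.ordU χ N)) (fun α => ?_)
      (fun i => ?_) j
    · exact IsMonomial.root α ih
    · rw [wt_tor, zero_add]
      exact IsMonomial.torus (S.hb i) ih

theorem exists_eq_posM [Fact p.Prime] {M : Multiset S.Idx} (hM : ∀ i ∈ M, ∃ α, S.IsPos α ∧ i = S.rt α)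
    (h : ∀ α, M.count (S.rt α) < p) : ∃ b, M = S.posM b := by
  have h1 : ∀ i, S.tor i ∉ M := fun i hi => by
    obtain ⟨α, -, h⟩ := hM _ hi
    exact S.rt_ne_tor α i h.symm
  refine ⟨fun α => S.res M α.1, ?_⟩
  conv_lhs => rw [S.eq_mset h1 h, mset_eq_negM_add_posM]
  rw [add_eq_right, negM]
  refine Finset.sum_eq_zero fun α _ => ?_
  have h2 : S.rt α.1 ∉ M := fun h2 => by
    obtain ⟨β, hβ, h⟩ := hM _ h2
    exact α.2 (S.rt_injective h ▸ hβ)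
  simp only [res, Multiset.count_eq_zero_of_notMem h2, Nat.zero_mod, Multiset.replicate_zero]

/-- χ vanishes on positive root vectors, so e_α^p = 0 in U_χ for positive α. -/
theorem ordU_eq_zero_of_le_count [Fact p.Prime] [CharP K p] (hχ : S.IsStandardLeviForm χ I) {M : Multiset S.Idx} {α : S.R}
    (hα : S.IsPos α) (h : p ≤ M.count (S.rt α)) : S.ordU χ M = 0 := by
  obtain ⟨N, rfl⟩ : ∃ N, M = N + Multiset.replicate p (S.rt α) := by
    rw [Multiset.le_count_iff_replicate_le] at h
    exact ⟨M - _, (Multiset.sub_add_cancel h).symm⟩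
  rw [ordU, ordMonomial_add_p, map_mul, toU_e_pow, chi_of_isPos hχ hα,
    zero_pow (Fact.out : p.Prime).ne_zero, map_zero, mul_zero]

/-- Multiplication by a positive root vector raises the height of monomials in the positive root
vectors. -/
theorem e_mul_ordU_posM_mem [Fact p.Prime] [CharP K p] (hχ : S.IsStandardLeviForm χ I) {α : S.R} (hα : S.IsPos α)
    (b : S.PosExp) :
    S.ofLie χ (S.e α) * S.ordU χ (S.posM b) ∈ Submodule.span K
      ((fun b' => S.ordU χ (S.posM b')) ''
        {b' | ((S.posM b).map S.hgt).sum < ((S.posM b').map S.hgt).sum}) := by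
  have h := PBW.ι_mul_ordMonomial_mem S.bas (P := {i | ∃ γ, S.IsPos γ ∧ i = S.rt γ}) (wt := S.hgt)
    (by
      rintro _ ⟨β, hβ, rfl⟩ _ ⟨γ, hγ, rfl⟩ k hk
      obtain ⟨δ, rfl, hδ, hh⟩ := S.pos_of_repr_lie_ne_zero hβ hγ hk
      exact ⟨⟨δ, hδ, rfl⟩, hh⟩) (i := S.rt α) ⟨α, hα, rfl⟩
      (γ := ((S.posM b).map S.hgt).sum) (M := S.posM b) ⟨fun i hi => mem_posM hi, rfl⟩
  have h2 := Submodule.mem_map_of_mem (f := (S.toU χ).toLinearMap) h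
  rw [Submodule.map_span, AlgHom.toLinearMap_apply, map_mul] at h2
  refine Submodule.span_le.2 ?_ h2
  rintro _ ⟨_, ⟨N, hN, rfl⟩, rfl⟩
  change S.ordU χ N ∈ _
  -- A straightened monomial is either restricted, of height larger by the height of α, or contains
  -- a p-th power and is zero.
  by_cases hc : ∀ γ, N.count (S.rt γ) < p
  · obtain ⟨b', rfl⟩ := exists_eq_posM hN.1 hc
    refine Submodule.subset_span ⟨b', ?_, rfl⟩
    have h3 := S.height_pos hα
    have h4 := hN.2
    change _ = S.base.height α + _ at h4
    rw [Set.mem_ofPred_eq, h4]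
    exact lt_add_of_pos_left _ h3
  · push Not at hc
    obtain ⟨γ, hγ⟩ := hc
    have h3 : S.rt γ ∈ N := Multiset.count_pos.1 ((Fact.out : p.Prime).pos.trans_le hγ)
    obtain ⟨δ, hδ, h4⟩ := hN.1 _ h3
    rw [ordU_eq_zero_of_le_count hχ (S.rt_injective h4 ▸ hδ) hγ]
    exact zero_mem _

/-! ### Highest weight vectors -/

section HighestWeight

variable {A : Type v} [CommRing A] [Algebra K A] {π : S.U0 →ₐ[K] A}

variable (χ) in
/-- The element of `U_χ ⊗ A` with coordinates `c` at the monomials in the negative root vectors. -/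
def negSum (c : S.NegExp → A) : S.U χ ⊗[K] A := ∑ a, S.ordU χ (S.negM a) ⊗ₜ[K] c a

variable {V : Type*} [AddCommGroup V] [Module (S.U χ ⊗[K] A) V]

theorem tmul_smul_eq (u : S.U χ) (a : A) (v : V) :
    (u ⊗ₜ[K] a) • v = ((1 : S.U χ) ⊗ₜ[K] a) • (u ⊗ₜ[K] (1 : A)) • v := by
  rw [smul_smul, Algebra.TensorProduct.tmul_mul_tmul, one_mul, mul_one]

theorem ordU_smul_eq_zero {v : V}
    (hv : ∀ α, S.IsPos α → (S.ofLie χ (S.e α) ⊗ₜ[K] (1 : A)) • v = 0) {M : Multiset S.Idx}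
    (hM : ∀ i ∈ M, ∃ α, S.IsPos α ∧ i = S.rt α) (h0 : M ≠ 0) :
    (S.ordU χ M ⊗ₜ[K] (1 : A)) • v = 0 := by
  induction M using PBW.sorted_induction with
  | h0 => exact absurd rfl h0
  | h1 j N hj ih =>
    rw [ordU, PBW.ordMonomial_cons S.bas hj, map_mul, mul_tmul_one_smul]
    by_cases hN : N = 0
    · obtain ⟨α, hα, rfl⟩ := hM j (Multiset.mem_cons_self _ _)
      rw [hN, PBW.ordMonomial_zero, map_one, ← Algebra.TensorProduct.one_def, one_smul]
      exact hv α hα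
    · have := ih (fun i hi => hM i (Multiset.mem_cons_of_mem hi)) hN
      rw [ordU] at this
      rw [this, smul_zero]

/-- The module generated by a highest weight vector is spanned over `A` by the monomials in the
negative root vectors. -/
theorem exists_smul_eq_negSum_smul [Fact p.Prime] [CharP K p] (hχ : S.IsStandardLeviForm χ I) {μ : S.X} {v : V}
    (hv : S.IsTorusVector χ π μ v)
    (hv' : ∀ α, S.IsPos α → (S.ofLie χ (S.e α) ⊗ₜ[K] (1 : A)) • v = 0) (x : S.U χ ⊗[K] A) :
    ∃ c : S.NegExp → A, x • v = S.negSum χ c • v := by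
  let _ : Module A V := Module.compHom V (algebraMap A (S.U χ ⊗[K] A))
  have : IsScalarTower A (S.U χ ⊗[K] A) V := ⟨fun a x m => by
    rw [Algebra.smul_def, mul_smul]
    rfl⟩
  suffices h : x • v ∈ Submodule.span A
      (Set.range fun a : S.NegExp => (S.ordU χ (S.negM a) ⊗ₜ[K] (1 : A)) • v) by
    obtain ⟨c, hc⟩ := (Submodule.mem_span_range_iff_exists_fun A).1 h
    refine ⟨c, ?_⟩
    rw [← hc, negSum, Finset.sum_smul]
    refine Finset.sum_congr rfl fun a _ => ?_
    rw [tmul_smul_eq _ (c a), one_tmul_smul]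
  refine Submodule.span_le.2 ?_ (smul_mem_span_ordU_smul I hχ hv x)
  rintro _ ⟨n, rfl⟩
  beta_reduce
  rw [mset_eq_negM_add_posM, ordU_negM_add_posM, mul_tmul_one_smul]
  by_cases h0 : S.posM (fun α => n α.1) = 0
  · rw [h0, ordU, ordU, PBW.ordMonomial_zero, map_one, ← Algebra.TensorProduct.one_def, one_smul]
    exact Submodule.subset_span ⟨_, rfl⟩
  · rw [ordU_smul_eq_zero hv' (fun i hi => mem_posM hi) h0, smul_zero]
    exact zero_mem _

end HighestWeight

end ReductiveGroup

end

section

open ReductiveGroup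

variable {K : Type u} [Field K] {p : ℕ} {S : ReductiveGroup K p} {χ : Module.Dual K S.g}
  {I : Set S.R} {A : Type v} [CommRing A] [Algebra K A] {π : S.U0 →ₐ[K] A}

/-! ### Baby Verma modules -/

section BabyVerma

variable (χ π) in
/-- The generator of a baby Verma module. -/
def bvGen (μ : S.X) : BabyVerma S χ π μ := (babyVermaRel S χ π μ).mkQ 1

theorem smul_bvGen (μ : S.X) (x : S.U χ ⊗[K] A) :
    x • bvGen χ π μ = (babyVermaRel S χ π μ).mkQ x := by
  rw [bvGen, ← map_smul, smul_eq_mul, mul_one]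

theorem isTorusVector_bvGen (μ : S.X) : S.IsTorusVector χ π μ (bvGen χ π μ) := by
  intro x
  rw [← sub_eq_zero, ← sub_smul, smul_bvGen, Submodule.mkQ_apply, Submodule.Quotient.mk_eq_zero]
  exact Submodule.subset_span (Or.inr ⟨x, rfl⟩)

theorem e_smul_bvGen (μ : S.X) {α : S.R} (hα : S.IsPos α) :
    (S.ofLie χ (S.e α) ⊗ₜ[K] (1 : A)) • bvGen χ π μ = 0 := by
  rw [smul_bvGen, Submodule.mkQ_apply, Submodule.Quotient.mk_eq_zero]
  exact Submodule.subset_span (Or.inl ⟨α, hα, rfl⟩)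

theorem exists_eq_negSum_smul_bvGen [Fact p.Prime] [CharP K p] (hχ : S.IsStandardLeviForm χ I)
    (μ : S.X) (z : BabyVerma S χ π μ) : ∃ c : S.NegExp → A, z = S.negSum χ c • bvGen χ π μ := by
  obtain ⟨x, rfl⟩ := (babyVermaRel S χ π μ).mkQ_surjective z
  rw [← smul_bvGen]
  exact exists_smul_eq_negSum_smul hχ (isTorusVector_bvGen μ) (fun α hα => e_smul_bvGen μ hα) x

/-- The universal property of baby Verma modules. -/
theorem exists_bvHom {V : Type*} [AddCommGroup V] [Module (S.U χ ⊗[K] A) V] {μ : S.X} {v : V}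
    (hv : S.IsTorusVector χ π μ v)
    (hv' : ∀ α, S.IsPos α → (S.ofLie χ (S.e α) ⊗ₜ[K] (1 : A)) • v = 0) :
    ∃ f : BabyVerma S χ π μ →ₗ[S.U χ ⊗[K] A] V, f (bvGen χ π μ) = v := by
  have hle : babyVermaRel S χ π μ ≤ LinearMap.ker (LinearMap.toSpanSingleton _ _ v) := by
    refine Submodule.span_le.2 ?_
    rintro _ (⟨α, hα, rfl⟩ | ⟨x, rfl⟩)
    · rw [SetLike.mem_coe, LinearMap.mem_ker, LinearMap.toSpanSingleton_apply, hv' α hα]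
    · rw [SetLike.mem_coe, LinearMap.mem_ker, LinearMap.toSpanSingleton_apply, sub_smul,
        sub_eq_zero]
      exact hv x
  refine ⟨(babyVermaRel S χ π μ).liftQ (LinearMap.toSpanSingleton _ _ v) hle, ?_⟩
  rw [bvGen, Submodule.mkQ_apply, Submodule.liftQ_apply, LinearMap.toSpanSingleton_apply, one_smul]

end BabyVerma

/-! ### Construction of `Z`-filtrations -/

section Filtration

variable (Q : CA S χ I π) [Module A Q.carrier]

/-- A family of weight vectors in an object of `𝒞_A`, ordered in such a way that the positive root
vectors send each to the span of the earlier ones, and such that the products with the monomials in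
the negative root vectors form a basis over `A`. -/
structure ZBasis (r : ℕ) where
  v : Fin r → Q.carrier
  μ : Fin r → S.X
  basis : Module.Basis (Fin r × S.NegExp) A Q.carrier
  basis_apply : ∀ i a, basis (i, a) = (S.ordU χ (S.negM a) ⊗ₜ[K] (1 : A)) • v i
  v_mem : ∀ i, v i ∈ Q.wt (QuotientAddGroup.mk (μ i)) (S.diff (μ i))
  e_smul : ∀ i α, S.IsPos α →
    (S.ofLie χ (S.e α) ⊗ₜ[K] (1 : A)) • v i ∈ Submodule.span A (v '' {l | l < i})
  mem_wt : ∀ ξ w y, y ∈ Q.wt ξ w → ∀ i a, basis.repr y (i, a) ≠ 0 →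
    QuotientAddGroup.mk (μ i + S.wtM (S.negM a)) = ξ ∧ S.diff (μ i + S.wtM (S.negM a)) = w

namespace ZBasis

variable {Q} {r : ℕ} (Z : ZBasis Q r)

/-- The submodule generated by the first `i` vectors. -/
def fil (i : ℕ) : Submodule (S.U χ ⊗[K] A) Q.carrier :=
  Submodule.span _ (Z.v '' {l | (l : ℕ) < i})

theorem fil_mono {i j : ℕ} (h : i ≤ j) : Z.fil i ≤ Z.fil j :=
  Submodule.span_mono (Set.image_mono fun _ hl => lt_of_lt_of_le hl h)

theorem fil_succ (i : Fin r) :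
    Z.fil (i + 1) = Submodule.span (S.U χ ⊗[K] A) {Z.v i} ⊔ Z.fil i := by
  rw [fil, fil, ← Submodule.span_union, ← Set.image_singleton, ← Set.image_union]
  congr 2
  ext l
  simp only [Set.mem_ofPred_eq, Set.mem_union, Set.mem_singleton_iff, Fin.ext_iff]
  omega

theorem basis_mem_wt (i : Fin r) (a : S.NegExp) :
    Z.basis (i, a) ∈ Q.wt (QuotientAddGroup.mk (Z.μ i + S.wtM (S.negM a)))
      (S.diff (Z.μ i + S.wtM (S.negM a))) := by
  rw [basis_apply, QuotientAddGroup.mk_add]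
  exact Q.ordU_smul_mem_wt (Z.v_mem i) _

variable [IsScalarTower A (S.U χ ⊗[K] A) Q.carrier]

theorem e_smul_mem_fil (i : Fin r) {α : S.R} (hα : S.IsPos α) :
    (S.ofLie χ (S.e α) ⊗ₜ[K] (1 : A)) • Z.v i ∈ Z.fil i :=
  Submodule.span_le_restrictScalars A (S.U χ ⊗[K] A) _ (Z.e_smul i α hα)

theorem negSum_smul (c : S.NegExp → A) (i : Fin r) :
    S.negSum χ c • Z.v i = ∑ a, c a • Z.basis (i, a) := by
  rw [negSum, Finset.sum_smul]
  refine Finset.sum_congr rfl fun a _ => ?_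
  rw [tmul_smul_eq _ (c a), one_tmul_smul, basis_apply]

open Classical in
theorem repr_negSum_smul (c : S.NegExp → A) (i l : Fin r) (a : S.NegExp) :
    Z.basis.repr (S.negSum χ c • Z.v i) (l, a) = if i = l then c a else 0 := by
  rw [negSum_smul, map_sum, Finsupp.finsetSum_apply]
  simp only [map_smul, Module.Basis.repr_self, Finsupp.smul_apply, Finsupp.single_apply,
    Prod.mk.injEq, smul_eq_mul, mul_ite, mul_one, mul_zero]
  by_cases h : i = l
  · simp [h]
  · simp [h]

variable [Fact p.Prime] [CharP K p]

/-- Modulo the submodule generated by the earlier vectors, the i-th one is a highest weight vector,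
so the negative monomials suffice. -/
theorem exists_smul_v (hχ : S.IsStandardLeviForm χ I) (i : Fin r) (x : S.U χ ⊗[K] A) :
    ∃ c : S.NegExp → A, x • Z.v i - S.negSum χ c • Z.v i ∈ Z.fil i := by
  have hv := Q.wt_torus' (Z.v_mem i)
  obtain ⟨c, hc⟩ := exists_smul_eq_negSum_smul hχ (π := π) (μ := Z.μ i)
    (v := (Z.fil i).mkQ (Z.v i)) (fun y => by rw [← map_smul, hv y, map_smul])
    (fun α hα => by
      rw [← map_smul, Submodule.mkQ_apply, Submodule.Quotient.mk_eq_zero]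
      exact Z.e_smul_mem_fil i hα) x
  refine ⟨c, ?_⟩
  rwa [← map_smul, ← map_smul, ← sub_eq_zero, ← map_sub, Submodule.mkQ_apply,
    Submodule.Quotient.mk_eq_zero] at hc

/-- Each step of the filtration is spanned over A by part of the given basis, so membership can be
read off from coordinates. -/
theorem mem_fil (hχ : S.IsStandardLeviForm χ I) (i : ℕ) (hi : i ≤ r) (y : Q.carrier) :
    y ∈ Z.fil i ↔ y ∈ Submodule.span A (Z.basis '' {x | (x.1 : ℕ) < i}) := by
  constructor
  · induction i generalizing y with
    | zero =>
      intro h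
      simp only [fil, Nat.not_lt_zero, Set.ofPred_false, Set.image_empty, Submodule.span_empty,
        Submodule.mem_bot] at h
      rw [h]
      exact zero_mem _
    | succ i ih =>
      intro h
      have h1 := Z.fil_succ ⟨i, hi⟩
      dsimp only at h1
      rw [h1, Submodule.mem_sup] at h
      obtain ⟨y₁, hy₁, y₂, hy₂, rfl⟩ := h
      obtain ⟨x, rfl⟩ := Submodule.mem_span_singleton.1 hy₁
      obtain ⟨c, hc⟩ := Z.exists_smul_v hχ ⟨i, hi⟩ x
      rw [← sub_add_cancel (x • _) (S.negSum χ c • Z.v ⟨i, hi⟩)]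
      have h2 : ∀ y ∈ Z.fil i, y ∈ Submodule.span A (Z.basis '' {x | (x.1 : ℕ) < i + 1}) :=
        fun y hy => Submodule.span_mono
          (Set.image_mono fun _ hl => Nat.lt_succ_of_lt hl) (ih (by omega) y hy)
      refine add_mem (add_mem (h2 _ hc) ?_) (h2 _ hy₂)
      rw [negSum_smul]
      refine sum_mem fun a _ => Submodule.smul_mem _ _ (Submodule.subset_span ⟨_, ?_, rfl⟩)
      exact Nat.lt_succ_self i
  · intro h
    have h1 : Submodule.span A (Z.basis '' {x | (x.1 : ℕ) < i}) ≤ (Z.fil i).restrictScalars A := by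
      refine Submodule.span_le.2 ?_
      rintro _ ⟨⟨l, a⟩, hl, rfl⟩
      rw [basis_apply]
      exact Submodule.smul_mem (Z.fil i) _ (Submodule.subset_span ⟨l, hl, rfl⟩)
    exact h1 h

theorem repr_eq_zero (hχ : S.IsStandardLeviForm χ I) {i : ℕ} (hi : i ≤ r) {y : Q.carrier}
    (hy : y ∈ Z.fil i) {l : Fin r} (hl : i ≤ l) (a : S.NegExp) : Z.basis.repr y (l, a) = 0 := by
  rw [Z.mem_fil hχ i hi, Module.Basis.mem_span_image] at hy
  by_contra h
  exact absurd (hy (Finsupp.mem_support_iff.2 h)) (not_lt.2 hl)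

/-- The basis vectors that span a step are themselves weight vectors. -/
theorem fil_eq_iSup (hχ : S.IsStandardLeviForm χ I) (i : ℕ) (hi : i ≤ r) :
    (Z.fil i).toAddSubgroup = ⨆ ξ, ⨆ w, (Z.fil i).toAddSubgroup ⊓ Q.wt ξ w := by
  refine le_antisymm (fun y hy => ?_) (iSup₂_le fun _ _ => inf_le_left)
  have hy' := hy
  rw [Submodule.mem_toAddSubgroup, Z.mem_fil hχ i hi, Module.Basis.mem_span_image] at hy'
  rw [← Z.basis.sum_repr y]
  refine sum_mem fun ⟨l, a⟩ _ => ?_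
  by_cases h : Z.basis.repr y (l, a) = 0
  · rw [h, zero_smul]
    exact zero_mem _
  have hl : (l : ℕ) < i := hy' (Finsupp.mem_support_iff.2 h)
  refine AddSubgroup.mem_iSup_of_mem (QuotientAddGroup.mk (Z.μ l + S.wtM (S.negM a)))
    (AddSubgroup.mem_iSup_of_mem (S.diff (Z.μ l + S.wtM (S.negM a))) ⟨?_, ?_⟩)
  · refine (Z.mem_fil hχ i hi _).2 ?_
    exact Submodule.smul_mem _ _ (Submodule.subset_span ⟨_, hl, rfl⟩)
  · have h1 := Q.wt_smul _ _ (Z.basis.repr y (l, a)) _ (Z.basis_mem_wt l a)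
    rwa [one_tmul_smul] at h1

/-- The subquotients of the filtration are baby Verma modules. -/
theorem exists_equiv (hχ : S.IsStandardLeviForm χ I) (i : Fin r)
    {F F' : Submodule (S.U χ ⊗[K] A) Q.carrier} (hF : F = Z.fil i) (hF' : F' = Z.fil (i + 1)) :
    ∃ φ : (F' ⧸ F.submoduleOf F') ≃ₗ[S.U χ ⊗[K] A] BabyVerma S χ π (Z.μ i),
      ∀ ξ w (z : BabyVerma S χ π (Z.μ i)), z ∈ babyVermaWt S χ I π (Z.μ i) ξ w ↔
        ∃ y : F', (y : Q.carrier) ∈ Q.wt ξ w ∧ φ (Submodule.Quotient.mk y) = z := by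
  subst hF hF'
  have hvi : Z.v i ∈ Z.fil (i + 1) := Submodule.subset_span ⟨i, Nat.lt_succ_self _, rfl⟩
  let q := ((Z.fil i).submoduleOf (Z.fil (i + 1))).mkQ
  have hq : ∀ y, q y = 0 ↔ (y : Q.carrier) ∈ Z.fil i := by
    intro y
    rw [Submodule.mkQ_apply, Submodule.Quotient.mk_eq_zero]
    rfl
  let v' : Z.fil (i + 1) := ⟨Z.v i, hvi⟩
  have hv := Q.wt_torus' (Z.v_mem i)
  obtain ⟨f, hf⟩ := exists_bvHom (π := π) (μ := Z.μ i) (v := q v')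
    (fun x => by
      rw [← map_smul, ← map_smul]
      exact congrArg q (Subtype.ext (hv x)))
    (fun α hα => by
      rw [← map_smul, hq]
      exact Z.e_smul_mem_fil i hα)
  have hfs : ∀ x : S.U χ ⊗[K] A, f (x • bvGen χ π (Z.μ i)) = q (x • v') := by
    intro x
    rw [map_smul, hf, map_smul]
  have hinj : Function.Injective f := by
    rw [injective_iff_map_eq_zero]
    intro z hz
    obtain ⟨c, rfl⟩ := exists_eq_negSum_smul_bvGen hχ (Z.μ i) z
    rw [hfs, hq] at hz
    -- The coordinates of the image at (i, a) are the c a, whereas those of an element of the i-th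
    -- step vanish.
    have hc : c = 0 := by
      funext a
      have h1 := Z.repr_eq_zero hχ i.2.le hz le_rfl a
      rw [show ((S.negSum χ c • v' : Z.fil (i + 1)) : Q.carrier) = S.negSum χ c • Z.v i from rfl,
        repr_negSum_smul, if_pos rfl] at h1
      exact h1
    simp [hc, negSum]
  have hsurj : Function.Surjective f := by
    intro y
    obtain ⟨⟨y, hy⟩, rfl⟩ := Submodule.mkQ_surjective _ y
    have hy' := hy
    rw [Z.fil_succ, Submodule.mem_sup] at hy'
    obtain ⟨y₁, hy₁, y₂, hy₂, h⟩ := hy'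
    obtain ⟨x, rfl⟩ := Submodule.mem_span_singleton.1 hy₁
    refine ⟨x • bvGen χ π (Z.μ i), ?_⟩
    rw [hfs]
    refine (sub_eq_zero.1 ?_).symm
    rw [← map_sub]
    refine (hq _).2 ?_
    rw [AddSubgroupClass.coe_sub]
    change y - x • Z.v i ∈ _
    rwa [← h, add_sub_cancel_left]
  refine ⟨(LinearEquiv.ofBijective f ⟨hinj, hsurj⟩).symm, fun ξ w z => ?_⟩
  have hφ : ∀ y : Z.fil (i + 1), (LinearEquiv.ofBijective f ⟨hinj, hsurj⟩).symm
      (Submodule.Quotient.mk y) = z ↔ q y = f z := by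
    intro y
    rw [LinearEquiv.symm_apply_eq]
    rfl
  simp only [hφ]
  constructor
  · intro hz
    induction hz using AddSubgroup.closure_induction with
    | zero => exact ⟨0, zero_mem _, by rw [map_zero, map_zero]⟩
    | add x y _ _ hx hy =>
      -- `hφ` depends on z, so the induction hypotheses carry it as a premise.
      obtain ⟨y₁, h₁, h₁'⟩ := hx fun y => by rw [LinearEquiv.symm_apply_eq]; rfl
      obtain ⟨y₂, h₂, h₂'⟩ := hy fun y => by rw [LinearEquiv.symm_apply_eq]; rfl
      exact ⟨y₁ + y₂, add_mem h₁ h₂, by rw [map_add, h₁', h₂', map_add]⟩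
    | neg x _ hx =>
      obtain ⟨y, h, h'⟩ := hx fun y => by rw [LinearEquiv.symm_apply_eq]; rfl
      exact ⟨-y, neg_mem h, by rw [map_neg, h', map_neg]⟩
    | mem z hz =>
      obtain ⟨u, hu, a, rfl⟩ := hz
      refine ⟨(u ⊗ₜ[K] a) • v', ?_, ?_⟩
      · have h1 := Q.Uwt_smul_mem_wt (Z.v_mem i) hu
        rw [sub_add_cancel, sub_add_cancel] at h1
        have h2 := Q.wt_smul _ _ a _ h1
        rwa [← tmul_smul_eq] at h2
      · rw [← hfs, smul_bvGen]
  · rintro ⟨y, hy, hyz⟩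
    obtain ⟨c, rfl⟩ := exists_eq_negSum_smul_bvGen hχ (Z.μ i) z
    rw [hfs, ← sub_eq_zero, ← map_sub, hq] at hyz
    -- y and the negative combination of v i agree modulo the i-th step. As y is homogeneous,
    -- `mem_wt` then forces degree and weight of every negative monomial with nonzero coefficient.
    have hc : ∀ a, c a = Z.basis.repr (y : Q.carrier) (i, a) := by
      intro a
      have h1 := Z.repr_eq_zero hχ i.2.le hyz le_rfl a
      rw [show ((y - S.negSum χ c • v' : Z.fil (i + 1)) : Q.carrier) =
        y - S.negSum χ c • Z.v i from rfl, map_sub, Finsupp.sub_apply,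
        repr_negSum_smul, if_pos rfl, sub_eq_zero] at h1
      exact h1.symm
    rw [smul_bvGen, negSum, map_sum]
    refine sum_mem fun a _ => ?_
    by_cases h0 : c a = 0
    · rw [h0, TensorProduct.tmul_zero, map_zero]
      exact zero_mem _
    · rw [hc] at h0
      obtain ⟨rfl, rfl⟩ := Z.mem_wt ξ w y hy i a h0
      refine AddSubgroup.subset_closure ⟨_, ?_, _, rfl⟩
      rw [QuotientAddGroup.mk_add, add_sub_cancel_left, diff_add, add_sub_cancel_left]
      exact ordU_mem_Uwt _

theorem hasZFiltration (Z : ZBasis Q r) (hχ : S.IsStandardLeviForm χ I) : Q.HasZFiltration := by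
  refine ⟨r, fun i => Z.fil i, fun i j h => Z.fil_mono h, ?_, ?_,
    fun i => Z.fil_eq_iSup hχ i (Nat.lt_succ_iff.1 i.2),
    fun i => ⟨Z.μ i, Z.exists_equiv hχ i rfl rfl⟩⟩
  · simp [fil]
  · rw [eq_top_iff]
    intro y _
    refine (Z.mem_fil hχ r le_rfl y).2 ?_
    have : {x : Fin r × S.NegExp | (x.1 : ℕ) < r} = Set.univ := Set.eq_univ_of_forall fun x => x.1.2
    rw [this, Set.image_univ]
    exact Z.basis.mem_span y

end ZBasis

end Filtration

end

section

open ReductiveGroup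

variable {K : Type u} [Field K] {p : ℕ} {S : ReductiveGroup K p} {χ : Module.Dual K S.g}
  {I : Set S.R} {A : Type v} [CommRing A] [Algebra K A] {π : S.U0 →ₐ[K] A}

/-- A finite type can be enumerated by decreasing values of a given function. -/
theorem exists_equiv_antitone {T : Type*} [Finite T] (f : T → ℤ) :
    ∃ (r : ℕ) (o : Fin r ≃ T), Antitone (f ∘ o) := by
  obtain ⟨r, ⟨e⟩⟩ := Finite.exists_equiv_fin T
  refine ⟨r, (Tuple.sort fun i => -f (e.symm i)).trans e.symm, fun i j h => ?_⟩
  exact neg_le_neg_iff.1 (Tuple.monotone_sort (fun i => -f (e.symm i)) h)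

/-! ### Z-filtrations of the free objects -/

namespace CA

section

variable {k : ℕ} (lam : Fin k → S.X)

variable (π) in
/-- The product of a monomial in the positive root vectors with a generator. -/
def posVec (t : Fin k × S.PosExp) : FreeMod χ π lam :=
  (S.ordU χ (S.posM t.2) ⊗ₜ[K] (1 : A)) • gen π lam t.1

/-- The weight of `posVec`. -/
def posWt (t : Fin k × S.PosExp) : S.X := lam t.1 + S.wtM (S.posM t.2)

open Classical in
variable (S) in
/-- Splitting exponents into those on positive and those on negative roots. -/
def splitExp (k : ℕ) : (Σ _ : Fin k, S.R → Fin p) ≃ (Fin k × S.PosExp) × S.NegExp :=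
  (Equiv.sigmaEquivProd _ _).trans (((Equiv.refl _).prodCongr
    (Equiv.piEquivPiSubtypeProd (fun α => S.IsPos α) fun _ => Fin p)).trans
      (Equiv.prodAssoc _ _ _).symm)

theorem freeWt_eq (x : Σ _ : Fin k, S.R → Fin p) :
    freeWt lam x = posWt lam (splitExp S k x).1 + S.wtM (S.negM (splitExp S k x).2) := by
  obtain ⟨j, n⟩ := x
  rw [freeWt, mset_eq_negM_add_posM, wtM_add, add_comm (S.wtM _), ← add_assoc]
  rfl

variable [Fact p.Prime] [CharP K p]

theorem e_smul_posVec_mem (hχ : S.IsStandardLeviForm χ I) {α : S.R} (hα : S.IsPos α)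
    (t : Fin k × S.PosExp) :
    (S.ofLie χ (S.e α) ⊗ₜ[K] (1 : A)) • posVec π lam t ∈ Submodule.span A
      (posVec (χ := χ) π lam ''
        {t' | ((S.posM t.2).map S.hgt).sum < ((S.posM t'.2).map S.hgt).sum}) := by
  have h : (S.ofLie χ (S.e α) ⊗ₜ[K] (1 : A)) • posVec π lam t =
      ((S.ofLie χ (S.e α) * S.ordU χ (S.posM t.2)) ⊗ₜ[K] (1 : A)) • gen π lam t.1 :=
    (mul_tmul_one_smul (A := A) (V := FreeMod χ π lam) (S.ofLie χ (S.e α)) (S.ordU χ (S.posM t.2))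
      (gen π lam t.1)).symm
  rw [h]
  refine Submodule.span_mono ?_
    (tmul_smul_mem_span (A := A) (e_mul_ordU_posM_mem hχ hα t.2) (gen π lam t.1))
  rintro _ ⟨_, ⟨b, hb, rfl⟩, rfl⟩
  exact ⟨(t.1, b), hb, rfl⟩

theorem freeBasis_eq (hχ : S.IsStandardLeviForm χ I) (x : Σ _ : Fin k, S.R → Fin p) :
    freeBasis π hχ lam x = (S.ordU χ (S.negM (splitExp S k x).2) ⊗ₜ[K] (1 : A)) •
      posVec π lam (splitExp S k x).1 := by
  obtain ⟨j, n⟩ := x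
  rw [freeBasis_apply, mset_eq_negM_add_posM, ordU_negM_add_posM]
  exact mul_tmul_one_smul (A := A) (V := FreeMod χ π lam) (S.ordU χ (S.negM fun α => n α.1))
    (S.ordU χ (S.posM fun α => n α.1)) (gen π lam j)

/-- The vectors of the `ZBasis` are the positive restricted monomials applied to the generators, in
order of decreasing height; raising the height therefore means moving to an earlier vector. -/
theorem hasZFiltration_free (hχ : S.IsStandardLeviForm χ I) : (free π hχ lam).HasZFiltration := by
  obtain ⟨r, o, ho⟩ := exists_equiv_antitone
    fun t : Fin k × S.PosExp => ((S.posM t.2).map S.hgt).sum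
  let E : (Σ _ : Fin k, S.R → Fin p) ≃ Fin r × S.NegExp :=
    (splitExp S k).trans (o.symm.prodCongr (Equiv.refl _))
  have hE : ∀ i a, splitExp S k (E.symm (i, a)) = (o i, a) := by
    intro i a
    simp [E]
  have h1 : ∀ i a, (freeBasis π hχ lam).reindex E (i, a) =
      (S.ordU χ (S.negM a) ⊗ₜ[K] (1 : A)) • posVec π lam (o i) := by
    intro i a
    rw [Module.Basis.reindex_apply, freeBasis_eq, hE]
  have h2 : ∀ i α, S.IsPos α → (S.ofLie χ (S.e α) ⊗ₜ[K] (1 : A)) • posVec (χ := χ) π lam (o i) ∈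
      Submodule.span A ((fun i => posVec (χ := χ) π lam (o i)) '' {l | l < i}) := by
    intro i α hα
    refine Submodule.span_mono ?_ (e_smul_posVec_mem lam hχ hα (o i))
    rintro _ ⟨t, ht, rfl⟩
    refine ⟨o.symm t, ?_, by beta_reduce; rw [Equiv.apply_symm_apply]⟩
    -- The enumeration is only weakly antitone, but a strictly larger height still forces a strictly
    -- smaller index.
    by_contra h
    have h1 := ho (not_lt.1 h)
    simp only [Function.comp_apply, Equiv.apply_symm_apply] at h1
    exact absurd ht (not_lt.2 h1)
  have h3 : ∀ ξ w (y : FreeMod χ π lam),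
      y ∈ Submodule.span A (freeBasis π hχ lam '' wtIdx I (freeWt lam) ξ w) →
      ∀ i a, ((freeBasis π hχ lam).reindex E).repr y (i, a) ≠ 0 →
        QuotientAddGroup.mk (posWt lam (o i) + S.wtM (S.negM a)) = ξ ∧
          S.diff (posWt lam (o i) + S.wtM (S.negM a)) = w := by
    intro ξ w y hy i a h
    rw [Module.Basis.mem_span_image] at hy
    rw [Module.Basis.repr_reindex_apply] at h
    have h2 := hy (Finsupp.mem_support_iff.2 h)
    have h3 := freeWt_eq lam (E.symm (i, a))
    rw [hE] at h3
    rw [← h3]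
    exact h2
  have h4 : ∀ i, posVec π lam (o i) ∈ (free π hχ lam).wt
      (QuotientAddGroup.mk (posWt lam (o i))) (S.diff (posWt lam (o i))) := fun i =>
    (free π hχ lam).ordU_smul_mem_wt (gen_mem_wt π hχ lam (o i).1) _
  -- The carrier of `free` is `FreeMod` by definition; its A-structure is transported along this.
  let _ : Module A (free π hχ lam).carrier := (inferInstance : Module A (FreeMod χ π lam))
  have : IsScalarTower A (S.U χ ⊗[K] A) (free π hχ lam).carrier :=
    (inferInstance : IsScalarTower A (S.U χ ⊗[K] A) (FreeMod χ π lam))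
  exact ZBasis.hasZFiltration (Q := free π hχ lam) (r := r)
    ⟨fun i => posVec π lam (o i), fun i => posWt lam (o i), (freeBasis π hχ lam).reindex E, h1, h4,
      h2, h3⟩ hχ

end

end CA

end

end GradedLevi

end

theorem mainTheorem7 {K : Type u} [Field K] [IsAlgClosed K] {p : ℕ} [Fact p.Prime] [CharP K p]
    (S : GradedLevi.ReductiveGroup K p) (χ : Module.Dual K S.g) (I : Set S.R)
    (hχ : S.IsStandardLeviForm χ I)
    {A : Type v} [CommRing A] [IsNoetherianRing A] [Algebra K A] (π : S.U0 →ₐ[K] A)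
    (M : GradedLevi.CA S χ I π) :
    ∃ (Q : GradedLevi.CA S χ I π) (f : Q ⟶ M),
      CategoryTheory.Projective Q ∧ Function.Surjective (GradedLevi.CA.linearMap f) ∧
        Q.HasZFiltration := by
  obtain ⟨k, lam, m, hm, htop⟩ := M.exists_generators
  obtain ⟨f, hf⟩ := GradedLevi.CA.exists_freeHom hχ lam M m hm
  refine ⟨_, f, GradedLevi.CA.projective_free hχ lam, ?_,
    GradedLevi.CA.hasZFiltration_free lam hχ⟩
  -- The range is a submodule that contains the generators m j of M.
  rw [← LinearMap.range_eq_top, eq_top_iff, ← htop, Submodule.span_le]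
  rintro _ ⟨j, rfl⟩
  exact ⟨_, hf j⟩
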